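/- Let $C=C_{4\pi}$ be the Euclidean cone of angle $4\pi$, i.e. $[0,\infty)_r\times(\mathbb R/4\pi\mathbb Z)_\theta$ with all points $(0,\theta)$ identified to the tip $p$, with the metric $dr^2+r^2d\theta^2$ and the measure $r\,dr\,d\theta$, and let $C^\circ=C\setminus\{p\}$. Let $\Delta=-(\partial_r^2+r^{-1}\partial_r+r^{-2}\partial_\theta^2)$, regarded as an unbounded operator on $L^2(C)$ with domain $C_c^\infty(C^\circ)$, let $\overline\Delta$ be its closure and $\overline\Delta^{*}$ the adjoint of the closure. Let $H^2(C)$ be the space of all $u\in L^2(C)$ whose weak derivatives on $C^\circ$ of order at most $2$ with respect to the constant vector fields $\partial_x=\cos\theta\,\partial_r-r^{-1}\sin\theta\,\partial_\theta$ and $\partial_y=\sin\theta\,\partial_r+r^{-1}\cos\theta\,\partial_\theta$ lie in $L^2(C)$. A function on $C^\circ$, taken up to null sets, is said to have the value $c$ at $p$ if it has a representative that is continuous on $C^\circ$ and tends to $c$ as $r\to0$. A radial cutoff is a real function $\rho=\rho(r)$, smooth on $(0,\infty)$, identically $1$ near $r=0$ and vanishing for all large $r$. 1. The domain of $\overline\Delta$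 is $$\operatorname{Dom}(\overline\Delta)=\{u\in H^2(C): u(p)=0\}.$$ 2. For every radial cutoff $\rho$ (in particular, if $\rho\equiv1$ for $r\le1$ and $\rho\equiv0$ for $r\ge2$), the functions $\rho$, $\rho\log r$, $\rho\,r^{1/2}e^{\pm i\theta/2}$ and $\rho\,r^{-1/2}e^{\pm i\theta/2}$ lie in $L^2(C)$, and $$\operatorname{Dom}(\overline\Delta^{*})=\operatorname{Dom}(\overline\Delta)\oplus\operatorname{span}_{\mathbb C}\bigl\{\rho,\ \rho\log r,\ \rho\,r^{1/2}e^{\pm i\theta/2},\ \rho\,r^{-1/2}e^{\pm i\theta/2}\bigr\}.$$ 3. Let $\mathcal D_2$ be the domain of the Friedrichs extension of $\Delta$, i.e. of the restriction of the adjoint of $\Delta$ to those elements of its domain that lie in the form domain of $\Delta$; the form domain consists of the $L^2$-limits of those $L^2$-convergent sequences in $C_c^\infty(C^\circ)$ that are Cauchy with respect to the quadratic form $\langle\varphi,\Delta\varphi\rangle$. For every radial cutoff $\rho$ and every $u\in\mathcal D_2$ there are $a_{-1},a_0,a_1\in\mathbb C$ and $v\in\operatorname{Dom}(\overline\Delta)$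 with $$u=\bigl(a_0+a_{-1}\sqrt r\,e^{-i\theta/2}+a_1\sqrt r\,e^{i\theta/2}\bigr)\rho(r)+v,$$ and the function $u-a_0-a_{-1}\sqrt r\,e^{-i\theta/2}-a_1\sqrt r\,e^{i\theta/2}$ has the value $0$ at $p$. -/

import Mathlib

open MeasureTheory Filter Topology Set
open scoped ContDiff ENNReal InnerProductSpace

noncomputable section

namespace FlatCone

/-- The angular variable `θ ∈ ℝ / 4πℤ`. -/
abbrev Angle : Type := AddCircle (4 * Real.pi)

instance : Fact ((0 : ℝ) < 4 * Real.pi) := ⟨by positivity⟩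

/-- Polar coordinates `(r, θ)`. The cone without its tip is the open set `punctured` of all `(r, θ)`
with `r > 0`; the points with `r ≤ 0` are not points of the cone, they carry no mass
(see `coneMeasure`), and test functions vanish there. -/
abbrev Coord : Type := ℝ × Angle

/-- The cone of angle `4π` without its tip, `C° = (0, ∞) × ℝ / 4πℤ`. -/
def punctured : Set Coord := {p | 0 < p.1}

/-- The Riemannian measure `r dr dθ` of the metric `dr² + r² dθ²` on `C°`. -/
def coneMeasure : Measure Coord :=
  ((volume.restrict (Ioi (0 : ℝ))).withDensity fun r => ENNReal.ofReal r).prod volume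

/-- The Hilbert space `L²(C)` of the cone. -/
abbrev ConeL2 : Type := Lp ℂ 2 coneMeasure

/-- The function `e^{i n θ / 2}`, which is well defined for `θ ∈ ℝ / 4πℤ`. -/
def halfExp (n : ℤ) (θ : Angle) : ℂ := fourier n θ

theorem halfExp_coe (n : ℤ) (t : ℝ) :
    halfExp n (t : Angle) = Complex.exp (Complex.I * n * t / 2) := by
  have h : (Real.pi : ℂ) ≠ 0 := by exact_mod_cast Real.pi_ne_zero
  rw [halfExp, fourier_coe_apply]
  congr 1
  push_cast
  field_simp
  ring

/-- The cosine on `ℝ / 4πℤ`. -/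
def cosAngle (θ : Angle) : ℝ := (halfExp 2 θ).re

/-- The sine on `ℝ / 4πℤ`. -/
def sinAngle (θ : Angle) : ℝ := (halfExp 2 θ).im

theorem cosAngle_coe (t : ℝ) : cosAngle (t : Angle) = Real.cos t := by
  have h : Complex.I * ((2 : ℤ) : ℂ) * (t : ℂ) / 2 = (t : ℂ) * Complex.I := by push_cast; ring
  rw [cosAngle, halfExp_coe, h, Complex.exp_ofReal_mul_I_re]

theorem sinAngle_coe (t : ℝ) : sinAngle (t : Angle) = Real.sin t := by
  have h : Complex.I * ((2 : ℤ) : ℂ) * (t : ℂ) / 2 = (t : ℂ) * Complex.I := by push_cast; ring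
  rw [sinAngle, halfExp_coe, h, Complex.exp_ofReal_mul_I_im]

/-! ### Test functions and differential operators -/

/-- A function on the cone, read in the coordinates `(r, t) ∈ ℝ × ℝ` of the universal cover. -/
def lift (φ : Coord → ℂ) (x : ℝ × ℝ) : ℂ := φ (x.1, (x.2 : Angle))

/-- The partial derivative `∂φ/∂r`. -/
def dr (φ : Coord → ℂ) (p : Coord) : ℂ := deriv (fun s : ℝ => φ (s, p.2)) p.1

/-- The partial derivative `∂φ/∂θ`. -/
def dtheta (φ : Coord → ℂ) (p : Coord) : ℂ := deriv (fun s : ℝ => φ (p.1, p.2 + (s : Angle))) 0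

/-- The space `C_c^∞(C°)` of complex valued smooth functions with compact support in the cone
without its tip (extended by zero to `r ≤ 0`). -/
def testFunctions : Submodule ℂ (Coord → ℂ) where
  carrier := {φ | ContDiff ℝ ∞ (lift φ) ∧ HasCompactSupport φ ∧ tsupport φ ⊆ punctured}
  zero_mem' := ⟨contDiff_const, HasCompactSupport.zero, by simp [tsupport]⟩
  add_mem' := by
    rintro φ ψ ⟨h1, h2, h3⟩ ⟨k1, k2, k3⟩
    exact ⟨h1.add k1, h2.add k2, (tsupport_add φ ψ).trans (union_subset h3 k3)⟩
  smul_mem' := by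
    rintro c φ ⟨h1, h2, h3⟩
    exact ⟨contDiff_const.smul h1, h2.smul_left (f := fun _ => c),
      (tsupport_smul_subset_right (fun _ => c) φ).trans h3⟩

/-- The (nonnegative) Laplace operator `Δ = -(∂_r² + r⁻¹ ∂_r + r⁻² ∂_θ²)` of the flat metric
`dr² + r² dθ²`, on functions. -/
def laplace (φ : Coord → ℂ) (p : Coord) : ℂ :=
  -(dr (dr φ) p + (p.1 : ℂ)⁻¹ * dr φ p + ((p.1 : ℂ) ^ 2)⁻¹ * dtheta (dtheta φ) p)

/-- The constant vector field `∂_x = cos θ ∂_r - r⁻¹ sin θ ∂_θ`, where `x = r cos θ`. -/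
def dx (φ : Coord → ℂ) (p : Coord) : ℂ :=
  (cosAngle p.2 : ℂ) * dr φ p - (p.1 : ℂ)⁻¹ * (sinAngle p.2 : ℂ) * dtheta φ p

/-- The constant vector field `∂_y = sin θ ∂_r + r⁻¹ cos θ ∂_θ`, where `y = r sin θ`. -/
def dy (φ : Coord → ℂ) (p : Coord) : ℂ :=
  (sinAngle p.2 : ℂ) * dr φ p + (p.1 : ℂ)⁻¹ * (cosAngle p.2 : ℂ) * dtheta φ p

theorem hasFDerivAt_lift {φ : Coord → ℂ} (h : φ ∈ testFunctions) (x : ℝ × ℝ) :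
    HasFDerivAt (lift φ) (fderiv ℝ (lift φ) x) x :=
  (h.1.differentiable (by simp) x).hasFDerivAt

theorem lift_dr_eq {φ : Coord → ℂ} (h : φ ∈ testFunctions) :
    lift (dr φ) = fun x => fderiv ℝ (lift φ) x (1, 0) := by
  funext x
  have h2 : HasDerivAt (fun s : ℝ => ((s, x.2) : ℝ × ℝ)) (1, 0) x.1 :=
    (hasDerivAt_id x.1).prodMk (hasDerivAt_const x.1 x.2)
  rw [← ((hasFDerivAt_lift h x).comp_hasDerivAt x.1 h2).deriv]
  rfl

theorem lift_dtheta_eq {φ : Coord → ℂ} (h : φ ∈ testFunctions) :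
    lift (dtheta φ) = fun x => fderiv ℝ (lift φ) x (0, 1) := by
  funext x
  have h2 : HasDerivAt (fun s : ℝ => ((x.1, x.2 + s) : ℝ × ℝ)) (0, 1) 0 :=
    (hasDerivAt_const (0 : ℝ) x.1).prodMk ((hasDerivAt_id (0 : ℝ)).const_add x.2)
  have h0 : HasFDerivAt (lift φ) (fderiv ℝ (lift φ) x) ((x.1, x.2 + 0) : ℝ × ℝ) := by
    simpa using hasFDerivAt_lift h x
  have h3 := (h0.comp_hasDerivAt (0 : ℝ) h2).deriv
  rw [← h3]
  rfl

theorem dr_eq_zero {φ : Coord → ℂ} {p : Coord} (h : p ∉ tsupport φ) : dr φ p = 0 := by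
  have h1 : φ =ᶠ[𝓝 p] 0 := notMem_tsupport_iff_eventuallyEq.1 h
  have h2 : Tendsto (fun s : ℝ => ((s, p.2) : Coord)) (𝓝 p.1) (𝓝 p) :=
    (by fun_prop : Continuous fun s : ℝ => ((s, p.2) : Coord)).tendsto' _ _ rfl
  have h3 : (fun s : ℝ => φ (s, p.2)) =ᶠ[𝓝 p.1] fun _ => 0 := h2.eventually h1
  rw [dr, h3.deriv_eq, deriv_const]

theorem dtheta_eq_zero {φ : Coord → ℂ} {p : Coord} (h : p ∉ tsupport φ) : dtheta φ p = 0 := by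
  have h1 : φ =ᶠ[𝓝 p] 0 := notMem_tsupport_iff_eventuallyEq.1 h
  have hc : Continuous fun s : ℝ => ((p.1, p.2 + (s : Angle)) : Coord) :=
    continuous_const.prodMk (continuous_const.add (AddCircle.continuous_mk' _))
  have h2 : Tendsto (fun s : ℝ => ((p.1, p.2 + (s : Angle)) : Coord)) (𝓝 0) (𝓝 p) :=
    hc.tendsto' _ _ (by simp)
  have h3 : (fun s : ℝ => φ (p.1, p.2 + (s : Angle))) =ᶠ[𝓝 0] fun _ => 0 := h2.eventually h1
  rw [dtheta, h3.deriv_eq, deriv_const]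

/-- A function with smooth lift that vanishes off the support of a test function is a test
function. -/
theorem mem_of_support {φ ψ : Coord → ℂ} (h : φ ∈ testFunctions) (h1 : ContDiff ℝ ∞ (lift ψ))
    (h2 : ∀ p, p ∉ tsupport φ → ψ p = 0) : ψ ∈ testFunctions := by
  have hs : tsupport ψ ⊆ tsupport φ :=
    closure_minimal (fun p hp => by by_contra hn; exact hp (h2 p hn)) (isClosed_tsupport φ)
  exact ⟨h1, h.2.1.of_isClosed_subset (isClosed_tsupport ψ) hs, hs.trans h.2.2⟩

theorem lift_injective {φ ψ : Coord → ℂ} (h : lift φ = lift ψ) : φ = ψ := by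
  funext p
  obtain ⟨t, ht⟩ := QuotientAddGroup.mk_surjective p.2
  have := congrFun h (p.1, t)
  simp only [lift] at this
  rwa [show ((t : ℝ) : Angle) = p.2 from ht] at this

theorem continuous_of_mem {φ : Coord → ℂ} (h : φ ∈ testFunctions) : Continuous φ := by
  have hq : IsOpenQuotientMap (fun x : ℝ × ℝ => ((x.1, (x.2 : Angle)) : Coord)) :=
    IsOpenQuotientMap.id.prodMap QuotientAddGroup.isOpenQuotientMap_mk
  exact hq.continuous_comp_iff.1 h.1.continuous

theorem dr_mem {φ : Coord → ℂ} (h : φ ∈ testFunctions) : dr φ ∈ testFunctions := by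
  refine mem_of_support h ?_ fun p hp => dr_eq_zero hp
  rw [lift_dr_eq h]
  exact (h.1.fderiv_right (m := ∞) (by simp)).clm_apply contDiff_const

theorem dtheta_mem {φ : Coord → ℂ} (h : φ ∈ testFunctions) : dtheta φ ∈ testFunctions := by
  refine mem_of_support h ?_ fun p hp => dtheta_eq_zero hp
  rw [lift_dtheta_eq h]
  exact (h.1.fderiv_right (m := ∞) (by simp)).clm_apply contDiff_const

theorem mul_mem {φ : Coord → ℂ} (h : φ ∈ testFunctions) {g : Coord → ℂ}
    (hg : ∀ x : ℝ × ℝ, 0 < x.1 → ContDiffAt ℝ ∞ (lift g) x) :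
    (fun p => g p * φ p) ∈ testFunctions := by
  refine mem_of_support h ?_ fun p hp => by simp [image_eq_zero_of_notMem_tsupport hp]
  refine contDiff_iff_contDiffAt.2 fun x => ?_
  by_cases hx : 0 < x.1
  · exact (hg x hx).mul h.1.contDiffAt
  · have hp : ((x.1, (x.2 : Angle)) : Coord) ∉ tsupport φ := fun hp => hx (h.2.2 hp)
    have h1 : φ =ᶠ[𝓝 ((x.1, (x.2 : Angle)) : Coord)] 0 := notMem_tsupport_iff_eventuallyEq.1 hp
    have hc : Continuous fun y : ℝ × ℝ => ((y.1, (y.2 : Angle)) : Coord) :=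
      continuous_fst.prodMk ((AddCircle.continuous_mk' _).comp continuous_snd)
    have h2 : ∀ᶠ y in 𝓝 x, φ (y.1, (y.2 : Angle)) = 0 := (hc.tendsto x).eventually h1
    have h3 : lift (fun p => g p * φ p) =ᶠ[𝓝 x] fun _ => 0 := by
      filter_upwards [h2] with y hy
      simp [lift, hy]
    exact contDiffAt_const.congr_of_eventuallyEq h3

theorem contDiffAt_ofReal_fst (x : ℝ × ℝ) :
    ContDiffAt ℝ ∞ (fun y : ℝ × ℝ => (y.1 : ℂ)) x :=
  (Complex.ofRealCLM.contDiff.comp contDiff_fst).contDiffAt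

theorem laplace_mem {φ : Coord → ℂ} (h : φ ∈ testFunctions) : laplace φ ∈ testFunctions := by
  have h1 := mul_mem (dr_mem h) (g := fun p => (p.1 : ℂ)⁻¹) fun x hx =>
    (contDiffAt_ofReal_fst x).inv (by exact_mod_cast hx.ne')
  have h2 := mul_mem (dtheta_mem (dtheta_mem h)) (g := fun p => ((p.1 : ℂ) ^ 2)⁻¹) fun x hx =>
    ((contDiffAt_ofReal_fst x).pow 2).inv (pow_ne_zero 2 (by exact_mod_cast hx.ne'))
  exact testFunctions.neg_mem (testFunctions.add_mem
    (testFunctions.add_mem (dr_mem (dr_mem h)) h1) h2)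

theorem dr_add {φ ψ : Coord → ℂ} (h : φ ∈ testFunctions) (k : ψ ∈ testFunctions) :
    dr (φ + ψ) = dr φ + dr ψ := by
  apply lift_injective
  change _ = lift (dr φ) + lift (dr ψ)
  rw [lift_dr_eq h, lift_dr_eq k, lift_dr_eq (testFunctions.add_mem h k)]
  funext x
  change fderiv ℝ (lift φ + lift ψ) x (1, 0) = _
  rw [fderiv_add (hasFDerivAt_lift h x).differentiableAt (hasFDerivAt_lift k x).differentiableAt]
  rfl

theorem dtheta_add {φ ψ : Coord → ℂ} (h : φ ∈ testFunctions) (k : ψ ∈ testFunctions) :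
    dtheta (φ + ψ) = dtheta φ + dtheta ψ := by
  apply lift_injective
  change _ = lift (dtheta φ) + lift (dtheta ψ)
  rw [lift_dtheta_eq h, lift_dtheta_eq k, lift_dtheta_eq (testFunctions.add_mem h k)]
  funext x
  change fderiv ℝ (lift φ + lift ψ) x (0, 1) = _
  rw [fderiv_add (hasFDerivAt_lift h x).differentiableAt (hasFDerivAt_lift k x).differentiableAt]
  rfl

theorem dr_smul (c : ℂ) (φ : Coord → ℂ) : dr (c • φ) = c • dr φ := by
  funext p
  exact deriv_const_mul_field c

theorem dtheta_smul (c : ℂ) (φ : Coord → ℂ) : dtheta (c • φ) = c • dtheta φ := by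
  funext p
  exact deriv_const_mul_field c

/-- The Laplace operator as a linear map on test functions. -/
def laplaceTest : testFunctions →ₗ[ℂ] testFunctions where
  toFun φ := ⟨laplace φ, laplace_mem φ.2⟩
  map_add' φ ψ := by
    ext p
    simp only [laplace, Submodule.coe_add, dr_add φ.2 ψ.2, dr_add (dr_mem φ.2) (dr_mem ψ.2),
      dtheta_add φ.2 ψ.2, dtheta_add (dtheta_mem φ.2) (dtheta_mem ψ.2), Pi.add_apply]
    ring
  map_smul' c φ := by
    ext p
    simp only [laplace, Submodule.coe_smul, dr_smul, dtheta_smul, Pi.smul_apply, smul_eq_mul,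
      RingHom.id_apply]
    ring

/-! ### The Laplace operator as an unbounded operator on `L²(C)` -/

instance : IsLocallyFiniteMeasure
    ((volume.restrict (Ioi (0 : ℝ))).withDensity fun r => ENNReal.ofReal r) :=
  IsLocallyFiniteMeasure.withDensity_coe (f := Real.toNNReal) continuous_real_toNNReal

instance : IsLocallyFiniteMeasure coneMeasure := by
  unfold coneMeasure
  infer_instance

theorem memLp_of_mem {φ : Coord → ℂ} (h : φ ∈ testFunctions) : MemLp φ 2 coneMeasure :=
  (continuous_of_mem h).memLp_of_hasCompactSupport h.2.1

/-- The inclusion `C_c^∞(C°) → L²(C)`. -/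
def testToL2 : testFunctions →ₗ[ℂ] ConeL2 where
  toFun φ := (memLp_of_mem φ.2).toLp φ
  map_add' φ ψ := MemLp.toLp_add (memLp_of_mem φ.2) (memLp_of_mem ψ.2)
  map_smul' c φ := MemLp.toLp_const_smul c (memLp_of_mem φ.2)

theorem restrict_absolutelyContinuous :
    (volume : Measure Coord).restrict punctured ≪ coneMeasure := by
  have h1 : (punctured : Set Coord) = Ioi (0 : ℝ) ×ˢ (univ : Set Angle) := by
    ext p; simp [punctured]
  have h2 : volume.restrict (Ioi (0 : ℝ)) ≪
      (volume.restrict (Ioi (0 : ℝ))).withDensity fun r => ENNReal.ofReal r := by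
    refine withDensity_absolutelyContinuous' (by fun_prop) ?_
    filter_upwards [ae_restrict_mem measurableSet_Ioi] with r hr
    simpa using hr
  rw [h1, Measure.volume_eq_prod, ← Measure.prod_restrict, Measure.restrict_univ]
  exact h2.prod Measure.AbsolutelyContinuous.rfl

theorem testToL2_injective : Function.Injective testToL2 := by
  rw [← LinearMap.ker_eq_bot, LinearMap.ker_eq_bot']
  rintro ⟨φ, h⟩ h0
  have h1 : φ =ᵐ[coneMeasure] 0 := by
    have h2 := (memLp_of_mem h).coeFn_toLp
    have h3 : (memLp_of_mem h).toLp φ = 0 := h0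
    rw [h3] at h2
    exact h2.symm.trans (Lp.coeFn_zero _ _ _)
  have h4 : EqOn φ 0 punctured := Measure.eqOn_open_of_ae_eq
    (restrict_absolutelyContinuous.ae_eq h1) (isOpen_lt continuous_const continuous_fst)
    (continuous_of_mem h).continuousOn continuousOn_const
  ext p
  by_cases hp : p ∈ punctured
  · exact h4 hp
  · exact image_eq_zero_of_notMem_tsupport fun hn => hp (h.2.2 hn)

/-- The Laplace operator of the cone as an unbounded operator on `L²(C)` with domain
`C_c^∞(C°)`. -/
def coneLaplacian : ConeL2 →ₗ.[ℂ] ConeL2 where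
  domain := LinearMap.range testToL2
  toFun := testToL2 ∘ₗ laplaceTest ∘ₗ
    (LinearEquiv.ofInjective testToL2 testToL2_injective).symm.toLinearMap

theorem coneLaplacian_apply (φ : testFunctions) :
    coneLaplacian ⟨testToL2 φ, LinearMap.mem_range_self _ φ⟩ = testToL2 (laplaceTest φ) := by
  exact congrArg (fun ψ => testToL2 (laplaceTest ψ))
    ((LinearEquiv.ofInjective testToL2 testToL2_injective).symm_apply_apply φ)

/-! ### Sobolev spaces, values at the tip, the Friedrichs domain -/

/-- `v` is the weak derivative `∂_x u` on `C°` (the field `∂_x` is divergence free). -/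
def IsWeakDx (u v : ConeL2) : Prop :=
  ∀ φ ∈ testFunctions, ∫ p, v p * φ p ∂coneMeasure = -∫ p, u p * dx φ p ∂coneMeasure

/-- `v` is the weak derivative `∂_y u` on `C°` (the field `∂_y` is divergence free). -/
def IsWeakDy (u v : ConeL2) : Prop :=
  ∀ φ ∈ testFunctions, ∫ p, v p * φ p ∂coneMeasure = -∫ p, u p * dy φ p ∂coneMeasure

/-- The Sobolev space `H^k(C)`: all weak derivatives of order at most `k` with respect to the
constant vector fields `∂_x`, `∂_y` are in `L²(C)`. -/
def MemSobolev : ℕ → ConeL2 → Prop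
  | 0, _ => True
  | k + 1, u => ∃ v w : ConeL2, IsWeakDx u v ∧ IsWeakDy u w ∧ MemSobolev k v ∧ MemSobolev k w

/-- The function `u` (taken up to null sets) has the value `c` at the tip `p` of the cone: it has a
representative that is continuous on `C°` and tends to `c` at the tip, where `r → 0`. -/
def HasValueAtTip (u : Coord → ℂ) (c : ℂ) : Prop :=
  ∃ g : Coord → ℂ, u =ᵐ[coneMeasure] g ∧ ContinuousOn g punctured ∧
    Tendsto g (comap Prod.fst (𝓝[>] (0 : ℝ))) (𝓝 c)

/-- The form domain of an unbounded operator `S`: the limits in `E` of those sequences in the domain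
of `S` that are Cauchy for the quadratic form `x ↦ ⟪x, S x⟫`. -/
def formDomain {E : Type*} [NormedAddCommGroup E] [InnerProductSpace ℂ E] (S : E →ₗ.[ℂ] E) :
    Set E :=
  {u | ∃ x : ℕ → S.domain, Tendsto (fun n => (x n : E)) atTop (𝓝 u) ∧
    Tendsto (fun q : ℕ × ℕ => inner ℂ ((x q.1 - x q.2 : S.domain) : E) (S (x q.1 - x q.2)))
      atTop (𝓝 0)}

/-- The domain of the Friedrichs extension of a densely defined nonnegative symmetric operator `S`:
the Friedrichs extension is the restriction of the adjoint of `S` to the elements of its domain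
that lie in the form domain. -/
def friedrichsDomain {E : Type*} [NormedAddCommGroup E] [InnerProductSpace ℂ E] [CompleteSpace E]
    (S : E →ₗ.[ℂ] E) : Set E :=
  {u | u ∈ S.adjoint.domain ∧ u ∈ formDomain S}

/-! ### Cutoffs and model functions at the tip -/

/-- A smooth radial cutoff `ρ = ρ(r)` with bounded support in `C` that is identically `1` near the
tip of the cone. -/
structure IsRadialCutoff (ρ : ℝ → ℝ) : Prop where
  smooth : ContDiffOn ℝ ∞ ρ (Ioi 0)
  eq_one : ∃ ε > 0, ∀ r, 0 < r → r ≤ ε → ρ r = 1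
  eq_zero : ∃ R, ∀ r, R ≤ r → ρ r = 0

/-- The functions `ρ`, `ρ log r`, `ρ r^{1/2} e^{± i θ / 2}` and `ρ r^{-1/2} e^{± i θ / 2}`. -/
def modelFunctions (ρ : ℝ → ℝ) : Set (Coord → ℂ) :=
  {fun p => (ρ p.1 : ℂ),
   fun p => ((ρ p.1 * Real.log p.1 : ℝ) : ℂ),
   fun p => ((ρ p.1 * p.1 ^ (1 / 2 : ℝ) : ℝ) : ℂ) * halfExp 1 p.2,
   fun p => ((ρ p.1 * p.1 ^ (1 / 2 : ℝ) : ℝ) : ℂ) * halfExp (-1) p.2,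
   fun p => ((ρ p.1 * p.1 ^ (-1 / 2 : ℝ) : ℝ) : ℂ) * halfExp 1 p.2,
   fun p => ((ρ p.1 * p.1 ^ (-1 / 2 : ℝ) : ℝ) : ℂ) * halfExp (-1) p.2}

/-- The complex span in `L²(C)` of the classes of the six model functions. -/
def modelSpan (ρ : ℝ → ℝ) : Submodule ℂ ConeL2 :=
  Submodule.span ℂ {w | ∃ f ∈ modelFunctions ρ, w =ᵐ[coneMeasure] f}

end FlatCone

end

/-! The operator is analysed through the constant fields `∂_x`, `∂_y`. They commute, they are
antisymmetric on test functions, and `Δ = -(∂_x² + ∂_y²)`. Hence `⟨φ, Δφ⟩` is the Dirichlet energy,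
and since the fields commute with `Δ`, the `L²` norm of each second derivative of a test function is
at most `‖Δφ‖` (`hessian_dxTest`, `hessian_dyTest`). A trace estimate for the gradient on circles
then gives `|φ| ≤ C (‖φ‖ + ‖Δφ‖) √r` (`norm_le_sqrt_of_test`). Both bounds survive limits in the
graph norm, so every element of the domain `D` of the closure lies in `H²` and vanishes at the tip.

The remaining inclusions come from a dimension count in `A / D`, where `A` is the domain of the
adjoint.

Upper bound: `Δ ≥ 0` makes the range of `Δ + 1` on `D` closed, and its orthogonal complement
consists of `L²` solutions of `Δu = -u`. Sending `u ∈ A` to the projection of `(Δ* + 1)u` onto this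
complement has kernel `D + ker(Δ* + 1)`, so `dim A/D ≤ 2 dim ker(Δ* + 1)`. In the coordinate `t =
log r` the `n`-th Fourier coefficient of a solution satisfies the modified Bessel equation `F'' =
(ν² + e^{2t}) F` with `ν = |n|/2`. Square integrability at infinity leaves only the decaying
solution, which grows at least like `r^{-ν}` at the tip and is therefore excluded for `ν ≥ 1`. For
`n = -1, 0, 1` a nonzero real solution has constant sign, so it is detected by pairing with one bump
function. Thus `ker(Δ* + 1)` embeds in `ℂ³` and `dim A/D ≤ 6`.

Lower bound: the six model functions are harmonic near the tip, so their cutoffs lie in `A`. They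
are independent modulo `D` (`modelSum_coeff_eq_zero`): first derivatives in `L²` exclude `log r` and
`r^{-1/2} e^{± iθ/2}`, second derivatives in `L²` exclude `r^{1/2} e^{± iθ/2}`, and the value at the
tip excludes the constant. Hence `A = D ⊕ span` (`adjoint_domain_eq`).

The same independence finishes the rest. A function in `H²` vanishing at the tip lies in `A`, and
its model part must vanish, so it lies in `D`. An element of the form domain has a weak derivative
`∂_x` in `L²`, so an element of the Friedrichs domain has no `log r` and no `r^{-1/2}` term. -/

namespace FlatCone

/-! ### Calculus on the punctured cone -/

/-- Smooth functions on `C°`. -/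
def SmoothPunctured (g : Coord → ℂ) : Prop := ∀ x : ℝ × ℝ, 0 < x.1 → ContDiffAt ℝ ∞ (lift g) x

theorem smoothPunctured_of_mem {φ : Coord → ℂ} (h : φ ∈ testFunctions) : SmoothPunctured φ :=
  fun _ _ => h.1.contDiffAt

theorem SmoothPunctured.add {f g : Coord → ℂ} (hf : SmoothPunctured f) (hg : SmoothPunctured g) :
    SmoothPunctured (fun p => f p + g p) := fun x hx => (hf x hx).add (hg x hx)

theorem SmoothPunctured.sub {f g : Coord → ℂ} (hf : SmoothPunctured f) (hg : SmoothPunctured g) :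
    SmoothPunctured (fun p => f p - g p) := fun x hx => (hf x hx).sub (hg x hx)

theorem SmoothPunctured.mul {f g : Coord → ℂ} (hf : SmoothPunctured f) (hg : SmoothPunctured g) :
    SmoothPunctured (fun p => f p * g p) := fun x hx => (hf x hx).mul (hg x hx)

theorem smoothPunctured_const (c : ℂ) : SmoothPunctured (fun _ => c) :=
  fun _ _ => contDiffAt_const

theorem isOpen_fst_pos : IsOpen {x : ℝ × ℝ | 0 < x.1} := isOpen_lt continuous_const continuous_fst

theorem isOpen_punctured : IsOpen punctured := isOpen_lt continuous_const continuous_fst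

theorem exists_angle_coe (θ : Angle) : ∃ t : ℝ, (t : Angle) = θ := QuotientAddGroup.mk_surjective θ

theorem SmoothPunctured.differentiableAt {g : Coord → ℂ} (hg : SmoothPunctured g) {x : ℝ × ℝ}
    (hx : 0 < x.1) : DifferentiableAt ℝ (lift g) x := (hg x hx).differentiableAt (by simp)

theorem hasDerivAt_dr_of_differentiableAt {g : Coord → ℂ} {r t : ℝ}
    (h : DifferentiableAt ℝ (lift g) (r, t)) :
    HasDerivAt (fun s : ℝ => g (s, (t : Angle))) (dr g (r, (t : Angle))) r := by
  have h2 : HasDerivAt (fun s : ℝ => ((s, t) : ℝ × ℝ)) (1, 0) r :=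
    (hasDerivAt_id r).prodMk (hasDerivAt_const r t)
  exact (h.hasFDerivAt.comp_hasDerivAt r h2).differentiableAt.hasDerivAt

theorem SmoothPunctured.hasDerivAt_dr {g : Coord → ℂ} (hg : SmoothPunctured g) {r : ℝ} (hr : 0 < r)
    (θ : Angle) : HasDerivAt (fun s : ℝ => g (s, θ)) (dr g (r, θ)) r := by
  obtain ⟨t, rfl⟩ := exists_angle_coe θ
  exact hasDerivAt_dr_of_differentiableAt (hg.differentiableAt hr)

theorem hasDerivAt_dr_of_mem {φ : Coord → ℂ} (h : φ ∈ testFunctions) (r : ℝ) (θ : Angle) :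
    HasDerivAt (fun s : ℝ => φ (s, θ)) (dr φ (r, θ)) r := by
  obtain ⟨t, rfl⟩ := exists_angle_coe θ
  exact hasDerivAt_dr_of_differentiableAt (h.1.differentiable (by simp) _)

theorem hasDerivAt_dtheta_of_differentiableAt {g : Coord → ℂ} {r t : ℝ}
    (h : DifferentiableAt ℝ (lift g) (r, t)) :
    HasDerivAt (fun s : ℝ => g (r, (s : Angle))) (dtheta g (r, (t : Angle))) t := by
  have h2 : HasDerivAt (fun s : ℝ => ((r, s) : ℝ × ℝ)) (0, 1) t :=
    (hasDerivAt_const t r).prodMk (hasDerivAt_id t)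
  have h3 := (h.hasFDerivAt.comp_hasDerivAt t h2).differentiableAt.hasDerivAt
  have h4 : deriv (fun s : ℝ => lift g (r, s)) t = dtheta g (r, (t : Angle)) := by
    have := deriv_comp_const_add (fun s : ℝ => lift g (r, s)) t 0
    simp only [add_zero] at this
    rw [← this]
    rfl
  rw [← h4]
  exact h3

theorem SmoothPunctured.hasDerivAt_dtheta {g : Coord → ℂ} (hg : SmoothPunctured g) {r : ℝ}
    (hr : 0 < r) (t : ℝ) :
    HasDerivAt (fun s : ℝ => g (r, (s : Angle))) (dtheta g (r, (t : Angle))) t :=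
  hasDerivAt_dtheta_of_differentiableAt (hg.differentiableAt hr)

theorem hasDerivAt_dtheta_of_mem {φ : Coord → ℂ} (h : φ ∈ testFunctions) (r t : ℝ) :
    HasDerivAt (fun s : ℝ => φ (r, (s : Angle))) (dtheta φ (r, (t : Angle))) t :=
  hasDerivAt_dtheta_of_differentiableAt (h.1.differentiable (by simp) _)

theorem dr_eq_of_hasDerivAt {g : Coord → ℂ} {r : ℝ} {θ : Angle} {c : ℂ}
    (h : HasDerivAt (fun s : ℝ => g (s, θ)) c r) : dr g (r, θ) = c := h.deriv

theorem dtheta_eq_of_hasDerivAt {g : Coord → ℂ} {r t : ℝ} {c : ℂ}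
    (h : HasDerivAt (fun s : ℝ => g (r, (s : Angle))) c t) : dtheta g (r, (t : Angle)) = c := by
  have h4 : deriv (fun s : ℝ => lift g (r, s)) t = dtheta g (r, (t : Angle)) := by
    have := deriv_comp_const_add (fun s : ℝ => lift g (r, s)) t 0
    simp only [add_zero] at this
    rw [← this]
    rfl
  rw [← h4]
  exact h.deriv

theorem SmoothPunctured.lift_dr_eq {g : Coord → ℂ} (hg : SmoothPunctured g) {x : ℝ × ℝ}
    (hx : 0 < x.1) : lift (dr g) x = fderiv ℝ (lift g) x (1, 0) := by
  have h2 : HasDerivAt (fun s : ℝ => ((s, x.2) : ℝ × ℝ)) (1, 0) x.1 :=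
    (hasDerivAt_id x.1).prodMk (hasDerivAt_const x.1 x.2)
  have h3 : DifferentiableAt ℝ (lift g) (x.1, x.2) := hg.differentiableAt hx
  have h4 := (h3.hasFDerivAt.comp_hasDerivAt x.1 h2).deriv
  exact h4

theorem SmoothPunctured.lift_dtheta_eq {g : Coord → ℂ} (hg : SmoothPunctured g) {x : ℝ × ℝ}
    (hx : 0 < x.1) : lift (dtheta g) x = fderiv ℝ (lift g) x (0, 1) := by
  have h2 : HasDerivAt (fun s : ℝ => ((x.1, s) : ℝ × ℝ)) (0, 1) x.2 :=
    (hasDerivAt_const x.2 x.1).prodMk (hasDerivAt_id x.2)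
  have h3 : DifferentiableAt ℝ (lift g) (x.1, x.2) := hg.differentiableAt hx
  exact dtheta_eq_of_hasDerivAt (h3.hasFDerivAt.comp_hasDerivAt x.2 h2)

theorem SmoothPunctured.dr {g : Coord → ℂ} (hg : SmoothPunctured g) : SmoothPunctured (dr g) := by
  intro x hx
  have h1 : ContDiffAt ℝ ∞ (fun y => fderiv ℝ (lift g) y (1, 0)) x :=
    ((hg x hx).fderiv_right (m := ∞) (by simp)).clm_apply contDiffAt_const
  refine h1.congr_of_eventuallyEq ?_
  filter_upwards [isOpen_fst_pos.mem_nhds hx] with y hy using hg.lift_dr_eq hy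

theorem SmoothPunctured.dtheta {g : Coord → ℂ} (hg : SmoothPunctured g) :
    SmoothPunctured (dtheta g) := by
  intro x hx
  have h1 : ContDiffAt ℝ ∞ (fun y => fderiv ℝ (lift g) y (0, 1)) x :=
    ((hg x hx).fderiv_right (m := ∞) (by simp)).clm_apply contDiffAt_const
  refine h1.congr_of_eventuallyEq ?_
  filter_upwards [isOpen_fst_pos.mem_nhds hx] with y hy using hg.lift_dtheta_eq hy

theorem dr_congr {f g : Coord → ℂ} (h : EqOn f g punctured) : EqOn (dr f) (dr g) punctured := by
  rintro ⟨r, θ⟩ (hr : 0 < r)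
  refine EventuallyEq.deriv_eq ?_
  filter_upwards [isOpen_Ioi.mem_nhds hr] with s hs using h hs

theorem dtheta_congr {f g : Coord → ℂ} (h : EqOn f g punctured) :
    EqOn (dtheta f) (dtheta g) punctured := by
  rintro ⟨r, θ⟩ (hr : 0 < r)
  exact EventuallyEq.deriv_eq (Eventually.of_forall fun s => h (x := (r, θ + (s : Angle))) hr)

theorem SmoothPunctured.dr_add {f g : Coord → ℂ} (hf : SmoothPunctured f) (hg : SmoothPunctured g)
    {p : Coord} (hp : 0 < p.1) : FlatCone.dr (fun p => f p + g p) p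
      = FlatCone.dr f p + FlatCone.dr g p :=
  dr_eq_of_hasDerivAt ((hf.hasDerivAt_dr hp p.2).add (hg.hasDerivAt_dr hp p.2))

theorem SmoothPunctured.dr_sub {f g : Coord → ℂ} (hf : SmoothPunctured f) (hg : SmoothPunctured g)
    {p : Coord} (hp : 0 < p.1) : FlatCone.dr (fun p => f p - g p) p
      = FlatCone.dr f p - FlatCone.dr g p :=
  dr_eq_of_hasDerivAt ((hf.hasDerivAt_dr hp p.2).sub (hg.hasDerivAt_dr hp p.2))

theorem SmoothPunctured.dr_mul {f g : Coord → ℂ} (hf : SmoothPunctured f) (hg : SmoothPunctured g)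
    {p : Coord} (hp : 0 < p.1) : FlatCone.dr (fun p => f p * g p) p
      = FlatCone.dr f p * g p + f p * FlatCone.dr g p :=
  dr_eq_of_hasDerivAt ((hf.hasDerivAt_dr hp p.2).mul (hg.hasDerivAt_dr hp p.2))

theorem SmoothPunctured.dtheta_add {f g : Coord → ℂ} (hf : SmoothPunctured f)
    (hg : SmoothPunctured g) {p : Coord} (hp : 0 < p.1) :
    FlatCone.dtheta (fun p => f p + g p) p = FlatCone.dtheta f p + FlatCone.dtheta g p := by
  obtain ⟨r, θ⟩ := p
  obtain ⟨t, rfl⟩ := exists_angle_coe θ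
  exact dtheta_eq_of_hasDerivAt ((hf.hasDerivAt_dtheta hp t).add (hg.hasDerivAt_dtheta hp t))

theorem SmoothPunctured.dtheta_sub {f g : Coord → ℂ} (hf : SmoothPunctured f)
    (hg : SmoothPunctured g) {p : Coord} (hp : 0 < p.1) :
    FlatCone.dtheta (fun p => f p - g p) p = FlatCone.dtheta f p - FlatCone.dtheta g p := by
  obtain ⟨r, θ⟩ := p
  obtain ⟨t, rfl⟩ := exists_angle_coe θ
  exact dtheta_eq_of_hasDerivAt ((hf.hasDerivAt_dtheta hp t).sub (hg.hasDerivAt_dtheta hp t))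

theorem SmoothPunctured.dtheta_mul {f g : Coord → ℂ} (hf : SmoothPunctured f)
    (hg : SmoothPunctured g) {p : Coord} (hp : 0 < p.1) :
    FlatCone.dtheta (fun p => f p * g p) p
      = FlatCone.dtheta f p * g p + f p * FlatCone.dtheta g p := by
  obtain ⟨r, θ⟩ := p
  obtain ⟨t, rfl⟩ := exists_angle_coe θ
  exact dtheta_eq_of_hasDerivAt ((hf.hasDerivAt_dtheta hp t).mul (hg.hasDerivAt_dtheta hp t))

theorem SmoothPunctured.dr_dtheta_comm {g : Coord → ℂ} (hg : SmoothPunctured g) {p : Coord}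
    (hp : 0 < p.1) :
    FlatCone.dr (FlatCone.dtheta g) p = FlatCone.dtheta (FlatCone.dr g) p := by
  obtain ⟨r, θ⟩ := p
  obtain ⟨t, rfl⟩ := exists_angle_coe θ
  have hx : 0 < ((r, t) : ℝ × ℝ).1 := hp
  have hd : DifferentiableAt ℝ (fderiv ℝ (lift g)) (r, t) :=
    ((hg (r, t) hx).fderiv_right (m := ∞) (by simp)).differentiableAt (by simp)
  have e1 : lift (FlatCone.dr g) =ᶠ[𝓝 (r, t)] fun y => fderiv ℝ (lift g) y (1, 0) := by
    filter_upwards [isOpen_fst_pos.mem_nhds hx] with y hy using hg.lift_dr_eq hy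
  have e2 : lift (FlatCone.dtheta g) =ᶠ[𝓝 (r, t)] fun y => fderiv ℝ (lift g) y (0, 1) := by
    filter_upwards [isOpen_fst_pos.mem_nhds hx] with y hy using hg.lift_dtheta_eq hy
  have k1 := hg.dtheta.lift_dr_eq hx
  have k2 := hg.dr.lift_dtheta_eq hx
  rw [e2.fderiv_eq] at k1
  rw [e1.fderiv_eq] at k2
  rw [fderiv_clm_apply hd (differentiableAt_const _)] at k1 k2
  have hs : IsSymmSndFDerivAt ℝ (lift g) (r, t) :=
    (hg (r, t) hx).isSymmSndFDerivAt
      (by simpa using WithTop.coe_le_coe.2 (le_top : (2 : ℕ∞) ≤ ⊤))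
  have := hs (1, 0) (0, 1)
  simp at k1 k2
  exact k1.trans (this.trans k2.symm)

/-! ### Coefficients of the constant vector fields -/

theorem contDiff_halfExp_coe (n : ℤ) : ContDiff ℝ ∞ (fun t : ℝ => halfExp n (t : Angle)) := by
  simp_rw [halfExp_coe]
  have : ContDiff ℝ ∞ (fun t : ℝ => Complex.I * n * (t : ℂ) / 2) :=
    ((contDiff_const.mul Complex.ofRealCLM.contDiff).div_const _)
  exact Complex.contDiff_exp.comp this

theorem hasDerivAt_halfExp_coe (n : ℤ) (t : ℝ) :
    HasDerivAt (fun t : ℝ => halfExp n (t : Angle)) (Complex.I * n / 2 * halfExp n (t : Angle)) t := by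
  simp_rw [halfExp_coe]
  have h : HasDerivAt (fun t : ℝ => Complex.I * n * (t : ℂ) / 2) (Complex.I * n / 2) t := by
    have := (((hasDerivAt_id t).ofReal_comp.const_mul (Complex.I * n)).div_const 2)
    simpa using this
  convert h.cexp using 1
  ring

theorem halfExp_mul (m n : ℤ) (θ : Angle) : halfExp m θ * halfExp n θ = halfExp (m + n) θ := by
  simp [halfExp]

theorem halfExp_zero (θ : Angle) : halfExp 0 θ = 1 := by simp [halfExp]

theorem conj_halfExp (n : ℤ) (θ : Angle) : (starRingEnd ℂ) (halfExp n θ) = halfExp (-n) θ := by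
  simp [halfExp]

theorem norm_halfExp (n : ℤ) (θ : Angle) : ‖halfExp n θ‖ = 1 := by
  exact Circle.norm_coe _

theorem continuous_halfExp (n : ℤ) : Continuous (halfExp n) := (fourier n).continuous

theorem cosAngle_eq (θ : Angle) : (cosAngle θ : ℂ) = (halfExp 2 θ + halfExp (-2) θ) / 2 := by
  rw [← conj_halfExp, cosAngle, Complex.re_eq_add_conj]

theorem sinAngle_eq (θ : Angle) :
    (sinAngle θ : ℂ) = (halfExp 2 θ - halfExp (-2) θ) / (2 * Complex.I) := by
  rw [← conj_halfExp, sinAngle, Complex.im_eq_sub_conj]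

theorem cosAngle_sq_add_sinAngle_sq (θ : Angle) : (cosAngle θ : ℂ) ^ 2 + (sinAngle θ : ℂ) ^ 2 = 1 := by
  obtain ⟨t, rfl⟩ := exists_angle_coe θ
  rw [cosAngle_coe, sinAngle_coe]
  exact_mod_cast Real.cos_sq_add_sin_sq t

theorem smoothPunctured_cos : SmoothPunctured (fun p => (cosAngle p.2 : ℂ)) := by
  intro x _
  have : lift (fun p => (cosAngle p.2 : ℂ)) = fun x : ℝ × ℝ => ((Real.cos x.2 : ℝ) : ℂ) := by
    funext x; simp only [lift, cosAngle_coe]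
  rw [this]
  exact (Complex.ofRealCLM.contDiff.comp (Real.contDiff_cos.comp contDiff_snd)).contDiffAt

theorem smoothPunctured_sin : SmoothPunctured (fun p => (sinAngle p.2 : ℂ)) := by
  intro x _
  have : lift (fun p => (sinAngle p.2 : ℂ)) = fun x : ℝ × ℝ => ((Real.sin x.2 : ℝ) : ℂ) := by
    funext x; simp only [lift, sinAngle_coe]
  rw [this]
  exact (Complex.ofRealCLM.contDiff.comp (Real.contDiff_sin.comp contDiff_snd)).contDiffAt

theorem smoothPunctured_inv : SmoothPunctured (fun p => (p.1 : ℂ)⁻¹) := fun x hx =>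
  (contDiffAt_ofReal_fst x).inv (by exact_mod_cast hx.ne')

theorem smoothPunctured_sq_inv : SmoothPunctured (fun p => ((p.1 : ℂ) ^ 2)⁻¹) := fun x hx =>
  ((contDiffAt_ofReal_fst x).pow 2).inv (pow_ne_zero 2 (by exact_mod_cast hx.ne'))

theorem dr_of_snd (f : Angle → ℂ) (p : Coord) : dr (fun p => f p.2) p = 0 := by
  simp [dr]

theorem dtheta_of_fst (f : ℝ → ℂ) (p : Coord) : dtheta (fun p => f p.1) p = 0 := by
  simp [dtheta]

theorem dtheta_cos (p : Coord) : dtheta (fun p => (cosAngle p.2 : ℂ)) p = -(sinAngle p.2 : ℂ) := by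
  obtain ⟨r, θ⟩ := p
  obtain ⟨t, rfl⟩ := exists_angle_coe θ
  apply dtheta_eq_of_hasDerivAt
  simp only [cosAngle_coe, sinAngle_coe]
  exact_mod_cast (Real.hasDerivAt_cos t).ofReal_comp

theorem dtheta_sin (p : Coord) : dtheta (fun p => (sinAngle p.2 : ℂ)) p = (cosAngle p.2 : ℂ) := by
  obtain ⟨r, θ⟩ := p
  obtain ⟨t, rfl⟩ := exists_angle_coe θ
  apply dtheta_eq_of_hasDerivAt
  simp only [cosAngle_coe, sinAngle_coe]
  exact_mod_cast (Real.hasDerivAt_sin t).ofReal_comp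

theorem dr_inv {p : Coord} (hp : 0 < p.1) :
    dr (fun p => (p.1 : ℂ)⁻¹) p = -((p.1 : ℂ) ^ 2)⁻¹ := by
  obtain ⟨r, θ⟩ := p
  apply dr_eq_of_hasDerivAt
  have h : HasDerivAt (fun s : ℝ => (s : ℂ)) 1 r := by simpa using (hasDerivAt_id r).ofReal_comp
  have hr : (r : ℂ) ≠ 0 := by exact_mod_cast (ne_of_gt hp)
  have h2 := h.fun_inv hr
  rwa [neg_div, one_div] at h2

theorem SmoothPunctured.dx {g : Coord → ℂ} (hg : SmoothPunctured g) : SmoothPunctured (dx g) :=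
  (smoothPunctured_cos.mul hg.dr).sub ((smoothPunctured_inv.mul smoothPunctured_sin).mul hg.dtheta)

theorem SmoothPunctured.dy {g : Coord → ℂ} (hg : SmoothPunctured g) : SmoothPunctured (dy g) :=
  (smoothPunctured_sin.mul hg.dr).add ((smoothPunctured_inv.mul smoothPunctured_cos).mul hg.dtheta)

/-! ### Second order calculus: the constant fields commute and their squares sum to `-Δ`. -/

section SecondOrder

variable {g : Coord → ℂ} (hg : SmoothPunctured g) {p : Coord} (hp : 0 < p.1)
include hg hp

theorem SmoothPunctured.dr_dx : FlatCone.dr (FlatCone.dx g) p =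
    (cosAngle p.2 : ℂ) * FlatCone.dr (FlatCone.dr g) p
      + ((p.1 : ℂ) ^ 2)⁻¹ * (sinAngle p.2 : ℂ) * FlatCone.dtheta g p
      - (p.1 : ℂ)⁻¹ * (sinAngle p.2 : ℂ) * FlatCone.dtheta (FlatCone.dr g) p := by
  have h := (smoothPunctured_cos.mul hg.dr).dr_sub
    ((smoothPunctured_inv.mul smoothPunctured_sin).mul hg.dtheta) hp
  rw [smoothPunctured_cos.dr_mul hg.dr hp,
    (smoothPunctured_inv.mul smoothPunctured_sin).dr_mul hg.dtheta hp,
    smoothPunctured_inv.dr_mul smoothPunctured_sin hp, dr_inv hp,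
    dr_of_snd (fun θ => (cosAngle θ : ℂ)), dr_of_snd (fun θ => (sinAngle θ : ℂ)),
    hg.dr_dtheta_comm hp] at h
  refine h.trans ?_
  ring

theorem SmoothPunctured.dr_dy : FlatCone.dr (FlatCone.dy g) p =
    (sinAngle p.2 : ℂ) * FlatCone.dr (FlatCone.dr g) p
      - ((p.1 : ℂ) ^ 2)⁻¹ * (cosAngle p.2 : ℂ) * FlatCone.dtheta g p
      + (p.1 : ℂ)⁻¹ * (cosAngle p.2 : ℂ) * FlatCone.dtheta (FlatCone.dr g) p := by
  have h := (smoothPunctured_sin.mul hg.dr).dr_add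
    ((smoothPunctured_inv.mul smoothPunctured_cos).mul hg.dtheta) hp
  rw [smoothPunctured_sin.dr_mul hg.dr hp,
    (smoothPunctured_inv.mul smoothPunctured_cos).dr_mul hg.dtheta hp,
    smoothPunctured_inv.dr_mul smoothPunctured_cos hp, dr_inv hp,
    dr_of_snd (fun θ => (cosAngle θ : ℂ)), dr_of_snd (fun θ => (sinAngle θ : ℂ)),
    hg.dr_dtheta_comm hp] at h
  refine h.trans ?_
  ring

theorem SmoothPunctured.dtheta_dx : FlatCone.dtheta (FlatCone.dx g) p =
    -(sinAngle p.2 : ℂ) * FlatCone.dr g p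
      + (cosAngle p.2 : ℂ) * FlatCone.dtheta (FlatCone.dr g) p
      - (p.1 : ℂ)⁻¹ * ((cosAngle p.2 : ℂ) * FlatCone.dtheta g p
        + (sinAngle p.2 : ℂ) * FlatCone.dtheta (FlatCone.dtheta g) p) := by
  have h := (smoothPunctured_cos.mul hg.dr).dtheta_sub
    ((smoothPunctured_inv.mul smoothPunctured_sin).mul hg.dtheta) hp
  rw [smoothPunctured_cos.dtheta_mul hg.dr hp,
    (smoothPunctured_inv.mul smoothPunctured_sin).dtheta_mul hg.dtheta hp,
    smoothPunctured_inv.dtheta_mul smoothPunctured_sin hp,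
    dtheta_of_fst (fun r => (r : ℂ)⁻¹), dtheta_cos, dtheta_sin] at h
  refine h.trans ?_
  ring

theorem SmoothPunctured.dtheta_dy : FlatCone.dtheta (FlatCone.dy g) p =
    (cosAngle p.2 : ℂ) * FlatCone.dr g p
      + (sinAngle p.2 : ℂ) * FlatCone.dtheta (FlatCone.dr g) p
      + (p.1 : ℂ)⁻¹ * (-(sinAngle p.2 : ℂ) * FlatCone.dtheta g p
        + (cosAngle p.2 : ℂ) * FlatCone.dtheta (FlatCone.dtheta g) p) := by
  have h := (smoothPunctured_sin.mul hg.dr).dtheta_add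
    ((smoothPunctured_inv.mul smoothPunctured_cos).mul hg.dtheta) hp
  rw [smoothPunctured_sin.dtheta_mul hg.dr hp,
    (smoothPunctured_inv.mul smoothPunctured_cos).dtheta_mul hg.dtheta hp,
    smoothPunctured_inv.dtheta_mul smoothPunctured_cos hp,
    dtheta_of_fst (fun r => (r : ℂ)⁻¹), dtheta_cos, dtheta_sin] at h
  refine h.trans ?_
  ring

theorem SmoothPunctured.dx_dy_comm :
    FlatCone.dx (FlatCone.dy g) p = FlatCone.dy (FlatCone.dx g) p := by
  rw [FlatCone.dx, FlatCone.dy, hg.dr_dx hp, hg.dr_dy hp, hg.dtheta_dx hp, hg.dtheta_dy hp]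
  have h := cosAngle_sq_add_sinAngle_sq p.2
  field_simp
  ring

theorem SmoothPunctured.laplace_eq :
    laplace g p = -(FlatCone.dx (FlatCone.dx g) p + FlatCone.dy (FlatCone.dy g) p) := by
  rw [FlatCone.dx, FlatCone.dy, hg.dr_dx hp, hg.dr_dy hp, hg.dtheta_dx hp, hg.dtheta_dy hp, laplace]
  linear_combination (FlatCone.dr (FlatCone.dr g) p + (p.1 : ℂ)⁻¹ * FlatCone.dr g p
    + ((p.1 : ℂ) ^ 2)⁻¹ * FlatCone.dtheta (FlatCone.dtheta g) p)
      * cosAngle_sq_add_sinAngle_sq p.2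

end SecondOrder

/-! ### Integration on the cone -/

/-- The measure `r dr` on `(0, ∞)`. -/
noncomputable def radialMeasure : Measure ℝ :=
  (volume.restrict (Ioi (0 : ℝ))).withDensity fun r => ENNReal.ofReal r

theorem coneMeasure_eq : coneMeasure = radialMeasure.prod volume := rfl

instance : SFinite radialMeasure := by
  unfold radialMeasure
  infer_instance

theorem integral_radialMeasure {E : Type*} [NormedAddCommGroup E] [NormedSpace ℝ E] (g : ℝ → E) :
    ∫ r, g r ∂radialMeasure = ∫ r in Ioi (0 : ℝ), r • g r := by
  rw [radialMeasure, integral_withDensity_eq_integral_toReal_smul (by fun_prop)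
    (Eventually.of_forall fun _ => ENNReal.ofReal_lt_top)]
  refine setIntegral_congr_fun measurableSet_Ioi fun r hr => ?_
  simp only [ENNReal.toReal_ofReal (le_of_lt (mem_Ioi.1 hr))]

theorem setIntegral_Ioi_eq_integral_exp {E : Type*} [NormedAddCommGroup E] [NormedSpace ℝ E]
    (g : ℝ → E) : ∫ r in Ioi (0 : ℝ), g r = ∫ t, Real.exp t • g (Real.exp t) := by
  have h := integral_image_eq_integral_abs_deriv_smul (s := univ) MeasurableSet.univ
    (fun t _ => (Real.hasDerivAt_exp t).hasDerivWithinAt) Real.exp_injective.injOn g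
  rw [image_univ, Real.range_exp] at h
  simpa [abs_of_pos (Real.exp_pos _)] using h

/-- In the coordinate `t = log r` the measure `r dr` becomes `e^{2t} dt` on the whole line. The tip
moves to `-∞`, and radial test functions become arbitrary elements of `C_c^∞(ℝ)`. -/
theorem integral_radialMeasure_eq_exp {E : Type*} [NormedAddCommGroup E] [NormedSpace ℝ E]
    (g : ℝ → E) :
    ∫ r, g r ∂radialMeasure = ∫ t, Real.exp (2 * t) • g (Real.exp t) := by
  rw [integral_radialMeasure, setIntegral_Ioi_eq_integral_exp]
  congr 1
  ext t
  rw [smul_smul, ← Real.exp_add, two_mul]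

theorem integrable_radialMeasure_iff {E : Type*} [NormedAddCommGroup E] [NormedSpace ℝ E]
    {g : ℝ → E} : Integrable g radialMeasure ↔
      Integrable fun t => Real.exp (2 * t) • g (Real.exp t) := by
  rw [radialMeasure, integrable_withDensity_iff_integrable_smul' (by fun_prop)
    (Eventually.of_forall fun _ => ENNReal.ofReal_lt_top)]
  have h := integrableOn_image_iff_integrableOn_abs_deriv_smul (s := univ) MeasurableSet.univ
    (fun t _ => (Real.hasDerivAt_exp t).hasDerivWithinAt) Real.exp_injective.injOn
    (fun r => (ENNReal.ofReal r).toReal • g r)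
  rw [image_univ, Real.range_exp] at h
  rw [← IntegrableOn, h, integrableOn_univ]
  refine iff_of_eq (congrArg (fun f => Integrable f volume) ?_)
  ext t
  rw [ENNReal.toReal_ofReal (Real.exp_pos t).le, abs_of_pos (Real.exp_pos _), smul_smul,
    ← Real.exp_add, two_mul]

theorem ae_radialMeasure_pos : ∀ᵐ r ∂radialMeasure, 0 < r := by
  have : radialMeasure ≪ volume.restrict (Ioi (0 : ℝ)) := withDensity_absolutelyContinuous _ _
  exact this.ae_le (ae_restrict_mem measurableSet_Ioi)

theorem ae_pos : ∀ᵐ p ∂coneMeasure, 0 < p.1 := by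
  rw [coneMeasure_eq]
  exact Measure.quasiMeasurePreserving_fst.ae ae_radialMeasure_pos

theorem integral_cone {F : Coord → ℂ} (hF : Integrable F coneMeasure) :
    ∫ p, F p ∂coneMeasure = ∫ r, (∫ θ : Angle, F (r, θ)) ∂radialMeasure := integral_prod F hF

theorem integral_congr_pos {F G : Coord → ℂ} (h : ∀ p : Coord, 0 < p.1 → F p = G p) :
    ∫ p, F p ∂coneMeasure = ∫ p, G p ∂coneMeasure :=
  integral_congr_ae (ae_pos.mono h)

theorem integrable_of_mem {φ : Coord → ℂ} (h : φ ∈ testFunctions) : Integrable φ coneMeasure :=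
  (continuous_of_mem h).integrable_of_hasCompactSupport h.2.1

theorem hasCompactSupport_slice {φ : Coord → ℂ} (h : HasCompactSupport φ) (θ : Angle) :
    HasCompactSupport fun s : ℝ => φ (s, θ) := by
  refine HasCompactSupport.intro (h.image continuous_fst) fun s hs => ?_
  exact image_eq_zero_of_notMem_tsupport fun hn => hs ⟨_, hn, rfl⟩

theorem integral_angle_dtheta {φ : Coord → ℂ} {r : ℝ}
    (h : ∀ t : ℝ, HasDerivAt (fun s : ℝ => φ (r, (s : Angle))) (dtheta φ (r, (t : Angle))) t)
    (hc : Continuous fun θ => dtheta φ (r, θ)) : ∫ θ : Angle, dtheta φ (r, θ) = 0 := by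
  rw [← AddCircle.intervalIntegral_preimage (4 * Real.pi) 0 (fun θ => dtheta φ (r, θ))]
  rw [intervalIntegral.integral_eq_sub_of_hasDerivAt (fun t _ => h t)
    ((hc.comp (AddCircle.continuous_mk' _)).intervalIntegrable _ _)]
  simp [AddCircle.coe_period]

theorem integral_dtheta {φ : Coord → ℂ} (h : φ ∈ testFunctions) :
    ∫ p, dtheta φ p ∂coneMeasure = 0 := by
  rw [integral_cone (integrable_of_mem (dtheta_mem h))]
  have : ∀ r : ℝ, ∫ θ : Angle, dtheta φ (r, θ) = 0 := fun r =>
    integral_angle_dtheta (hasDerivAt_dtheta_of_mem h r)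
      ((continuous_of_mem (dtheta_mem h)).comp (by fun_prop))
  simp only [this, integral_zero]

theorem inv_mul_mem {φ : Coord → ℂ} (h : φ ∈ testFunctions) :
    (fun p => (p.1 : ℂ)⁻¹ * φ p) ∈ testFunctions := mul_mem h smoothPunctured_inv

theorem eq_zero_of_nonpos {φ : Coord → ℂ} (h : φ ∈ testFunctions) {p : Coord} (hp : p.1 ≤ 0) :
    φ p = 0 :=
  image_eq_zero_of_notMem_tsupport fun hn => (not_lt.2 hp) (h.2.2 hn)

/-- The radial field has divergence `1/r`: against `r dr` the integrand becomes `∂_r (r φ)`, which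
is compactly supported on each ray. -/
theorem integral_dr {φ : Coord → ℂ} (h : φ ∈ testFunctions) :
    ∫ p, (dr φ p + (p.1 : ℂ)⁻¹ * φ p) ∂coneMeasure = 0 := by
  have hm : (fun p => dr φ p + (p.1 : ℂ)⁻¹ * φ p) ∈ testFunctions :=
    testFunctions.add_mem (dr_mem h) (inv_mul_mem h)
  refine (integral_prod_symm (μ := radialMeasure) (ν := (volume : Measure Angle)) _
    (integrable_of_mem hm)).trans ?_
  have : ∀ θ : Angle, ∫ r, (dr φ (r, θ) + ((r : ℝ) : ℂ)⁻¹ * φ (r, θ)) ∂radialMeasure = 0 := by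
    intro θ
    rw [integral_radialMeasure]
    have h1 : ∀ r ∈ Ioi (0 : ℝ), r • (dr φ (r, θ) + ((r : ℝ) : ℂ)⁻¹ * φ (r, θ))
        = φ (r, θ) + r * dr φ (r, θ) := by
      intro r hr
      have : (r : ℂ) ≠ 0 := by exact_mod_cast (ne_of_gt hr)
      rw [Complex.real_smul]
      field_simp
      ring
    rw [setIntegral_congr_fun measurableSet_Ioi h1]
    -- Test functions vanish for `r ≤ 0`, so the integral over the half line can be taken over all
    -- of `ℝ`, where no boundary term appears.
    have hs : Function.support (fun r : ℝ => φ (r, θ) + r * dr φ (r, θ)) ⊆ Ioi 0 := by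
      intro r hr
      by_contra hn
      have hn : r ≤ 0 := not_lt.1 hn
      apply hr
      simp [eq_zero_of_nonpos h (p := (r, θ)) hn, eq_zero_of_nonpos (dr_mem h) (p := (r, θ)) hn]
    rw [setIntegral_eq_integral_of_forall_compl_eq_zero
      fun r hr => by by_contra h0; exact hr (hs h0)]
    have hd : ∀ r : ℝ, HasDerivAt (fun s : ℝ => (s : ℂ) * φ (s, θ))
        (φ (r, θ) + r * dr φ (r, θ)) r := by
      intro r
      have h0 : HasDerivAt (fun s : ℝ => (s : ℂ)) 1 r := by simpa using (hasDerivAt_id r).ofReal_comp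
      simpa using h0.fun_mul (hasDerivAt_dr_of_mem h r θ)
    have c1 : Continuous fun s : ℝ => φ (s, θ) := (continuous_of_mem h).comp (by fun_prop)
    have c2 : Continuous fun s : ℝ => dr φ (s, θ) := (continuous_of_mem (dr_mem h)).comp (by fun_prop)
    have c3 := hasCompactSupport_slice h.2.1 θ
    have c4 := hasCompactSupport_slice (dr_mem h).2.1 θ
    refine integral_eq_zero_of_hasDerivAt_of_integrable hd ?_ ?_
    · exact (c1.add (Complex.continuous_ofReal.mul c2)).integrable_of_hasCompactSupport
        (c3.add c4.mul_left)
    · exact (Complex.continuous_ofReal.mul c1).integrable_of_hasCompactSupport c3.mul_left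
  simp only [this, integral_zero]

/-- The factor `G` may be singular at the tip and need not decay: `G φ` is again a test function
because `φ` has compact support in `C°`. This is what allows integration by parts against the model
functions. -/
theorem integral_mul_dr {G φ : Coord → ℂ} (hG : SmoothPunctured G) (h : φ ∈ testFunctions) :
    ∫ p, G p * dr φ p ∂coneMeasure
      = -∫ p, (dr G p + (p.1 : ℂ)⁻¹ * G p) * φ p ∂coneMeasure := by
  have h1 := integral_dr (mul_mem h hG)
  rw [integral_congr_pos (G := fun p => (dr G p + (p.1 : ℂ)⁻¹ * G p) * φ p + G p * dr φ p)
    (fun p hp => by rw [hG.dr_mul (smoothPunctured_of_mem h) hp]; ring),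
    integral_add (integrable_of_mem (mul_mem h (hG.dr.add (smoothPunctured_inv.mul hG))))
      (integrable_of_mem (mul_mem (dr_mem h) hG))] at h1
  linear_combination h1

theorem integral_mul_dtheta {G φ : Coord → ℂ} (hG : SmoothPunctured G) (h : φ ∈ testFunctions) :
    ∫ p, G p * dtheta φ p ∂coneMeasure = -∫ p, dtheta G p * φ p ∂coneMeasure := by
  have h1 := integral_dtheta (mul_mem h hG)
  rw [integral_congr_pos (G := fun p => dtheta G p * φ p + G p * dtheta φ p)
    (fun p hp => hG.dtheta_mul (smoothPunctured_of_mem h) hp),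
    integral_add (integrable_of_mem (mul_mem h hG.dtheta))
      (integrable_of_mem (mul_mem (dtheta_mem h) hG))] at h1
  linear_combination h1

theorem dx_mem {φ : Coord → ℂ} (h : φ ∈ testFunctions) : dx φ ∈ testFunctions :=
  testFunctions.sub_mem (mul_mem (dr_mem h) smoothPunctured_cos)
    (mul_mem (dtheta_mem h) (smoothPunctured_inv.mul smoothPunctured_sin))

theorem dy_mem {φ : Coord → ℂ} (h : φ ∈ testFunctions) : dy φ ∈ testFunctions :=
  testFunctions.add_mem (mul_mem (dr_mem h) smoothPunctured_sin)
    (mul_mem (dtheta_mem h) (smoothPunctured_inv.mul smoothPunctured_cos))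

/-- The field `∂_x` is antisymmetric. -/
theorem integral_mul_dx {G φ : Coord → ℂ} (hG : SmoothPunctured G) (h : φ ∈ testFunctions) :
    ∫ p, G p * dx φ p ∂coneMeasure = -∫ p, dx G p * φ p ∂coneMeasure := by
  have hC := hG.mul smoothPunctured_cos
  have hS := hG.mul (smoothPunctured_inv.mul smoothPunctured_sin)
  have h1 := integral_mul_dr hC h
  have h2 := integral_mul_dtheta hS h
  have e : ∫ p, G p * dx φ p ∂coneMeasure = ∫ p, G p * (cosAngle p.2 : ℂ) * dr φ p ∂coneMeasure
      - ∫ p, G p * ((p.1 : ℂ)⁻¹ * (sinAngle p.2 : ℂ)) * dtheta φ p ∂coneMeasure := by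
    rw [← integral_sub (integrable_of_mem (mul_mem (dr_mem h) hC))
      (integrable_of_mem (mul_mem (dtheta_mem h) hS))]
    congr 1; ext p; rw [dx]; ring
  rw [e, h1, h2, sub_neg_eq_add, neg_add_eq_sub, ← neg_sub]
  rw [← integral_sub
    (integrable_of_mem (mul_mem h (hC.dr.add (smoothPunctured_inv.mul hC))))
    (integrable_of_mem (mul_mem h hS.dtheta))]
  congr 1
  refine integral_congr_pos fun p hp => ?_
  rw [hG.dr_mul smoothPunctured_cos hp, dr_of_snd (fun θ => (cosAngle θ : ℂ)),
    hG.dtheta_mul (smoothPunctured_inv.mul smoothPunctured_sin) hp,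
    smoothPunctured_inv.dtheta_mul smoothPunctured_sin hp,
    dtheta_of_fst (fun r => (r : ℂ)⁻¹), dtheta_sin, dx]
  ring

/-- The field `∂_y` is antisymmetric. -/
theorem integral_mul_dy {G φ : Coord → ℂ} (hG : SmoothPunctured G) (h : φ ∈ testFunctions) :
    ∫ p, G p * dy φ p ∂coneMeasure = -∫ p, dy G p * φ p ∂coneMeasure := by
  have hS := hG.mul smoothPunctured_sin
  have hC := hG.mul (smoothPunctured_inv.mul smoothPunctured_cos)
  have h1 := integral_mul_dr hS h
  have h2 := integral_mul_dtheta hC h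
  have e : ∫ p, G p * dy φ p ∂coneMeasure = ∫ p, G p * (sinAngle p.2 : ℂ) * dr φ p ∂coneMeasure
      + ∫ p, G p * ((p.1 : ℂ)⁻¹ * (cosAngle p.2 : ℂ)) * dtheta φ p ∂coneMeasure := by
    rw [← integral_add (integrable_of_mem (mul_mem (dr_mem h) hS))
      (integrable_of_mem (mul_mem (dtheta_mem h) hC))]
    congr 1; ext p; rw [dy]; ring
  rw [e, h1, h2, ← neg_add]
  rw [← integral_add
    (integrable_of_mem (mul_mem h (hS.dr.add (smoothPunctured_inv.mul hS))))
    (integrable_of_mem (mul_mem h hC.dtheta))]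
  congr 1
  refine integral_congr_pos fun p hp => ?_
  rw [hG.dr_mul smoothPunctured_sin hp, dr_of_snd (fun θ => (sinAngle θ : ℂ)),
    hG.dtheta_mul (smoothPunctured_inv.mul smoothPunctured_cos) hp,
    smoothPunctured_inv.dtheta_mul smoothPunctured_cos hp,
    dtheta_of_fst (fun r => (r : ℂ)⁻¹), dtheta_cos, dy]
  ring

theorem integral_mul_laplace {G φ : Coord → ℂ} (hG : SmoothPunctured G) (h : φ ∈ testFunctions) :
    ∫ p, G p * laplace φ p ∂coneMeasure = ∫ p, laplace G p * φ p ∂coneMeasure := by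
  have hφ := smoothPunctured_of_mem h
  rw [integral_congr_pos (G := fun p => -(G p * dx (dx φ) p + G p * dy (dy φ) p))
      (fun p hp => by rw [hφ.laplace_eq hp]; ring),
    integral_congr_pos (F := fun p => laplace G p * φ p)
      (G := fun p => -(dx (dx G) p * φ p + dy (dy G) p * φ p))
      (fun p hp => by rw [hG.laplace_eq hp]; ring), integral_neg, integral_neg,
    integral_add (integrable_of_mem (mul_mem (dx_mem (dx_mem h)) hG))
      (integrable_of_mem (mul_mem (dy_mem (dy_mem h)) hG)),
    integral_add (integrable_of_mem (mul_mem h hG.dx.dx)) (integrable_of_mem (mul_mem h hG.dy.dy)),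
    integral_mul_dx hG (dx_mem h), integral_mul_dx hG.dx h, integral_mul_dy hG (dy_mem h),
    integral_mul_dy hG.dy h, neg_neg, neg_neg]

/-! ### Conjugation -/

theorem conj_mem {φ : Coord → ℂ} (h : φ ∈ testFunctions) :
    (fun p => (starRingEnd ℂ) (φ p)) ∈ testFunctions := by
  refine mem_of_support h (Complex.conjCLE.contDiff.comp h.1) fun p hp => ?_
  simp [image_eq_zero_of_notMem_tsupport hp]

theorem dr_conj {φ : Coord → ℂ} (p : Coord) :
    dr (fun p => (starRingEnd ℂ) (φ p)) p = (starRingEnd ℂ) (dr φ p) :=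
  deriv.star (f := fun s : ℝ => φ (s, p.2)) (x := p.1)

theorem dtheta_conj {φ : Coord → ℂ} (p : Coord) :
    dtheta (fun p => (starRingEnd ℂ) (φ p)) p = (starRingEnd ℂ) (dtheta φ p) :=
  deriv.star (f := fun s : ℝ => φ (p.1, p.2 + (s : Angle))) (x := (0 : ℝ))

theorem dx_conj {φ : Coord → ℂ} (p : Coord) :
    dx (fun p => (starRingEnd ℂ) (φ p)) p = (starRingEnd ℂ) (dx φ p) := by
  simp [dx, dr_conj, dtheta_conj]

theorem dy_conj {φ : Coord → ℂ} (p : Coord) :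
    dy (fun p => (starRingEnd ℂ) (φ p)) p = (starRingEnd ℂ) (dy φ p) := by
  simp [dy, dr_conj, dtheta_conj]

theorem laplace_conj {φ : Coord → ℂ} (p : Coord) :
    laplace (fun p => (starRingEnd ℂ) (φ p)) p = (starRingEnd ℂ) (laplace φ p) := by
  have h1 : dr (fun p => (starRingEnd ℂ) (φ p)) = fun p => (starRingEnd ℂ) (dr φ p) :=
    funext dr_conj
  have h2 : dtheta (fun p => (starRingEnd ℂ) (φ p)) = fun p => (starRingEnd ℂ) (dtheta φ p) :=
    funext dtheta_conj
  simp [laplace, h1, h2, dr_conj, dtheta_conj]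

/-! ### The `L²` pairing and a priori estimates for test functions -/

theorem inner_testToL2_left (φ : testFunctions) (u : ConeL2) :
    inner ℂ (testToL2 φ) u = ∫ p, u p * (starRingEnd ℂ) (φ.1 p) ∂coneMeasure := by
  rw [L2.inner_def]
  refine integral_congr_ae ?_
  filter_upwards [(memLp_of_mem φ.2).coeFn_toLp] with p hp
  have : (testToL2 φ : ConeL2) p = φ.1 p := hp
  rw [this, RCLike.inner_apply]

theorem inner_testToL2 (φ ψ : testFunctions) :
    inner ℂ (testToL2 φ) (testToL2 ψ) = ∫ p, ψ.1 p * (starRingEnd ℂ) (φ.1 p) ∂coneMeasure := by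
  rw [inner_testToL2_left]
  refine integral_congr_ae ?_
  filter_upwards [(memLp_of_mem ψ.2).coeFn_toLp] with p hp
  have : (testToL2 ψ : ConeL2) p = ψ.1 p := hp
  rw [this]

theorem norm_testToL2_sq (φ : testFunctions) :
    ‖testToL2 φ‖ ^ 2 = ∫ p, ‖φ.1 p‖ ^ 2 ∂coneMeasure := by
  have h := inner_self_eq_norm_sq_to_K (𝕜 := ℂ) (testToL2 φ)
  rw [inner_testToL2] at h
  have h2 : ∀ p, φ.1 p * (starRingEnd ℂ) (φ.1 p) = ((‖φ.1 p‖ ^ 2 : ℝ) : ℂ) := fun p => by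
    rw [Complex.mul_conj, Complex.normSq_eq_norm_sq]
  simp_rw [h2] at h
  rw [integral_complex_ofReal] at h
  exact (Complex.ofReal_injective (h.trans (Complex.ofReal_pow _ _).symm)).symm

/-- Complex conjugation of test functions. -/
noncomputable def conjTest (φ : testFunctions) : testFunctions := ⟨_, conj_mem φ.2⟩

theorem dx_add {φ ψ : Coord → ℂ} (h : φ ∈ testFunctions) (k : ψ ∈ testFunctions) :
    dx (φ + ψ) = dx φ + dx ψ := by
  funext p
  simp only [dx, dr_add h k, dtheta_add h k, Pi.add_apply]
  ring

theorem dy_add {φ ψ : Coord → ℂ} (h : φ ∈ testFunctions) (k : ψ ∈ testFunctions) :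
    dy (φ + ψ) = dy φ + dy ψ := by
  funext p
  simp only [dy, dr_add h k, dtheta_add h k, Pi.add_apply]
  ring

theorem dx_smul (c : ℂ) (φ : Coord → ℂ) : dx (c • φ) = c • dx φ := by
  funext p
  simp only [dx, dr_smul, dtheta_smul, Pi.smul_apply, smul_eq_mul]
  ring

theorem dy_smul (c : ℂ) (φ : Coord → ℂ) : dy (c • φ) = c • dy φ := by
  funext p
  simp only [dy, dr_smul, dtheta_smul, Pi.smul_apply, smul_eq_mul]
  ring

/-- The field `∂_x` on test functions. -/
noncomputable def dxTest : testFunctions →ₗ[ℂ] testFunctions where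
  toFun φ := ⟨dx φ, dx_mem φ.2⟩
  map_add' φ ψ := Subtype.ext (dx_add φ.2 ψ.2)
  map_smul' c φ := Subtype.ext (dx_smul c φ)

/-- The field `∂_y` on test functions. -/
noncomputable def dyTest : testFunctions →ₗ[ℂ] testFunctions where
  toFun φ := ⟨dy φ, dy_mem φ.2⟩
  map_add' φ ψ := Subtype.ext (dy_add φ.2 ψ.2)
  map_smul' c φ := Subtype.ext (dy_smul c φ)

theorem inner_dxTest (φ ψ : testFunctions) :
    inner ℂ (testToL2 φ) (testToL2 (dxTest ψ)) = -inner ℂ (testToL2 (dxTest φ)) (testToL2 ψ) := by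
  rw [inner_testToL2, inner_testToL2]
  have h := integral_mul_dx (smoothPunctured_of_mem (conj_mem φ.2)) ψ.2
  simp only [dx_conj] at h
  change ∫ p, dx ψ.1 p * (starRingEnd ℂ) (φ.1 p) ∂coneMeasure
    = -∫ p, ψ.1 p * (starRingEnd ℂ) (dx φ.1 p) ∂coneMeasure
  simpa only [mul_comm] using h

theorem inner_dyTest (φ ψ : testFunctions) :
    inner ℂ (testToL2 φ) (testToL2 (dyTest ψ)) = -inner ℂ (testToL2 (dyTest φ)) (testToL2 ψ) := by
  rw [inner_testToL2, inner_testToL2]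
  have h := integral_mul_dy (smoothPunctured_of_mem (conj_mem φ.2)) ψ.2
  simp only [dy_conj] at h
  change ∫ p, dy ψ.1 p * (starRingEnd ℂ) (φ.1 p) ∂coneMeasure
    = -∫ p, ψ.1 p * (starRingEnd ℂ) (dy φ.1 p) ∂coneMeasure
  simpa only [mul_comm] using h

theorem testFunctions_ext {φ ψ : testFunctions} (h : ∀ p : Coord, 0 < p.1 → φ.1 p = ψ.1 p) :
    φ = ψ := by
  ext p
  by_cases hp : 0 < p.1
  · exact h p hp
  · rw [eq_zero_of_nonpos φ.2 (not_lt.1 hp), eq_zero_of_nonpos ψ.2 (not_lt.1 hp)]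

theorem laplaceTest_eq (φ : testFunctions) :
    laplaceTest φ = -(dxTest (dxTest φ) + dyTest (dyTest φ)) :=
  testFunctions_ext fun _ hp => (smoothPunctured_of_mem φ.2).laplace_eq hp

theorem dxTest_dyTest (φ : testFunctions) : dxTest (dyTest φ) = dyTest (dxTest φ) :=
  testFunctions_ext fun _ hp => (smoothPunctured_of_mem φ.2).dx_dy_comm hp

theorem dxTest_laplaceTest (φ : testFunctions) :
    dxTest (laplaceTest φ) = laplaceTest (dxTest φ) := by
  rw [laplaceTest_eq, laplaceTest_eq, map_neg, map_add, dxTest_dyTest, dxTest_dyTest]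

theorem dyTest_laplaceTest (φ : testFunctions) :
    dyTest (laplaceTest φ) = laplaceTest (dyTest φ) := by
  rw [laplaceTest_eq, laplaceTest_eq, map_neg, map_add, ← dxTest_dyTest, ← dxTest_dyTest]

theorem inner_laplaceTest (φ ψ : testFunctions) :
    inner ℂ (testToL2 φ) (testToL2 (laplaceTest ψ))
      = inner ℂ (testToL2 (dxTest φ)) (testToL2 (dxTest ψ))
        + inner ℂ (testToL2 (dyTest φ)) (testToL2 (dyTest ψ)) := by
  rw [laplaceTest_eq, map_neg, map_add, inner_neg_right, inner_add_right, inner_dxTest,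
    inner_dyTest]
  ring

theorem inner_laplaceTest_symm (φ ψ : testFunctions) :
    inner ℂ (testToL2 (laplaceTest φ)) (testToL2 ψ)
      = inner ℂ (testToL2 φ) (testToL2 (laplaceTest ψ)) := by
  rw [inner_laplaceTest, ← inner_conj_symm, inner_laplaceTest, map_add, inner_conj_symm,
    inner_conj_symm]

theorem inner_laplaceTest_self (φ : testFunctions) :
    inner ℂ (testToL2 φ) (testToL2 (laplaceTest φ))
      = ((‖testToL2 (dxTest φ)‖ ^ 2 + ‖testToL2 (dyTest φ)‖ ^ 2 : ℝ) : ℂ) := by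
  rw [inner_laplaceTest, inner_self_eq_norm_sq_to_K, inner_self_eq_norm_sq_to_K]
  push_cast
  rfl

/-- The left side is `⟨φ, Δφ⟩`, to which Cauchy–Schwarz applies. -/
theorem sq_add_sq_le_norm_mul_norm_laplaceTest (φ : testFunctions) :
    ‖testToL2 (dxTest φ)‖ ^ 2 + ‖testToL2 (dyTest φ)‖ ^ 2
      ≤ ‖testToL2 φ‖ * ‖testToL2 (laplaceTest φ)‖ := by
  have h := norm_inner_le_norm (𝕜 := ℂ) (testToL2 φ) (testToL2 (laplaceTest φ))
  rw [inner_laplaceTest_self, Complex.norm_real, Real.norm_of_nonneg (by positivity)] at h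
  exact h

/-- Since `∂_x` commutes with `Δ`, `-⟨∂_x ∂_x φ, Δφ⟩ = ⟨∂_x φ, Δ ∂_x φ⟩`, which is the Dirichlet
energy of `∂_x φ`. With `X`, `Y` the norms of the two second derivatives and `L = ‖Δφ‖`,
Cauchy–Schwarz gives `X² + Y² ≤ X L`, whence `X ≤ L` and `Y ≤ L`. -/
theorem hessian_dxTest (φ : testFunctions) :
    ‖testToL2 (dxTest (dxTest φ))‖ ≤ ‖testToL2 (laplaceTest φ)‖ ∧
      ‖testToL2 (dyTest (dxTest φ))‖ ≤ ‖testToL2 (laplaceTest φ)‖ := by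
  have h : ‖testToL2 (dxTest (dxTest φ))‖ ^ 2 + ‖testToL2 (dyTest (dxTest φ))‖ ^ 2
      ≤ ‖testToL2 (dxTest (dxTest φ))‖ * ‖testToL2 (laplaceTest φ)‖ := by
    have h := norm_inner_le_norm (𝕜 := ℂ) (testToL2 (dxTest (dxTest φ))) (testToL2 (laplaceTest φ))
    rw [← norm_neg, ← inner_dxTest, dxTest_laplaceTest, inner_laplaceTest_self, Complex.norm_real,
      Real.norm_of_nonneg (by positivity)] at h
    exact h
  constructor <;>
    nlinarith [norm_nonneg (testToL2 (dxTest (dxTest φ))), norm_nonneg (testToL2 (laplaceTest φ)),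
      norm_nonneg (testToL2 (dyTest (dxTest φ))), sq_nonneg (‖testToL2 (dyTest (dxTest φ))‖),
      sq_nonneg (‖testToL2 (dxTest (dxTest φ))‖ - ‖testToL2 (laplaceTest φ)‖)]

theorem hessian_dyTest (φ : testFunctions) :
    ‖testToL2 (dxTest (dyTest φ))‖ ≤ ‖testToL2 (laplaceTest φ)‖ ∧
      ‖testToL2 (dyTest (dyTest φ))‖ ≤ ‖testToL2 (laplaceTest φ)‖ := by
  have h : ‖testToL2 (dxTest (dyTest φ))‖ ^ 2 + ‖testToL2 (dyTest (dyTest φ))‖ ^ 2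
      ≤ ‖testToL2 (dyTest (dyTest φ))‖ * ‖testToL2 (laplaceTest φ)‖ := by
    have h := norm_inner_le_norm (𝕜 := ℂ) (testToL2 (dyTest (dyTest φ))) (testToL2 (laplaceTest φ))
    rw [← norm_neg, ← inner_dyTest, dyTest_laplaceTest, inner_laplaceTest_self, Complex.norm_real,
      Real.norm_of_nonneg (by positivity)] at h
    exact h
  constructor <;>
    nlinarith [norm_nonneg (testToL2 (dyTest (dyTest φ))), norm_nonneg (testToL2 (laplaceTest φ)),
      norm_nonneg (testToL2 (dxTest (dyTest φ))), sq_nonneg (‖testToL2 (dxTest (dyTest φ))‖),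
      sq_nonneg (‖testToL2 (dyTest (dyTest φ))‖ - ‖testToL2 (laplaceTest φ)‖)]

/-! ### The uniform estimate near the tip -/

theorem abs_cosAngle_le_one (θ : Angle) : ‖(cosAngle θ : ℂ)‖ ≤ 1 := by
  obtain ⟨t, rfl⟩ := exists_angle_coe θ
  rw [cosAngle_coe, Complex.norm_real]
  exact Real.abs_cos_le_one t

theorem abs_sinAngle_le_one (θ : Angle) : ‖(sinAngle θ : ℂ)‖ ≤ 1 := by
  obtain ⟨t, rfl⟩ := exists_angle_coe θ
  rw [sinAngle_coe, Complex.norm_real]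
  exact Real.abs_sin_le_one t

theorem norm_dr_le (g : Coord → ℂ) (p : Coord) : ‖dr g p‖ ≤ ‖dx g p‖ + ‖dy g p‖ := by
  have h : dr g p = (cosAngle p.2 : ℂ) * dx g p + (sinAngle p.2 : ℂ) * dy g p := by
    rw [dx, dy]
    linear_combination (-dr g p) * cosAngle_sq_add_sinAngle_sq p.2
  rw [h]
  refine (norm_add_le _ _).trans (add_le_add ?_ ?_) <;> rw [norm_mul]
  · exact mul_le_of_le_one_left (norm_nonneg _) (abs_cosAngle_le_one _)
  · exact mul_le_of_le_one_left (norm_nonneg _) (abs_sinAngle_le_one _)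

theorem norm_dtheta_le (g : Coord → ℂ) {p : Coord} (hp : 0 < p.1) :
    ‖dtheta g p‖ ≤ p.1 * (‖dx g p‖ + ‖dy g p‖) := by
  have h : dtheta g p = (p.1 : ℂ) * (-(sinAngle p.2 : ℂ) * dx g p + (cosAngle p.2 : ℂ) * dy g p) := by
    have hr : (p.1 : ℂ) ≠ 0 := by exact_mod_cast hp.ne'
    rw [dx, dy]
    field_simp
    linear_combination (-dtheta g p) * cosAngle_sq_add_sinAngle_sq p.2
  rw [h, norm_mul, Complex.norm_real, Real.norm_of_nonneg hp.le]
  refine mul_le_mul_of_nonneg_left ((norm_add_le _ _).trans (add_le_add ?_ ?_)) hp.le <;>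
    rw [norm_mul]
  · rw [norm_neg]
    exact mul_le_of_le_one_left (norm_nonneg _) (abs_sinAngle_le_one _)
  · exact mul_le_of_le_one_left (norm_nonneg _) (abs_cosAngle_le_one _)

/-- Write `|η(r)|²` as minus the integral of its derivative over `(r, ∞)`. That derivative is at
most `2 |η| |∂_r η| ≤ |η|² + |∂_r η|²`, and the factor `r` is absorbed in the weight `s ≥ r`. -/
theorem mul_norm_sq_le_integral {η : Coord → ℂ} (h : η ∈ testFunctions) {r : ℝ} (hr : 0 < r)
    (θ : Angle) :
    r * ‖η (r, θ)‖ ^ 2 ≤ ∫ s, (‖η (s, θ)‖ ^ 2 + ‖dr η (s, θ)‖ ^ 2) ∂radialMeasure := by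
  have c1 : Continuous fun s : ℝ => η (s, θ) := (continuous_of_mem h).comp (by fun_prop)
  have c2 : Continuous fun s : ℝ => dr η (s, θ) := (continuous_of_mem (dr_mem h)).comp (by fun_prop)
  have c3 := hasCompactSupport_slice h.2.1 θ
  have c4 := hasCompactSupport_slice (dr_mem h).2.1 θ
  have hd : ∀ s : ℝ, HasDerivAt (fun s : ℝ => η (s, θ) * (starRingEnd ℂ) (η (s, θ)))
      (dr η (s, θ) * (starRingEnd ℂ) (η (s, θ)) + η (s, θ) * (starRingEnd ℂ) (dr η (s, θ))) s :=
    fun s => (hasDerivAt_dr_of_mem h s θ).fun_mul (hasDerivAt_dr_of_mem h s θ).star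
  have c1s := Complex.continuous_conj.comp c1
  have c2s := Complex.continuous_conj.comp c2
  have c5 : Continuous fun s : ℝ => dr η (s, θ) * (starRingEnd ℂ) (η (s, θ))
      + η (s, θ) * (starRingEnd ℂ) (dr η (s, θ)) := (c2.mul c1s).add (c1.mul c2s)
  have c6 : HasCompactSupport fun s : ℝ => dr η (s, θ) * (starRingEnd ℂ) (η (s, θ))
      + η (s, θ) * (starRingEnd ℂ) (dr η (s, θ)) := c4.mul_right.add c3.mul_right
  have c7 : HasCompactSupport fun s : ℝ => η (s, θ) * (starRingEnd ℂ) (η (s, θ)) := c3.mul_right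
  have c8 : Continuous fun s : ℝ => η (s, θ) * (starRingEnd ℂ) (η (s, θ)) := c1.mul c1s
  have hF := integral_Ioi_of_hasDerivAt_of_tendsto (a := r) (m := 0) c8.continuousWithinAt
    (fun s _ => hd s) (c5.integrable_of_hasCompactSupport c6).integrableOn
    (c7.is_zero_at_infty.mono_left atTop_le_cocompact)
  have c9 : Continuous fun s : ℝ => s • (‖η (s, θ)‖ ^ 2 + ‖dr η (s, θ)‖ ^ 2) :=
    continuous_id.smul ((c1.norm.pow 2).add (c2.norm.pow 2))
  have c10 : HasCompactSupport fun s : ℝ => s • (‖η (s, θ)‖ ^ 2 + ‖dr η (s, θ)‖ ^ 2) := by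
    have := (c3.norm.comp_left (g := fun x : ℝ => x ^ 2) (by simp)).add
      (c4.norm.comp_left (g := fun x : ℝ => x ^ 2) (by simp))
    exact this.smul_left (f := fun s : ℝ => s)
  have hI := c9.integrable_of_hasCompactSupport (μ := volume) c10
  have e1 : r * ‖η (r, θ)‖ ^ 2 = ‖∫ s in Ioi r, (r : ℂ) * (dr η (s, θ) * (starRingEnd ℂ) (η (s, θ))
      + η (s, θ) * (starRingEnd ℂ) (dr η (s, θ)))‖ := by
    rw [integral_const_mul, hF, norm_mul, zero_sub, norm_neg, norm_mul, RCLike.norm_conj,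
      Complex.norm_real, Real.norm_of_nonneg hr.le, sq]
  rw [e1, integral_radialMeasure]
  calc _ ≤ ∫ s in Ioi r, s • (‖η (s, θ)‖ ^ 2 + ‖dr η (s, θ)‖ ^ 2) := by
        refine norm_integral_le_of_norm_le hI.integrableOn ?_
        filter_upwards [ae_restrict_mem measurableSet_Ioi] with s hs
        have hs : r < s := hs
        rw [norm_mul, Complex.norm_real, Real.norm_of_nonneg hr.le, smul_eq_mul]
        refine mul_le_mul hs.le ?_ (norm_nonneg _) (hr.le.trans hs.le)
        refine (norm_add_le _ _).trans ?_
        rw [norm_mul, norm_mul, RCLike.norm_conj, RCLike.norm_conj]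
        nlinarith [sq_nonneg (‖η (s, θ)‖ - ‖dr η (s, θ)‖)]
    _ ≤ _ := by
        refine setIntegral_mono_set hI.integrableOn ?_ (Ioi_subset_Ioi hr.le).eventuallyLE
        filter_upwards [ae_restrict_mem measurableSet_Ioi] with s hs
        have hs : 0 < s := hs
        simp only [Pi.zero_apply, smul_eq_mul]
        positivity

theorem integrable_norm_sq_of_mem {φ : Coord → ℂ} (h : φ ∈ testFunctions) :
    Integrable (fun p => ‖φ p‖ ^ 2) coneMeasure :=
  (memLp_of_mem h).integrable_norm_pow (p := 2) (by simp)

theorem integrable_angle {E : Type*} [NormedAddCommGroup E] {f : Angle → E} (hf : Continuous f) :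
    Integrable f :=
  hf.integrable_of_hasCompactSupport (HasCompactSupport.of_compactSpace f)

/-- The trace of a test function on the circle of radius `r`. -/
theorem mul_integral_angle_sq_le (η : testFunctions) {r : ℝ} (hr : 0 < r) :
    r * ∫ θ : Angle, ‖η.1 (r, θ)‖ ^ 2 ≤ ‖testToL2 η‖ ^ 2
      + 2 * (‖testToL2 (dxTest η)‖ ^ 2 + ‖testToL2 (dyTest η)‖ ^ 2) := by
  have c1 := continuous_of_mem η.2
  have i1 := integrable_norm_sq_of_mem η.2
  have i2 := integrable_norm_sq_of_mem (dr_mem η.2)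
  have i3 := integrable_norm_sq_of_mem (dx_mem η.2)
  have i4 := integrable_norm_sq_of_mem (dy_mem η.2)
  have i5 : Integrable (fun p : ℝ × Angle => ‖η.1 p‖ ^ 2 + ‖dr η.1 p‖ ^ 2)
    (radialMeasure.prod volume) := i1.add i2
  have i6 : Integrable (fun p => ‖dx η.1 p‖ ^ 2 + ‖dy η.1 p‖ ^ 2) coneMeasure := i3.add i4
  calc r * ∫ θ : Angle, ‖η.1 (r, θ)‖ ^ 2
      = ∫ θ : Angle, r * ‖η.1 (r, θ)‖ ^ 2 := by rw [integral_const_mul]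
    _ ≤ ∫ θ : Angle, ∫ s, (‖η.1 (s, θ)‖ ^ 2 + ‖dr η.1 (s, θ)‖ ^ 2) ∂radialMeasure := by
        refine integral_mono (integrable_angle (by fun_prop)) i5.integral_prod_right
          fun θ => mul_norm_sq_le_integral η.2 hr θ
    _ = ∫ p, (‖η.1 p‖ ^ 2 + ‖dr η.1 p‖ ^ 2) ∂coneMeasure := (integral_prod_symm _ i5).symm
    _ ≤ ∫ p, (‖η.1 p‖ ^ 2 + 2 * (‖dx η.1 p‖ ^ 2 + ‖dy η.1 p‖ ^ 2)) ∂coneMeasure := by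
        refine integral_mono i5 (i1.add (i6.const_mul 2)) fun p => ?_
        have h := norm_dr_le η.1 p
        have h0 := norm_nonneg (dr η.1 p)
        simp only [add_le_add_iff_left]
        nlinarith [sq_nonneg (‖dx η.1 p‖ - ‖dy η.1 p‖)]
    _ = _ := by
        rw [integral_add i1 (i6.const_mul 2), integral_const_mul, integral_add i3 i4,
          norm_testToL2_sq, norm_testToL2_sq, norm_testToL2_sq]
        rfl

theorem volume_angle : (volume : Measure Angle).real univ = 4 * Real.pi := by
  rw [Measure.real, AddCircle.measure_univ, ENNReal.toReal_ofReal (by positivity)]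

theorem sq_integral_angle_le {f : Angle → ℝ} (hf : Integrable f)
    (hf2 : Integrable fun θ => f θ ^ 2) :
    (∫ θ, f θ) ^ 2 ≤ 4 * Real.pi * ∫ θ, f θ ^ 2 := by
  set X := ∫ θ, f θ
  have hpi : 0 < 4 * Real.pi := by positivity
  have h : 0 ≤ ∫ θ, (f θ - X / (4 * Real.pi)) ^ 2 := integral_nonneg fun θ => sq_nonneg _
  have e : ∀ θ, (f θ - X / (4 * Real.pi)) ^ 2
      = (f θ ^ 2 - 2 * (X / (4 * Real.pi)) * f θ) + (X / (4 * Real.pi)) ^ 2 := fun θ => by ring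
  simp_rw [e] at h
  have i1 : Integrable (fun θ => f θ ^ 2 - 2 * (X / (4 * Real.pi)) * f θ) :=
    hf2.sub (hf.const_mul _)
  rw [integral_add i1 (integrable_const _), integral_sub hf2 (hf.const_mul _), integral_const_mul, integral_const, volume_angle] at h
  change 0 ≤ (∫ θ, f θ ^ 2) - 2 * (X / (4 * Real.pi)) * X + (4 * Real.pi) • (X / (4 * Real.pi)) ^ 2 at h
  rw [smul_eq_mul] at h
  have e2 : (∫ θ, f θ ^ 2) - 2 * (X / (4 * Real.pi)) * X + (4 * Real.pi) * (X / (4 * Real.pi)) ^ 2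
      = (4 * Real.pi)⁻¹ * (4 * Real.pi * (∫ θ, f θ ^ 2) - X ^ 2) := by
    field_simp
    ring
  rw [e2] at h
  have := nonneg_of_mul_nonneg_right h (by positivity)
  linarith

/-- Cauchy–Schwarz on a circle of angular length `4π` turns the `L²` trace bound into an `L¹` bound.
The factor `4` comes from `4π ≤ 16`. -/
theorem integral_angle_norm_le (η : testFunctions) {r B : ℝ} (hr : 0 < r) (hB : 0 ≤ B)
    (h : ‖testToL2 η‖ ^ 2 + 2 * (‖testToL2 (dxTest η)‖ ^ 2 + ‖testToL2 (dyTest η)‖ ^ 2) ≤ B ^ 2) :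
    ∫ θ : Angle, ‖η.1 (r, θ)‖ ≤ 4 * B / √r := by
  have c1 := continuous_of_mem η.2
  have h1 := sq_integral_angle_le (f := fun θ => ‖η.1 (r, θ)‖)
    (integrable_angle (by fun_prop)) (integrable_angle (by fun_prop))
  have h2 := (mul_integral_angle_sq_le η hr).trans h
  have hs : 0 < √r := Real.sqrt_pos.2 hr
  rw [le_div_iff₀ hs]
  refine le_of_sq_le_sq ?_ (by positivity)
  rw [mul_pow, Real.sq_sqrt hr.le]
  have h3 : 0 ≤ ∫ θ : Angle, ‖η.1 (r, θ)‖ ^ 2 := integral_nonneg fun θ => by positivity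
  have h4 : 0 ≤ r * ∫ θ : Angle, ‖η.1 (r, θ)‖ ^ 2 := by positivity
  calc _ ≤ (4 * Real.pi * ∫ θ : Angle, ‖η.1 (r, θ)‖ ^ 2) * r := by gcongr
    _ = 4 * Real.pi * (r * ∫ θ : Angle, ‖η.1 (r, θ)‖ ^ 2) := by ring
    _ ≤ 16 * B ^ 2 := by nlinarith [Real.pi_lt_four, Real.pi_pos]
    _ = _ := by ring

/-- The trace bound is applied to `∂_x φ` and `∂_y φ`, whose norms and first derivatives are
controlled by `‖φ‖ + ‖Δφ‖`. The constant is `24 = 2 · 4 · 3`, with `B = 3 (‖φ‖ + ‖Δφ‖)` for each of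
the two fields. -/
theorem integral_angle_gradient_le (φ : testFunctions) {r : ℝ} (hr : 0 < r) :
    ∫ θ : Angle, (‖dx φ.1 (r, θ)‖ + ‖dy φ.1 (r, θ)‖)
      ≤ 24 * (‖testToL2 φ‖ + ‖testToL2 (laplaceTest φ)‖) / √r := by
  have c1 := continuous_of_mem (dx_mem φ.2)
  have c2 := continuous_of_mem (dy_mem φ.2)
  have n0 := norm_nonneg (testToL2 φ)
  have n1 := norm_nonneg (testToL2 (laplaceTest φ))
  have h0 := sq_add_sq_le_norm_mul_norm_laplaceTest φ
  obtain ⟨h1, h2⟩ := hessian_dxTest φ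
  obtain ⟨h3, h4⟩ := hessian_dyTest φ
  have e1 := pow_le_pow_left₀ (norm_nonneg _) h1 2
  have e2 := pow_le_pow_left₀ (norm_nonneg _) h2 2
  have e3 := pow_le_pow_left₀ (norm_nonneg _) h3 2
  have e4 := pow_le_pow_left₀ (norm_nonneg _) h4 2
  have k1 := integral_angle_norm_le (dxTest φ) (B := 3 * (‖testToL2 φ‖ + ‖testToL2 (laplaceTest φ)‖))
    hr (by positivity) (by nlinarith [sq_nonneg ‖testToL2 (dyTest φ)‖])
  have k2 := integral_angle_norm_le (dyTest φ) (B := 3 * (‖testToL2 φ‖ + ‖testToL2 (laplaceTest φ)‖))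
    hr (by positivity) (by nlinarith [sq_nonneg ‖testToL2 (dxTest φ)‖])
  rw [integral_add (integrable_angle (by fun_prop)) (integrable_angle (by fun_prop))]
  calc _ ≤ _ := add_le_add k1 k2
    _ = _ := by ring

/-- The oscillation on a circle is at most `∫ |∂_θ φ| ≤ r ∫ (|∂_x φ| + |∂_y φ|)`, and the gradient
integral is `O(r^{-1/2})`. -/
theorem norm_sub_le_on_circle (φ : testFunctions) {r : ℝ} (hr : 0 < r) (θ θ' : Angle) :
    ‖φ.1 (r, θ) - φ.1 (r, θ')‖
      ≤ 24 * (‖testToL2 φ‖ + ‖testToL2 (laplaceTest φ)‖) * √r := by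
  obtain ⟨a, rfl⟩ := exists_angle_coe θ'
  -- Representatives are chosen within one period, so that the arc from `a` to `b` is covered at
  -- most once by the full circle.
  obtain ⟨b, hb, rfl⟩ : ∃ b ∈ Ico a (a + 4 * Real.pi), (b : Angle) = θ :=
    ⟨_, ((AddCircle.equivIco (4 * Real.pi) a) θ).2, AddCircle.coe_equivIco⟩
  have hc : Continuous fun θ => dtheta φ.1 (r, θ) :=
    (continuous_of_mem (dtheta_mem φ.2)).comp (by fun_prop)
  have hc2 : Continuous fun s : ℝ => dtheta φ.1 (r, (s : Angle)) :=
    hc.comp (AddCircle.continuous_mk' _)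
  have c1 : Continuous fun θ => dx φ.1 (r, θ) :=
    (continuous_of_mem (dx_mem φ.2)).comp (by fun_prop)
  have c2 : Continuous fun θ => dy φ.1 (r, θ) :=
    (continuous_of_mem (dy_mem φ.2)).comp (by fun_prop)
  rw [← intervalIntegral.integral_eq_sub_of_hasDerivAt
    (fun t _ => hasDerivAt_dtheta_of_mem φ.2 r t) (hc2.intervalIntegrable a b)]
  calc _ ≤ ∫ s in a..b, ‖dtheta φ.1 (r, (s : Angle))‖ :=
        intervalIntegral.norm_integral_le_integral_norm hb.1
    _ ≤ ∫ s in a..(a + 4 * Real.pi), ‖dtheta φ.1 (r, (s : Angle))‖ :=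
        intervalIntegral.integral_mono_interval le_rfl hb.1 hb.2.le
          (Eventually.of_forall fun _ => norm_nonneg _) (hc2.norm.intervalIntegrable _ _)
    _ = ∫ θ : Angle, ‖dtheta φ.1 (r, θ)‖ :=
        AddCircle.intervalIntegral_preimage (4 * Real.pi) a (fun θ => ‖dtheta φ.1 (r, θ)‖)
    _ ≤ ∫ θ : Angle, r * (‖dx φ.1 (r, θ)‖ + ‖dy φ.1 (r, θ)‖) :=
        integral_mono (integrable_angle hc.norm) (integrable_angle (by fun_prop))
          fun θ => norm_dtheta_le φ.1 (p := (r, θ)) hr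
    _ ≤ r * (24 * (‖testToL2 φ‖ + ‖testToL2 (laplaceTest φ)‖) / √r) := by
        rw [integral_const_mul]
        exact mul_le_mul_of_nonneg_left (integral_angle_gradient_le φ hr) hr.le
    _ = _ := by
        have hs : √r ≠ 0 := (Real.sqrt_pos.2 hr).ne'
        field_simp
        rw [Real.sq_sqrt hr.le]
        ring

/-- The circular mean is integrated outwards from `r = 0`, where `φ` vanishes. The gradient bound
`24 M s^{-1/2}` has integral `48 M √r` over `(0, r)`. -/
theorem norm_integral_angle_le (φ : testFunctions) {r : ℝ} (hr : 0 < r) :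
    ‖∫ θ : Angle, φ.1 (r, θ)‖
      ≤ 48 * (‖testToL2 φ‖ + ‖testToL2 (laplaceTest φ)‖) * √r := by
  set M := ‖testToL2 φ‖ + ‖testToL2 (laplaceTest φ)‖
  have cd := continuous_of_mem (dr_mem φ.2)
  have c1 := continuous_of_mem (dx_mem φ.2)
  have c2 := continuous_of_mem (dy_mem φ.2)
  have e1 : ∀ θ : Angle, φ.1 (r, θ) = ∫ s in Ioc 0 r, dr φ.1 (s, θ) := by
    intro θ
    have hc : Continuous fun s : ℝ => dr φ.1 (s, θ) := cd.comp (by fun_prop)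
    rw [← intervalIntegral.integral_of_le hr.le, intervalIntegral.integral_eq_sub_of_hasDerivAt
      (fun t _ => hasDerivAt_dr_of_mem φ.2 t θ) (hc.intervalIntegrable 0 r),
      eq_zero_of_nonpos φ.2 (p := (0, θ)) le_rfl, sub_zero]
  have hI : Integrable (fun p : ℝ × Angle => dr φ.1 p)
      ((volume.restrict (Ioc 0 r)).prod volume) :=
    cd.integrable_of_hasCompactSupport (dr_mem φ.2).2.1
  simp_rw [e1]
  rw [← integral_integral_swap (f := fun s θ => dr φ.1 (s, θ)) hI]
  have hJ : IntegrableOn (fun s : ℝ => 24 * M * s ^ (-(1 / 2) : ℝ)) (Ioc 0 r) := by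
    refine Integrable.const_mul ?_ _
    exact (intervalIntegrable_iff_integrableOn_Ioc_of_le hr.le).1
      (intervalIntegral.intervalIntegrable_rpow' (by norm_num))
  calc _ ≤ ∫ s in Ioc 0 r, 24 * M * s ^ (-(1 / 2) : ℝ) := by
        refine norm_integral_le_of_norm_le hJ ?_
        filter_upwards [ae_restrict_mem measurableSet_Ioc] with s hs
        calc _ ≤ ∫ θ : Angle, ‖dr φ.1 (s, θ)‖ := norm_integral_le_integral_norm _
          _ ≤ ∫ θ : Angle, (‖dx φ.1 (s, θ)‖ + ‖dy φ.1 (s, θ)‖) :=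
            integral_mono (integrable_angle (by fun_prop)) (integrable_angle (by fun_prop))
              fun θ => norm_dr_le φ.1 _
          _ ≤ 24 * M / √s := integral_angle_gradient_le φ hs.1
          _ = _ := by rw [Real.rpow_neg hs.1.le, Real.sqrt_eq_rpow, div_eq_mul_inv]
    _ = 24 * M * (r ^ (1 / 2 : ℝ) / (1 / 2)) := by
        rw [integral_const_mul, ← intervalIntegral.integral_of_le hr.le,
          integral_rpow (Or.inl (by norm_num))]
        norm_num
    _ = _ := by rw [Real.sqrt_eq_rpow]; ring

/-- Sobolev embedding on the cone, for functions that vanish near the tip. -/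
theorem norm_le_sqrt_of_test (φ : testFunctions) (p : Coord) :
    ‖φ.1 p‖ ≤ 28 * (‖testToL2 φ‖ + ‖testToL2 (laplaceTest φ)‖) * √p.1 := by
  obtain ⟨r, θ⟩ := p
  rcases le_or_gt r 0 with hr | hr
  · rw [eq_zero_of_nonpos φ.2 (p := (r, θ)) hr, norm_zero]
    positivity
  set M := ‖testToL2 φ‖ + ‖testToL2 (laplaceTest φ)‖ with hM
  have c1 := continuous_of_mem φ.2
  have hpi := Real.pi_pos
  -- The value at a point is the circular mean plus the average deviation from the other points of
  -- the circle.
  have e : ((4 * Real.pi : ℝ) : ℂ) * φ.1 (r, θ)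
      = (∫ θ' : Angle, φ.1 (r, θ')) + ∫ θ' : Angle, (φ.1 (r, θ) - φ.1 (r, θ')) := by
    rw [integral_sub (integrable_const _) (integrable_angle (by fun_prop)), integral_const,
      volume_angle, Complex.real_smul]
    ring
  have h1 : ‖∫ θ' : Angle, (φ.1 (r, θ) - φ.1 (r, θ'))‖ ≤ 24 * M * √r * (4 * Real.pi) := by
    have := norm_integral_le_of_norm_le_const (μ := (volume : Measure Angle))
      (Eventually.of_forall fun θ' => norm_sub_le_on_circle φ hr θ θ')
    rwa [volume_angle] at this
  have h2 := norm_integral_angle_le φ hr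
  have h3 : ‖((4 * Real.pi : ℝ) : ℂ) * φ.1 (r, θ)‖ = 4 * Real.pi * ‖φ.1 (r, θ)‖ := by
    rw [norm_mul, Complex.norm_real, Real.norm_of_nonneg (by positivity)]
  have h4 : 4 * Real.pi * ‖φ.1 (r, θ)‖ ≤ 48 * M * √r + 24 * M * √r * (4 * Real.pi) := by
    rw [← h3, e]
    exact (norm_add_le _ _).trans (add_le_add h2 h1)
  have h5 : 0 ≤ M * √r := by positivity
  -- Since `π > 3`, `48 ≤ 4 · 4π`: the mean contributes at most `4` to the constant, and `28 = 24 +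
  -- 4`.
  have h6 : 48 * (M * √r) ≤ 4 * (M * √r) * (4 * Real.pi) := by nlinarith [Real.pi_gt_three]
  have h7 : 4 * Real.pi * ‖φ.1 (r, θ)‖ ≤ 4 * Real.pi * (28 * M * √r) := by linarith
  exact le_of_mul_le_mul_left h7 (by positivity)

/-! ### Separated functions -/

/-- The function `g(r) e^{i n θ / 2}`. -/
noncomputable def radialMode (g : ℝ → ℂ) (n : ℤ) (p : Coord) : ℂ := g p.1 * halfExp n p.2

theorem smoothPunctured_radialMode {g : ℝ → ℂ} (hg : ContDiffOn ℝ ∞ g (Ioi 0)) (n : ℤ) :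
    SmoothPunctured (radialMode g n) := by
  intro x hx
  have h1 : ContDiffAt ℝ ∞ (fun y : ℝ × ℝ => g y.1) x :=
    ContDiffAt.comp (g := g) x (hg.contDiffAt (isOpen_Ioi.mem_nhds hx)) contDiffAt_fst
  exact h1.mul ((contDiff_halfExp_coe n).comp contDiff_snd).contDiffAt

theorem dr_radialMode {g : ℝ → ℂ} {g' : ℂ} (n : ℤ) {p : Coord} (h : HasDerivAt g g' p.1) :
    dr (radialMode g n) p = g' * halfExp n p.2 :=
  dr_eq_of_hasDerivAt (h.mul_const (halfExp n p.2))

theorem dtheta_radialMode (g : ℝ → ℂ) (n : ℤ) (p : Coord) :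
    dtheta (radialMode g n) p = Complex.I * n / 2 * (g p.1 * halfExp n p.2) := by
  obtain ⟨r, θ⟩ := p
  obtain ⟨t, rfl⟩ := exists_angle_coe θ
  refine (dtheta_eq_of_hasDerivAt ((hasDerivAt_halfExp_coe n t).const_mul (g r))).trans ?_
  ring

theorem dx_radialMode {g : ℝ → ℂ} {g' : ℂ} (n : ℤ) {p : Coord} (h : HasDerivAt g g' p.1) :
    dx (radialMode g n) p = (g' - n / 2 * (p.1 : ℂ)⁻¹ * g p.1) / 2 * halfExp (n + 2) p.2
      + (g' + n / 2 * (p.1 : ℂ)⁻¹ * g p.1) / 2 * halfExp (n - 2) p.2 := by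
  rw [dx, dr_radialMode n h, dtheta_radialMode, cosAngle_eq, sinAngle_eq, ← halfExp_mul,
    sub_eq_add_neg n 2, ← halfExp_mul]
  have hI : Complex.I ≠ 0 := Complex.I_ne_zero
  field_simp
  ring

theorem laplace_radialMode {g : ℝ → ℂ} {g' : ℝ → ℂ} {g'' : ℂ} (n : ℤ) {p : Coord} (hp : 0 < p.1)
    (h : ∀ r, 0 < r → HasDerivAt g (g' r) r) (h' : HasDerivAt g' g'' p.1) :
    laplace (radialMode g n) p = -(g'' + (p.1 : ℂ)⁻¹ * g' p.1
      - ((p.1 : ℂ) ^ 2)⁻¹ * ((n / 2) ^ 2 * g p.1)) * halfExp n p.2 := by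
  have e1 : dr (dr (radialMode g n)) p = dr (radialMode g' n) p :=
    dr_congr (fun q hq => dr_radialMode n (h q.1 hq)) hp
  have e2 : dtheta (dtheta (radialMode g n)) p
      = dtheta (radialMode (fun r => Complex.I * n / 2 * g r) n) p :=
    dtheta_congr (fun q hq => by rw [dtheta_radialMode, radialMode]; ring) hp
  rw [laplace, e1, e2, dr_radialMode n h', dr_radialMode n (h _ hp), dtheta_radialMode]
  linear_combination ((p.1 : ℂ) ^ 2)⁻¹ * (n / 2) ^ 2 * g p.1 * halfExp n p.2 * (-Complex.I_sq)

/-- The test function `χ(log r) e^{i n θ / 2}`. -/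
noncomputable def logMode (χ : ℝ → ℝ) (n : ℤ) : Coord → ℂ :=
  radialMode (fun r => if 0 < r then (χ (Real.log r) : ℂ) else 0) n

theorem logMode_of_pos (χ : ℝ → ℝ) (n : ℤ) {p : Coord} (hp : 0 < p.1) :
    logMode χ n p = χ (Real.log p.1) * halfExp n p.2 := by
  simp only [logMode, radialMode, if_pos hp]

/-- A compact support in `t = log r` stays away from `t = -∞`, so it corresponds to a compact
annulus that avoids the tip. -/
theorem logMode_mem {χ : ℝ → ℝ} (h : ContDiff ℝ ∞ χ) (hs : HasCompactSupport χ) (n : ℤ) :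
    logMode χ n ∈ testFunctions := by
  obtain ⟨M, hM⟩ := hs.isCompact.isBounded.subset_closedBall 0
  have h0 : ∀ p : Coord, p ∉ Icc (Real.exp (-M)) (Real.exp M) ×ˢ (univ : Set Angle) →
      logMode χ n p = 0 := by
    intro p hp
    by_cases hr : 0 < p.1
    · rw [logMode_of_pos χ n hr, image_eq_zero_of_notMem_tsupport (f := χ), Complex.ofReal_zero,
        zero_mul]
      intro hn
      have := hM hn
      rw [Real.closedBall_eq_Icc, zero_sub, zero_add] at this
      exact hp ⟨⟨(Real.le_log_iff_exp_le hr).1 this.1, (Real.log_le_iff_le_exp hr).1 this.2⟩, trivial⟩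
    · simp only [logMode, radialMode, if_neg hr, zero_mul]
  have hK : IsCompact (Icc (Real.exp (-M)) (Real.exp M) ×ˢ (univ : Set Angle)) :=
    isCompact_Icc.prod isCompact_univ
  have hsub : tsupport (logMode χ n) ⊆ Icc (Real.exp (-M)) (Real.exp M) ×ˢ (univ : Set Angle) :=
    closure_minimal (fun p hp => by by_contra hn; exact hp (h0 p hn)) hK.isClosed
  have hsm : SmoothPunctured (logMode χ n) := by
    refine smoothPunctured_radialMode ?_ n
    have h1 : ContDiffOn ℝ ∞ (fun r => ((χ (Real.log r) : ℝ) : ℂ)) (Ioi 0) :=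
      Complex.ofRealCLM.contDiff.comp_contDiffOn
        (h.comp_contDiffOn (Real.contDiffOn_log.mono fun r hr => ne_of_gt hr))
    exact h1.congr fun r hr => if_pos hr
  refine ⟨contDiff_iff_contDiffAt.2 fun x => ?_, hK.of_isClosed_subset (isClosed_tsupport _) hsub,
    hsub.trans fun p hp => lt_of_lt_of_le (Real.exp_pos _) hp.1.1⟩
  by_cases hx : 0 < x.1
  · exact hsm x hx
  · have h3 : lift (logMode χ n) =ᶠ[𝓝 x] fun _ => 0 := by
      have : ∀ᶠ y : ℝ × ℝ in 𝓝 x, y.1 < Real.exp (-M) :=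
        continuous_fst.continuousAt.eventually_lt continuousAt_const
          (lt_of_le_of_lt (not_lt.1 hx) (Real.exp_pos _))
      filter_upwards [this] with y hy
      exact h0 _ fun hn => absurd hn.1.1 (not_le.2 hy)
    exact contDiffAt_const.congr_of_eventuallyEq h3

theorem hasDerivAt_comp_log {χ : ℝ → ℝ} (h : ContDiff ℝ ∞ χ) {r : ℝ} (hr : 0 < r) :
    HasDerivAt (fun r => if 0 < r then (χ (Real.log r) : ℂ) else 0)
      ((r : ℂ)⁻¹ * (deriv χ (Real.log r) : ℝ)) r := by
  have h1 := ((h.differentiable (by simp) (Real.log r)).hasDerivAt.comp r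
    (Real.hasDerivAt_log hr.ne')).ofReal_comp
  refine (h1.congr_deriv (by push_cast; ring)).congr_of_eventuallyEq ?_
  filter_upwards [isOpen_Ioi.mem_nhds hr] with s hs
  exact if_pos hs

/-- In logarithmic coordinates `Δ = -e^{-2t} (∂_t² + ∂_θ²)`, and `∂_θ²` acts on `e^{inθ/2}` as
`-(n/2)²`. This conformal form reduces `Δu = -u` to an ordinary differential equation without
singular coefficients. -/
theorem laplace_logMode {χ : ℝ → ℝ} (h : ContDiff ℝ ∞ χ) (n : ℤ) {p : Coord} (hp : 0 < p.1) :
    laplace (logMode χ n) p =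
      -logMode (fun t => Real.exp (-(2 * t)) * (deriv (deriv χ) t - (n / 2) ^ 2 * χ t)) n p := by
  have h2 : ContDiff ℝ ∞ (deriv χ) := (contDiff_infty_iff_deriv.1 h).2
  have hr : (p.1 : ℂ) ≠ 0 := by exact_mod_cast hp.ne'
  have h0 : HasDerivAt (fun s : ℝ => (s : ℂ)⁻¹) (-((p.1 : ℂ) ^ 2)⁻¹) p.1 := by
    have := (by simpa using (hasDerivAt_id p.1).ofReal_comp :
      HasDerivAt (fun s : ℝ => (s : ℂ)) 1 p.1).fun_inv hr
    rwa [neg_div, one_div] at this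
  have h3 : HasDerivAt (fun s : ℝ => (s : ℂ)⁻¹ * (deriv χ (Real.log s) : ℝ))
      (-((p.1 : ℂ) ^ 2)⁻¹ * (deriv χ (Real.log p.1) : ℝ)
        + (p.1 : ℂ)⁻¹ * ((p.1 : ℂ)⁻¹ * (deriv (deriv χ) (Real.log p.1) : ℝ))) p.1 := by
    refine (h0.mul (hasDerivAt_comp_log h2 hp)).congr_of_eventuallyEq ?_ |>.congr_deriv ?_
    · filter_upwards [isOpen_Ioi.mem_nhds hp] with s hs
      simp only [Pi.mul_apply, if_pos (mem_Ioi.1 hs)]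
    · rw [if_pos hp]
  rw [logMode, laplace_radialMode n hp (fun r hr => hasDerivAt_comp_log h hr) h3, if_pos hp,
    logMode_of_pos _ _ hp, two_mul, neg_add, Real.exp_add, Real.exp_neg, Real.exp_log hp]
  push_cast
  field_simp
  ring

/-! ### Fourier coefficients in the angular variable -/

theorem integral_halfExp (n : ℤ) :
    ∫ θ : Angle, halfExp n θ = if n = 0 then ((4 * Real.pi : ℝ) : ℂ) else 0 := by
  split_ifs with h
  · subst h
    simp only [halfExp_zero, integral_const, volume_angle, Complex.real_smul, mul_one]
  · have h1 := AddCircle.integral_haarAddCircle (T := 4 * Real.pi) (f := halfExp n)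
    have h2 := congrFun (fourierCoeff_fourier (T := 4 * Real.pi) n) 0
    rw [Pi.single_eq_of_ne (Ne.symm h)] at h2
    simp only [fourierCoeff, neg_zero, fourier_zero, one_smul] at h2
    change ∫ t, halfExp n t ∂_ = 0 at h2
    rw [h2] at h1
    have h3 := (smul_eq_zero.1 h1.symm).resolve_left (by positivity)
    exact h3

theorem ae_eq_zero_of_fourier {f : Angle → ℂ} (hf : MemLp f 2)
    (h : ∀ n : ℤ, ∫ θ, f θ * halfExp n θ = 0) : f =ᵐ[volume] 0 := by
  have hf2 : MemLp f 2 AddCircle.haarAddCircle := memLp_haarAddCircle_iff.2 hf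
  have h0 : hf2.toLp f = 0 := by
    rw [← fourierBasis.repr.map_eq_zero_iff]
    ext n
    rw [fourierBasis_repr, fourierCoeff_congr_ae hf2.coeFn_toLp, fourierCoeff,
      AddCircle.integral_haarAddCircle]
    have e : (fun θ : Angle => fourier (-n) θ • f θ) = fun θ => f θ * halfExp (-n) θ := by
      ext θ
      rw [halfExp, smul_eq_mul, mul_comm]
    rw [e, h (-n), smul_zero]
    rfl
  have h1 := hf2.coeFn_toLp
  rw [h0] at h1
  have h2 : f =ᵐ[AddCircle.haarAddCircle] 0 := h1.symm.trans (Lp.coeFn_zero _ _ _)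
  have h3 : (volume : Measure Angle) ≪ AddCircle.haarAddCircle := by
    rw [AddCircle.volume_eq_smul_haarAddCircle]
    exact Measure.smul_absolutelyContinuous
  exact h3.ae_eq h2

/-- A differentiable map of the line, here the exponential, carries null sets to null sets. -/
theorem ae_radialMeasure_of_exp {P : ℝ → Prop} (h : ∀ᵐ t : ℝ, P (Real.exp t)) :
    ∀ᵐ r ∂radialMeasure, P r := by
  have hac : radialMeasure ≪ volume.restrict (Ioi (0 : ℝ)) := withDensity_absolutelyContinuous _ _
  refine hac.ae_le ?_
  refine (ae_restrict_iff' measurableSet_Ioi).2 ?_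
  have h1 : volume (Real.exp '' {t | ¬P (Real.exp t)}) = 0 :=
    addHaar_image_eq_zero_of_differentiableOn_of_addHaar_eq_zero volume
      Real.differentiable_exp.differentiableOn h
  refine measure_mono_null (fun r hr => ?_) h1
  obtain ⟨h2, h3⟩ := not_forall.1 (show ¬(r ∈ Ioi (0 : ℝ) → P r) from hr)
  exact ⟨Real.log r, by rw [mem_ofPred_eq, Real.exp_log h2]; exact h3, Real.exp_log h2⟩

/-- The Fourier coefficient `∫ u(e^t, θ) e^{i n θ / 2} dθ`. -/
noncomputable def angularCoeff (u : ConeL2) (n : ℤ) (t : ℝ) : ℂ :=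
  ∫ θ : Angle, u (Real.exp t, θ) * halfExp n θ

theorem ae_memLp_slice (u : ConeL2) : ∀ᵐ r ∂radialMeasure, MemLp (fun θ : Angle => u (r, θ)) 2 := by
  have h1 : Integrable (fun p : ℝ × Angle => ‖u p‖ ^ 2) (radialMeasure.prod volume) :=
    (Lp.memLp u).integrable_norm_pow (p := 2) (by simp)
  filter_upwards [h1.prod_right_ae] with r hr
  have hm : AEStronglyMeasurable (fun θ : Angle => u (r, θ)) volume :=
    ((Lp.stronglyMeasurable u).comp_measurable measurable_prodMk_left).aestronglyMeasurable
  exact (memLp_two_iff_integrable_sq_norm hm).2 hr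

theorem integral_mul_logMode {χ : ℝ → ℝ} (h : ContDiff ℝ ∞ χ) (hs : HasCompactSupport χ) (n : ℤ)
    (u : ConeL2) :
    Integrable (fun t => (Real.exp (2 * t) * χ t) • angularCoeff u n t) ∧
    ∫ p, u p * logMode χ n p ∂coneMeasure
      = ∫ t, (Real.exp (2 * t) * χ t) • angularCoeff u n t := by
  have hI : Integrable (fun p : ℝ × Angle => u p * logMode χ n p) (radialMeasure.prod volume) :=
    (Lp.memLp u).integrable_mul (memLp_of_mem (logMode_mem h hs n))
  have e : ∀ t : ℝ, Real.exp (2 * t) • ∫ θ : Angle, u (Real.exp t, θ) * logMode χ n (Real.exp t, θ)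
      = (Real.exp (2 * t) * χ t) • angularCoeff u n t := by
    intro t
    rw [mul_smul, angularCoeff, ← integral_smul (χ t)]
    congr 2
    ext θ
    rw [logMode_of_pos χ n (p := (Real.exp t, θ)) (Real.exp_pos t), Real.log_exp, Complex.real_smul]
    ring
  have h1 := integrable_radialMeasure_iff.1 hI.integral_prod_left
  have h2 := integral_cone hI
  rw [integral_radialMeasure_eq_exp] at h2
  simp only [e] at h1 h2
  exact ⟨h1, h2⟩

theorem exists_contDiff_one_on_ball (R : ℝ) (hR : 0 < R) : ∃ χ : ℝ → ℝ, ContDiff ℝ ∞ χ ∧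
    HasCompactSupport χ ∧ (∀ t, |t| ≤ R → χ t = 1) ∧ ∀ t, 0 ≤ χ t := by
  let f : ContDiffBump (0 : ℝ) := ⟨R, R + 1, hR, by linarith⟩
  exact ⟨f, f.contDiff, f.hasCompactSupport, fun t ht => f.one_of_mem_closedBall (by simpa using ht),
    fun t => f.nonneg⟩

theorem locallyIntegrable_angularCoeff (u : ConeL2) (n : ℤ) :
    LocallyIntegrable (angularCoeff u n) := by
  rw [locallyIntegrable_iff]
  intro K hK
  obtain ⟨R, hR⟩ := hK.isBounded.subset_closedBall 0
  obtain ⟨χ, h1, h2, h3, -⟩ := exists_contDiff_one_on_ball (max R 1) (by positivity)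
  -- The factor `e^{-2t}` cancels the density `e^{2t}`, so the tested integrand equals the
  -- coefficient itself wherever `χ = 1`.
  have h4 : ContDiff ℝ ∞ fun t => Real.exp (-(2 * t)) * χ t := by fun_prop
  have h5 := (integral_mul_logMode h4 h2.mul_left n u).1.integrableOn (s := K)
  refine h5.congr_fun (fun t ht => ?_) hK.measurableSet
  have ht2 : |t| ≤ max R 1 := by
    have := hR ht
    rw [mem_closedBall_zero_iff, Real.norm_eq_abs] at this
    exact this.trans (le_max_left _ _)
  simp only [h3 t ht2, mul_one]
  rw [← Real.exp_add, add_neg_cancel, Real.exp_zero, one_smul]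

/-- Cauchy–Schwarz on each circle bounds the squared coefficient by `4π ∫ |u|² dθ`, which is
integrable for `r dr` by Fubini. -/
theorem integrable_exp_mul_norm_sq_angularCoeff (u : ConeL2) (n : ℤ) :
    Integrable fun t => Real.exp (2 * t) * ‖angularCoeff u n t‖ ^ 2 := by
  have h1 : Integrable (fun p : ℝ × Angle => ‖u p‖ ^ 2) (radialMeasure.prod volume) :=
    (Lp.memLp u).integrable_norm_pow (p := 2) (by simp)
  have h2 : Integrable (fun r => ‖∫ θ : Angle, u (r, θ) * halfExp n θ‖ ^ 2) radialMeasure := by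
    have hm : StronglyMeasurable (fun r => ∫ θ : Angle, u (r, θ) * halfExp n θ) := by
      have h1 : StronglyMeasurable (fun p : ℝ × Angle => u p * halfExp n p.2) :=
        (Lp.stronglyMeasurable u).mul
          ((continuous_halfExp n).comp continuous_snd).stronglyMeasurable
      exact h1.integral_prod_right' (ν := volume)
    refine Integrable.mono' (h1.integral_prod_left.const_mul (4 * Real.pi))
      (hm.norm.pow 2).aestronglyMeasurable ?_
    filter_upwards [ae_memLp_slice u] with r hr
    rw [norm_pow, norm_norm]
    have k1 : Integrable (fun θ : Angle => ‖u (r, θ)‖ ^ 2) := hr.integrable_norm_pow (p := 2) (by simp)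
    have k2 : Integrable (fun θ : Angle => ‖u (r, θ)‖) := (hr.integrable one_le_two).norm
    have k3 : ‖∫ θ : Angle, u (r, θ) * halfExp n θ‖ ≤ ∫ θ : Angle, ‖u (r, θ)‖ := by
      refine (norm_integral_le_integral_norm _).trans_eq ?_
      simp only [norm_mul, norm_halfExp, mul_one]
    exact (pow_le_pow_left₀ (norm_nonneg _) k3 2).trans (sq_integral_angle_le k2 k1)
  exact integrable_radialMeasure_iff.1 h2

theorem eq_zero_of_angularCoeff {u : ConeL2} (h : ∀ n, angularCoeff u n =ᵐ[volume] 0) : u = 0 := by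
  have h1 : ∀ᵐ r ∂radialMeasure, ∀ n : ℤ, ∫ θ : Angle, u (r, θ) * halfExp n θ = 0 :=
    ae_all_iff.2 fun n => ae_radialMeasure_of_exp (h n)
  have h2 : ∀ᵐ r ∂radialMeasure, ∫ θ : Angle, ‖u (r, θ)‖ ^ 2 = 0 := by
    filter_upwards [h1, ae_memLp_slice u] with r hr1 hr2
    refine integral_eq_zero_of_ae ?_
    filter_upwards [ae_eq_zero_of_fourier hr2 hr1] with θ hθ
    simp [hθ]
  have h3 : Integrable (fun p : ℝ × Angle => ‖u p‖ ^ 2) (radialMeasure.prod volume) :=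
    (Lp.memLp u).integrable_norm_pow (p := 2) (by simp)
  have h4 : ∫ p, ‖u p‖ ^ 2 ∂coneMeasure = 0 :=
    (integral_prod _ h3).trans (integral_eq_zero_of_ae h2)
  have h5 := (integral_eq_zero_iff_of_nonneg (fun p => by positivity) h3).1 h4
  rw [Lp.eq_zero_iff_ae_eq_zero]
  filter_upwards [h5] with p hp
  simpa using hp

theorem angularCoeff_eq_zero_of_forall {u : ConeL2} {n : ℤ}
    (h : ∀ χ : ℝ → ℝ, ContDiff ℝ ∞ χ → HasCompactSupport χ →
      ∫ p, u p * logMode χ n p ∂coneMeasure = 0) : angularCoeff u n =ᵐ[volume] 0 := by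
  refine ae_eq_zero_of_integral_contDiff_smul_eq_zero (locallyIntegrable_angularCoeff u n)
    fun χ h1 h2 => ?_
  have h4 : ContDiff ℝ ∞ fun t => Real.exp (-(2 * t)) * χ t := by fun_prop
  have h5 := (integral_mul_logMode h4 h2.mul_left n u).2
  rw [h _ h4 h2.mul_left] at h5
  rw [h5]
  congr 1
  ext t
  rw [← mul_assoc, ← Real.exp_add, add_neg_cancel, Real.exp_zero, one_mul]

/-- Separated test functions already suffice: they determine all Fourier coefficients almost
everywhere, and these determine `u`. This yields the density of the test functions and the
uniqueness of weak Laplacians. -/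
theorem eq_zero_of_integral_test {u : ConeL2}
    (h : ∀ φ ∈ testFunctions, ∫ p, u p * φ p ∂coneMeasure = 0) : u = 0 :=
  eq_zero_of_angularCoeff fun n => angularCoeff_eq_zero_of_forall fun _ h1 h2 =>
    h _ (logMode_mem h1 h2 n)

/-! ### The closure and the adjoint of the Laplace operator -/

theorem dense_coneLaplacian_domain : Dense (coneLaplacian.domain : Set ConeL2) := by
  rw [Submodule.dense_iff_topologicalClosure_eq_top, Submodule.topologicalClosure_eq_top_iff,
    Submodule.eq_bot_iff]
  intro u hu
  refine eq_zero_of_integral_test fun φ hφ => ?_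
  have h := (Submodule.mem_orthogonal _ _).1 hu _
    (LinearMap.mem_range_self testToL2 (conjTest ⟨φ, hφ⟩))
  rw [inner_testToL2_left] at h
  simpa [conjTest] using h

/-- `f` is the Laplacian of `u` in the sense of distributions on `C°`. -/
def IsWeakLaplace (u f : ConeL2) : Prop :=
  ∀ φ : testFunctions, inner ℂ (testToL2 φ) f = inner ℂ (testToL2 (laplaceTest φ)) u

/-- `(u, f)` is the limit in the graph norm of a sequence of test functions. -/
def IsGraphLimit (u f : ConeL2) : Prop :=
  ∃ φ : ℕ → testFunctions, Tendsto (fun n => testToL2 (φ n)) atTop (𝓝 u) ∧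
    Tendsto (fun n => testToL2 (laplaceTest (φ n))) atTop (𝓝 f)

theorem isWeakLaplace_of_integral {u f : ConeL2}
    (h : ∀ φ ∈ testFunctions, ∫ p, f p * φ p ∂coneMeasure = ∫ p, u p * laplace φ p ∂coneMeasure) :
    IsWeakLaplace u f := by
  intro φ
  rw [inner_testToL2_left, inner_testToL2_left]
  refine (h _ (conj_mem φ.2)).trans (integral_congr_ae (Eventually.of_forall fun p => ?_))
  simp only [laplace_conj]
  rfl

theorem IsWeakLaplace.integral_eq {u f : ConeL2} (h : IsWeakLaplace u f) {φ : Coord → ℂ}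
    (hφ : φ ∈ testFunctions) :
    ∫ p, f p * φ p ∂coneMeasure = ∫ p, u p * laplace φ p ∂coneMeasure := by
  have h1 := h (conjTest ⟨φ, hφ⟩)
  rw [inner_testToL2_left, inner_testToL2_left] at h1
  have h2 : ∀ p, laplace (fun p => (starRingEnd ℂ) (φ p)) p = (starRingEnd ℂ) (laplace φ p) :=
    laplace_conj
  simpa [conjTest, laplaceTest, h2] using h1

theorem mem_coneLaplacian_graph {x : ConeL2 × ConeL2} :
    x ∈ coneLaplacian.graph ↔ ∃ φ, testToL2 φ = x.1 ∧ testToL2 (laplaceTest φ) = x.2 := by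
  rw [LinearPMap.mem_graph_iff]
  constructor
  · rintro ⟨⟨_, φ, rfl⟩, h1, h2⟩
    exact ⟨φ, h1, (coneLaplacian_apply φ).symm.trans h2⟩
  · rintro ⟨φ, h1, h2⟩
    exact ⟨⟨_, LinearMap.mem_range_self _ φ⟩, h1, (coneLaplacian_apply φ).trans h2⟩

theorem coneLaplacian_isFormalAdjoint : coneLaplacian.IsFormalAdjoint coneLaplacian := by
  rintro ⟨_, φ, rfl⟩ ⟨_, ψ, rfl⟩
  have h1 := coneLaplacian_apply φ
  have h2 := coneLaplacian_apply ψ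
  rw [h1, h2]
  exact inner_laplaceTest_symm φ ψ

/-- A densely defined symmetric operator is contained in its adjoint, which is closed. -/
theorem coneLaplacian_isClosable : coneLaplacian.IsClosable :=
  (LinearPMap.adjoint_isClosed dense_coneLaplacian_domain).isClosable.leIsClosable
    (coneLaplacian_isFormalAdjoint.le_adjoint dense_coneLaplacian_domain)

theorem mem_closure_graph_iff {u f : ConeL2} :
    (u, f) ∈ coneLaplacian.closure.graph ↔ IsGraphLimit u f := by
  rw [← coneLaplacian_isClosable.graph_closure_eq_closure_graph, ← SetLike.mem_coe,
    Submodule.topologicalClosure_coe, mem_closure_iff_seq_limit]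
  constructor
  · rintro ⟨x, h1, h2⟩
    choose φ h3 h4 using fun n => mem_coneLaplacian_graph.1 (h1 n)
    rw [Prod.tendsto_iff] at h2
    exact ⟨φ, h2.1.congr fun n => (h3 n).symm, h2.2.congr fun n => (h4 n).symm⟩
  · rintro ⟨φ, h1, h2⟩
    exact ⟨fun n => (testToL2 (φ n), testToL2 (laplaceTest (φ n))),
      fun n => mem_coneLaplacian_graph.2 ⟨φ n, rfl, rfl⟩, h1.prodMk_nhds h2⟩

theorem mem_closure_domain_iff {u : ConeL2} :
    u ∈ coneLaplacian.closure.domain ↔ ∃ f, IsGraphLimit u f := by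
  rw [LinearPMap.mem_domain_iff]
  exact exists_congr fun f => mem_closure_graph_iff

theorem isWeakLaplace_adjoint (u : coneLaplacian.adjoint.domain) :
    IsWeakLaplace u (coneLaplacian.adjoint u) := by
  intro φ
  have h := LinearPMap.adjoint_isFormalAdjoint dense_coneLaplacian_domain u
    ⟨_, LinearMap.mem_range_self testToL2 φ⟩
  rw [coneLaplacian_apply] at h
  have h2 := congrArg (starRingEnd ℂ) h
  rwa [inner_conj_symm, inner_conj_symm] at h2

theorem mem_adjoint_domain_iff' {u : ConeL2} :
    u ∈ coneLaplacian.adjoint.domain ↔ ∃ f, IsWeakLaplace u f := by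
  constructor
  · exact fun hu => ⟨_, isWeakLaplace_adjoint ⟨u, hu⟩⟩
  · rintro ⟨f, hf⟩
    refine LinearPMap.mem_adjoint_domain_of_exists u ⟨f, ?_⟩
    rintro ⟨_, φ, rfl⟩
    have h1 := coneLaplacian_apply φ
    rw [h1, ← inner_conj_symm, hf φ, inner_conj_symm]

theorem IsWeakLaplace.inner_eq_of_isGraphLimit {u f v g : ConeL2} (h : IsWeakLaplace u f)
    (hv : IsGraphLimit v g) : inner ℂ v f = inner ℂ g u := by
  obtain ⟨φ, h1, h2⟩ := hv
  exact tendsto_nhds_unique ((h1.inner tendsto_const_nhds).congr fun n => h (φ n))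
    (h2.inner tendsto_const_nhds)

theorem isGraphLimit_test (φ : testFunctions) :
    IsGraphLimit (testToL2 φ) (testToL2 (laplaceTest φ)) :=
  ⟨fun _ => φ, tendsto_const_nhds, tendsto_const_nhds⟩

/-- The weak equation tested on `C_c^∞(C°)` extends to graph limits by continuity of the inner
product, so passing to the closure does not change the adjoint. -/
theorem mem_closure_adjoint_domain_iff {u : ConeL2} :
    u ∈ coneLaplacian.closure.adjoint.domain ↔ ∃ f, IsWeakLaplace u f := by
  have hd : Dense (coneLaplacian.closure.domain : Set ConeL2) :=
    dense_coneLaplacian_domain.mono coneLaplacian.le_closure.1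
  constructor
  · intro hu
    refine ⟨coneLaplacian.closure.adjoint ⟨u, hu⟩, fun φ => ?_⟩
    obtain ⟨x, hx1, hx2⟩ := (LinearPMap.mem_graph_iff _).1
      (mem_closure_graph_iff.2 (isGraphLimit_test φ))
    have h := LinearPMap.adjoint_isFormalAdjoint hd ⟨u, hu⟩ x
    rw [hx2, show ((x : ConeL2)) = testToL2 φ from hx1] at h
    rw [← inner_conj_symm, ← inner_conj_symm (testToL2 (laplaceTest φ))]
    exact congrArg _ h
  · rintro ⟨f, hf⟩
    refine LinearPMap.mem_adjoint_domain_of_exists u ⟨f, fun x => ?_⟩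
    have h := mem_closure_graph_iff.1 (coneLaplacian.closure.mem_graph x)
    rw [← inner_conj_symm, hf.inner_eq_of_isGraphLimit h, inner_conj_symm]

theorem IsGraphLimit.isWeakLaplace {u f : ConeL2} (h : IsGraphLimit u f) : IsWeakLaplace u f := by
  obtain ⟨φ, h1, h2⟩ := h
  intro ψ
  refine tendsto_nhds_unique (tendsto_const_nhds.inner h2) ?_
  exact (tendsto_const_nhds.inner h1).congr fun n => inner_laplaceTest_symm ψ (φ n)

theorem IsWeakLaplace.unique {u f g : ConeL2} (hf : IsWeakLaplace u f) (hg : IsWeakLaplace u g) :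
    f = g := by
  rw [← sub_eq_zero]
  refine eq_zero_of_integral_test fun φ hφ => ?_
  have h1 := hf (conjTest ⟨φ, hφ⟩)
  rw [← hg, ← sub_eq_zero, ← inner_sub_right, inner_testToL2_left] at h1
  simpa [conjTest] using h1

theorem IsWeakLaplace.add {u v f g : ConeL2} (hf : IsWeakLaplace u f) (hg : IsWeakLaplace v g) :
    IsWeakLaplace (u + v) (f + g) := fun φ => by
  rw [inner_add_right, inner_add_right, hf φ, hg φ]

theorem IsWeakLaplace.smul {u f : ConeL2} (c : ℂ) (hf : IsWeakLaplace u f) :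
    IsWeakLaplace (c • u) (c • f) := fun φ => by
  rw [inner_smul_right, inner_smul_right, hf φ]

/-! ### Regularity of the elements of the domain of the closure -/

theorem isWeakDx_of_tendsto {u v : ConeL2} {φ : ℕ → testFunctions}
    (h1 : Tendsto (fun n => testToL2 (φ n)) atTop (𝓝 u))
    (h2 : Tendsto (fun n => testToL2 (dxTest (φ n))) atTop (𝓝 v)) : IsWeakDx u v := by
  intro ψ hψ
  have h : inner ℂ (testToL2 (conjTest ⟨ψ, hψ⟩)) v
      = -inner ℂ (testToL2 (dxTest (conjTest ⟨ψ, hψ⟩))) u := by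
    refine tendsto_nhds_unique (tendsto_const_nhds.inner h2) ?_
    exact (tendsto_const_nhds.inner h1).neg.congr fun n => (inner_dxTest _ _).symm
  rw [inner_testToL2_left, inner_testToL2_left] at h
  have h2 : ∀ p, dx (fun p => (starRingEnd ℂ) (ψ p)) p = (starRingEnd ℂ) (dx ψ p) := dx_conj
  simpa [conjTest, dxTest, h2] using h

theorem isWeakDy_of_tendsto {u v : ConeL2} {φ : ℕ → testFunctions}
    (h1 : Tendsto (fun n => testToL2 (φ n)) atTop (𝓝 u))
    (h2 : Tendsto (fun n => testToL2 (dyTest (φ n))) atTop (𝓝 v)) : IsWeakDy u v := by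
  intro ψ hψ
  have h : inner ℂ (testToL2 (conjTest ⟨ψ, hψ⟩)) v
      = -inner ℂ (testToL2 (dyTest (conjTest ⟨ψ, hψ⟩))) u := by
    refine tendsto_nhds_unique (tendsto_const_nhds.inner h2) ?_
    exact (tendsto_const_nhds.inner h1).neg.congr fun n => (inner_dyTest _ _).symm
  rw [inner_testToL2_left, inner_testToL2_left] at h
  have h2 : ∀ p, dy (fun p => (starRingEnd ℂ) (ψ p)) p = (starRingEnd ℂ) (dy ψ p) := dy_conj
  simpa [conjTest, dyTest, h2] using h

theorem norm_dxTest_le (φ : testFunctions) :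
    ‖testToL2 (dxTest φ)‖ ≤ ‖testToL2 φ‖ + ‖testToL2 (laplaceTest φ)‖ ∧
      ‖testToL2 (dyTest φ)‖ ≤ ‖testToL2 φ‖ + ‖testToL2 (laplaceTest φ)‖ := by
  have h := sq_add_sq_le_norm_mul_norm_laplaceTest φ
  have h1 := norm_nonneg (testToL2 φ)
  have h2 := norm_nonneg (testToL2 (laplaceTest φ))
  constructor <;> refine le_of_sq_le_sq ?_ (by positivity) <;>
    nlinarith [sq_nonneg ‖testToL2 (dxTest φ)‖, sq_nonneg ‖testToL2 (dyTest φ)‖]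

theorem cauchySeq_of_graph {F : Type*} [NormedAddCommGroup F] {u f : ConeL2}
    {φ : ℕ → testFunctions} (h1 : Tendsto (fun n => testToL2 (φ n)) atTop (𝓝 u))
    (h2 : Tendsto (fun n => testToL2 (laplaceTest (φ n))) atTop (𝓝 f)) (L : testFunctions →+ F)
    (hL : ∀ φ, ‖L φ‖ ≤ ‖testToL2 φ‖ + ‖testToL2 (laplaceTest φ)‖) :
    CauchySeq fun n => L (φ n) := by
  have h3 := h1.cauchySeq
  have h4 := h2.cauchySeq
  rw [Metric.cauchySeq_iff] at *
  intro ε hε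
  obtain ⟨N1, hN1⟩ := h3 (ε / 2) (by positivity)
  obtain ⟨N2, hN2⟩ := h4 (ε / 2) (by positivity)
  refine ⟨max N1 N2, fun m hm n hn => ?_⟩
  have k1 := hN1 m (le_of_max_le_left hm) n (le_of_max_le_left hn)
  have k2 := hN2 m (le_of_max_le_right hm) n (le_of_max_le_right hn)
  rw [dist_eq_norm, ← map_sub] at *
  rw [← map_sub] at k2
  have := hL (φ m - φ n)
  linarith

/-- The energy and Hessian bounds make the derivatives of order at most two of the approximating
sequence Cauchy in `L²`. Their limits are weak derivatives of `u`. -/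
theorem IsGraphLimit.memSobolev {u f : ConeL2} (h : IsGraphLimit u f) : MemSobolev 2 u := by
  obtain ⟨φ, h1, h2⟩ := h
  have key : ∀ L : testFunctions →ₗ[ℂ] testFunctions,
      (∀ φ, ‖testToL2 (L φ)‖ ≤ ‖testToL2 φ‖ + ‖testToL2 (laplaceTest φ)‖) →
      ∃ v, Tendsto (fun n => testToL2 (L (φ n))) atTop (𝓝 v) := fun L hL =>
    cauchySeq_tendsto_of_complete
      (cauchySeq_of_graph h1 h2 (testToL2 ∘ₗ L).toAddMonoidHom hL)
  obtain ⟨v, hv⟩ := key dxTest fun φ => (norm_dxTest_le φ).1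
  obtain ⟨w, hw⟩ := key dyTest fun φ => (norm_dxTest_le φ).2
  have hn := fun φ : testFunctions => norm_nonneg (testToL2 φ)
  obtain ⟨vx, hvx⟩ := key (dxTest ∘ₗ dxTest) fun φ =>
    (hessian_dxTest φ).1.trans (le_add_of_nonneg_left (hn φ))
  obtain ⟨vy, hvy⟩ := key (dyTest ∘ₗ dxTest) fun φ =>
    (hessian_dxTest φ).2.trans (le_add_of_nonneg_left (hn φ))
  obtain ⟨wx, hwx⟩ := key (dxTest ∘ₗ dyTest) fun φ =>
    (hessian_dyTest φ).1.trans (le_add_of_nonneg_left (hn φ))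
  obtain ⟨wy, hwy⟩ := key (dyTest ∘ₗ dyTest) fun φ =>
    (hessian_dyTest φ).2.trans (le_add_of_nonneg_left (hn φ))
  exact ⟨v, w, isWeakDx_of_tendsto h1 hv, isWeakDy_of_tendsto h1 hw,
    ⟨vx, vy, isWeakDx_of_tendsto hv hvx, isWeakDy_of_tendsto hv hvy, trivial, trivial⟩,
    ⟨wx, wy, isWeakDx_of_tendsto hw hwx, isWeakDy_of_tendsto hw hwy, trivial, trivial⟩⟩

theorem MemSobolev.exists_isWeakLaplace {u : ConeL2} (h : MemSobolev 2 u) :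
    ∃ f, IsWeakLaplace u f := by
  obtain ⟨v, w, h1, h2, ⟨vx, -, h3, -, -, -⟩, ⟨-, wy, -, h4, -, -⟩⟩ := h
  refine ⟨-(vx + wy), isWeakLaplace_of_integral fun φ hφ => ?_⟩
  have i : ∀ (g : ConeL2) {ψ : Coord → ℂ}, ψ ∈ testFunctions →
      Integrable (fun p => g p * ψ p) coneMeasure :=
    fun g ψ hψ => (Lp.memLp g).integrable_mul (memLp_of_mem hψ)
  have e1 : ∫ p, (-(vx + wy) : ConeL2) p * φ p ∂coneMeasure
      = ∫ p, -(vx p * φ p + wy p * φ p) ∂coneMeasure := by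
    refine integral_congr_ae ?_
    filter_upwards [Lp.coeFn_neg (vx + wy), Lp.coeFn_add vx wy] with p hp1 hp2
    rw [hp1, Pi.neg_apply, hp2, Pi.add_apply]
    ring
  have e2 : ∫ p, u p * laplace φ p ∂coneMeasure
      = ∫ p, -(u p * dx (dx φ) p + u p * dy (dy φ) p) ∂coneMeasure :=
    integral_congr_pos fun p hp => by rw [(smoothPunctured_of_mem hφ).laplace_eq hp]; ring
  rw [e1, e2, integral_neg, integral_neg, integral_add (i vx hφ) (i wy hφ),
    integral_add (i u (dx_mem (dx_mem hφ))) (i u (dy_mem (dy_mem hφ))), h3 φ hφ, h4 φ hφ]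
  have k1 := h1 _ (dx_mem hφ)
  have k2 := h2 _ (dy_mem hφ)
  rw [k1, k2, neg_neg, neg_neg]

theorem tendsto_sqrt_tip : Tendsto (fun p : Coord => √p.1) (comap Prod.fst (𝓝[>] (0 : ℝ))) (𝓝 0) := by
  have h : Tendsto (fun r : ℝ => √r) (𝓝[>] 0) (𝓝 0) :=
    (Real.continuous_sqrt.tendsto' 0 0 Real.sqrt_zero).mono_left nhdsWithin_le_nhds
  exact h.comp tendsto_comap

/-- Applied to differences, the `√r` estimate makes the approximating test functions converge
uniformly on sets of bounded `r`. The continuous limit inherits the bound `C √r`, hence the value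
`0`. -/
theorem IsGraphLimit.hasValueAtTip {u f : ConeL2} (h : IsGraphLimit u f) : HasValueAtTip u 0 := by
  obtain ⟨φ, h1, h2⟩ := h
  have hc : ∀ p : Coord, ∃ z, Tendsto (fun n => (φ n).1 p) atTop (𝓝 z) := by
    intro p
    have hb : ∀ ψ : testFunctions, ‖ψ.1 p‖ ≤
        28 * √p.1 * (‖testToL2 ψ‖ + ‖testToL2 (laplaceTest ψ)‖) := fun ψ =>
      (norm_le_sqrt_of_test ψ p).trans_eq (by ring)
    refine cauchySeq_tendsto_of_complete (Metric.cauchySeq_iff.2 fun ε hε => ?_)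
    -- The summand `1` keeps the divisor positive also when `r ≤ 0`, where `√r = 0`.
    have hs : 0 < 28 * √p.1 + 1 := by positivity
    obtain ⟨N1, hN1⟩ := Metric.cauchySeq_iff.1 h1.cauchySeq (ε / (28 * √p.1 + 1) / 2) (by positivity)
    obtain ⟨N2, hN2⟩ := Metric.cauchySeq_iff.1 h2.cauchySeq (ε / (28 * √p.1 + 1) / 2) (by positivity)
    refine ⟨max N1 N2, fun m hm n hn => ?_⟩
    have k1 := hN1 m (le_of_max_le_left hm) n (le_of_max_le_left hn)
    have k2 := hN2 m (le_of_max_le_right hm) n (le_of_max_le_right hn)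
    rw [dist_eq_norm, ← map_sub] at k1 k2
    rw [← map_sub] at k2
    have k3 := hb (φ m - φ n)
    have k4 : ‖testToL2 (φ m - φ n)‖ + ‖testToL2 (laplaceTest (φ m - φ n))‖
      < ε / (28 * √p.1 + 1) := by linarith
    rw [lt_div_iff₀ hs] at k4
    rw [dist_eq_norm]
    refine lt_of_le_of_lt (k3.trans ?_) k4
    have := norm_nonneg (testToL2 (φ m - φ n))
    have := norm_nonneg (testToL2 (laplaceTest (φ m - φ n)))
    nlinarith
  choose g hg using hc
  have hb0 : ∀ p, ‖g p‖ ≤ 28 * (‖u‖ + ‖f‖) * √p.1 := fun p =>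
    le_of_tendsto_of_tendsto' (hg p).norm
      (((h1.norm.add h2.norm).const_mul 28).mul_const _) fun n => norm_le_sqrt_of_test (φ n) p
  have hb1 : ∀ n p, ‖g p - (φ n).1 p‖
      ≤ 28 * (‖u - testToL2 (φ n)‖ + ‖f - testToL2 (laplaceTest (φ n))‖) * √p.1 := by
    intro n p
    refine le_of_tendsto_of_tendsto' ((hg p).sub_const _).norm
      (((((h1.sub_const _).norm).add (h2.sub_const _).norm).const_mul 28).mul_const _) fun m => ?_
    have := norm_le_sqrt_of_test (φ m - φ n) p
    rw [map_sub, map_sub, map_sub] at this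
    exact this
  have he : Tendsto (fun n => 28 * (‖u - testToL2 (φ n)‖ + ‖f - testToL2 (laplaceTest (φ n))‖))
      atTop (𝓝 0) := by
    have k1 := (tendsto_const_nhds (x := u)).sub h1
    have k2 := (tendsto_const_nhds (x := f)).sub h2
    simpa using (k1.norm.add k2.norm).const_mul 28
  refine ⟨g, ?_, ?_, ?_⟩
  -- An almost everywhere convergent subsequence identifies the `L²` limit with the pointwise limit
  -- `g`.
  · obtain ⟨ns, hns, h4⟩ := (tendstoInMeasure_of_tendsto_Lp h1).exists_seq_tendsto_ae
    have h5 : ∀ᵐ p ∂coneMeasure, ∀ n, (testToL2 (φ n) : ConeL2) p = (φ n).1 p :=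
      ae_all_iff.2 fun n => (memLp_of_mem (φ n).2).coeFn_toLp

    filter_upwards [h4, h5] with p hp1 hp2
    exact tendsto_nhds_unique (hp1.congr fun n => hp2 _) ((hg p).comp hns.tendsto_atTop)
  · have hU : TendstoLocallyUniformly (fun n => (φ n).1) g atTop := by
      rw [Metric.tendstoLocallyUniformly_iff]
      intro ε hε p
      refine ⟨{y | y.1 < p.1 + 1}, continuous_fst.continuousAt.eventually_lt continuousAt_const
        (lt_add_one p.1), ?_⟩
      have h7 := he.mul_const (√(p.1 + 1))
      rw [zero_mul] at h7
      filter_upwards [h7.eventually (gt_mem_nhds hε)] with n hn y hy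
      rw [dist_eq_norm]
      refine lt_of_le_of_lt ((hb1 n y).trans ?_) hn
      exact mul_le_mul_of_nonneg_left (Real.sqrt_le_sqrt (le_of_lt hy)) (by positivity)
    exact (hU.continuous (Frequently.of_forall fun n => continuous_of_mem (φ n).2)).continuousOn
  · refine squeeze_zero_norm hb0 ?_
    simpa using tendsto_sqrt_tip.const_mul (28 * (‖u‖ + ‖f‖))

/-! ### Comparison with explicit functions near the tip -/

theorem exists_test_eq {G : Coord → ℂ} (hG : SmoothPunctured G) {ε R : ℝ} (hε : 0 < ε)
    (h1 : ∀ p : Coord, 0 < p.1 → p.1 < ε → G p = 0) (h2 : ∀ p : Coord, R < p.1 → G p = 0) :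
    ∃ ψ ∈ testFunctions, ∀ p : Coord, 0 < p.1 → G p = ψ p := by
  -- The bump in `log r` has to be `1` between `log ε` and the logarithm of `max R 1`. The inner
  -- maximum makes the argument of the logarithm positive, the outer one makes the radius positive.
  obtain ⟨χ, c1, c2, c3, -⟩ := exists_contDiff_one_on_ball
    (max (max |Real.log ε| |Real.log (max R 1)|) 1) (by positivity)
  refine ⟨_, mul_mem (logMode_mem c1 c2 0) hG, fun p hp => ?_⟩
  by_cases hp1 : p.1 < ε
  · rw [h1 p hp hp1, zero_mul]
  by_cases hp2 : R < p.1
  · rw [h2 p hp2, zero_mul]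
  rw [logMode_of_pos χ 0 hp, halfExp_zero, c3, Complex.ofReal_one, mul_one, mul_one]
  refine le_trans (abs_le_max_abs_abs (Real.log_le_log hε (not_lt.1 hp1))
    (Real.log_le_log hp ((not_lt.1 hp2).trans (le_max_left R 1)))) (le_max_left _ _)

/-- The distribution `u` coincides with the function `G` on the part `r ≤ ε` of the cone. -/
def EqNearTip (ε : ℝ) (u : ConeL2) (G : Coord → ℂ) : Prop :=
  ∀ φ ∈ testFunctions, (∀ p : Coord, ε < p.1 → φ p = 0) →
    ∫ p, u p * φ p ∂coneMeasure = ∫ p, G p * φ p ∂coneMeasure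

theorem dx_eq_zero_of_eventuallyEq {φ : Coord → ℂ} {ε : ℝ} (h : ∀ p : Coord, ε < p.1 → φ p = 0)
    {p : Coord} (hp : ε < p.1) : dx φ p = 0 := by
  have h1 : dr φ p = 0 := by
    have : (fun s : ℝ => φ (s, p.2)) =ᶠ[𝓝 p.1] fun _ => 0 := by
      filter_upwards [isOpen_Ioi.mem_nhds hp] with s hs using h (s, p.2) hs
    rw [dr, this.deriv_eq, deriv_const]
  have h2 : dtheta φ p = 0 := by
    have : (fun s : ℝ => φ (p.1, p.2 + (s : Angle))) = fun _ => 0 := funext fun s => h _ hp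
    rw [dtheta, this, deriv_const]
  rw [dx, h1, h2]
  ring

/-- Weak derivatives are local: the derivative of a test function supported in `r ≤ ε` vanishes for
`r > ε` as well, so both sides are integrated by parts with the same test function. -/
theorem EqNearTip.dx {ε : ℝ} {u v : ConeL2} {G : Coord → ℂ} (h : EqNearTip ε u G)
    (hG : SmoothPunctured G) (hv : IsWeakDx u v) : EqNearTip ε v (dx G) := by
  intro φ hφ h0
  rw [hv φ hφ, h _ (dx_mem hφ) fun p hp => dx_eq_zero_of_eventuallyEq h0 hp,
    integral_mul_dx hG hφ, neg_neg]

theorem EqNearTip.congr {ε : ℝ} {u : ConeL2} {F G : Coord → ℂ} (h : EqNearTip ε u F)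
    (hFG : ∀ p : Coord, 0 < p.1 → F p = G p) : EqNearTip ε u G := by
  intro φ hφ h0
  rw [h φ hφ h0]
  exact integral_congr_pos fun p hp => by rw [hFG p hp]

/-- The angular Fourier coefficients of an element of `L²(C)` are square integrable near the tip. -/
theorem EqNearTip.coeff_eq_zero {ε : ℝ} (hε : 0 < ε) {v : ConeL2} {G : Coord → ℂ}
    (h : EqNearTip ε v G) (hG : SmoothPunctured G) (k : ℤ) {a : ℂ} {α : ℝ} (hα : 1 ≤ α)
    (ha : ∀ r : ℝ, 0 < r → ∫ θ : Angle, G (r, θ) * halfExp k θ = a * ((r ^ (-α) : ℝ) : ℂ)) :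
    a = 0 := by
  have hc : Continuous fun t : ℝ => a * ((Real.exp t ^ (-α) : ℝ) : ℂ) := by
    refine continuous_const.mul (Complex.continuous_ofReal.comp ?_)
    exact Real.continuous_exp.rpow_const fun t => Or.inl (Real.exp_pos t).ne'
  -- Testing with separated functions supported in `r < ε` shows that the `k`-th coefficient of `v`
  -- is exactly `a e^{-αt}` for `t < log ε`.
  have key : ∀ᵐ t : ℝ, t ∈ Iio (Real.log ε) →
      angularCoeff v k t - a * ((Real.exp t ^ (-α) : ℝ) : ℂ) = 0 := by
    refine IsOpen.ae_eq_zero_of_integral_contDiff_smul_eq_zero isOpen_Iio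
      (((locallyIntegrable_angularCoeff v k).sub hc.locallyIntegrable).locallyIntegrableOn _)
      fun χ h1 h2 h3 => ?_
    have h4 : ContDiff ℝ ∞ fun t => Real.exp (-(2 * t)) * χ t := by fun_prop
    have h5 := (integral_mul_logMode h4 h2.mul_left k v)
    have hm := logMode_mem h4 h2.mul_left k
    have e : ∀ t, Real.exp (2 * t) * (Real.exp (-(2 * t)) * χ t) = χ t := fun t => by
      rw [← mul_assoc, ← Real.exp_add, add_neg_cancel, Real.exp_zero, one_mul]
    simp only [e] at h5
    have h6 : ∫ p, v p * logMode (fun t => Real.exp (-(2 * t)) * χ t) k p ∂coneMeasure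
        = ∫ p, G p * logMode (fun t => Real.exp (-(2 * t)) * χ t) k p ∂coneMeasure := by
      refine h _ hm fun p hp => ?_
      rw [logMode_of_pos _ _ (hε.trans hp),
        image_eq_zero_of_notMem_tsupport (f := χ), mul_zero, Complex.ofReal_zero, zero_mul]
      exact fun hn => absurd (h3 hn) (not_lt.2 (Real.log_le_log hε hp.le))
    rw [integral_cone (integrable_of_mem (mul_mem hm hG)), integral_radialMeasure_eq_exp] at h6
    have h7 : ∀ t : ℝ, Real.exp (2 * t) • ∫ θ : Angle, G (Real.exp t, θ)
        * logMode (fun t => Real.exp (-(2 * t)) * χ t) k (Real.exp t, θ)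
        = χ t • (a * ((Real.exp t ^ (-α) : ℝ) : ℂ)) := by
      intro t
      rw [← ha _ (Real.exp_pos t), ← integral_smul, ← integral_smul]
      congr 1
      ext θ
      rw [logMode_of_pos _ _ (p := (Real.exp t, θ)) (Real.exp_pos t), Real.log_exp]
      have e' : ((Real.exp (2 * t) : ℝ) : ℂ) * ((Real.exp (-(2 * t)) : ℝ) : ℂ) = 1 := by
        rw [← Complex.ofReal_mul, ← Real.exp_add, add_neg_cancel, Real.exp_zero, Complex.ofReal_one]
      simp only [Complex.real_smul, Complex.ofReal_mul]
      linear_combination (G (Real.exp t, θ) * χ t * halfExp k θ) * e'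
    simp only [h7] at h6
    have h8 : Integrable fun t => χ t • (a * ((Real.exp t ^ (-α) : ℝ) : ℂ)) :=
      (h1.continuous.smul hc).integrable_of_hasCompactSupport h2.smul_right
    simp only [smul_sub]
    rw [integral_sub h5.1 h8, ← h5.2, h6, sub_self]
  by_contra h0
  have hI := integrable_exp_mul_norm_sq_angularCoeff v k
  -- For `t < 0` and `α ≥ 1` the weighted square `|a|² e^{2t - 2αt}` is at least `|a|²`, and a
  -- nonzero constant is not integrable on a half line.
  have hI2 : IntegrableOn (fun _ : ℝ => ‖a‖ ^ 2) (Iio (min (Real.log ε) 0)) := by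
    refine Integrable.mono' hI.integrableOn aestronglyMeasurable_const ?_
    rw [ae_restrict_iff' measurableSet_Iio]
    filter_upwards [key] with t ht ht2
    have ht3 := lt_min_iff.1 (mem_Iio.1 ht2)
    rw [sub_eq_zero.1 (ht ht3.1), norm_mul, Complex.norm_real, Real.norm_of_nonneg (by positivity),
      Real.norm_of_nonneg (by positivity), mul_pow, ← Real.exp_mul, ← Real.exp_nsmul, mul_left_comm,
      ← Real.exp_add]
    refine le_mul_of_one_le_right (by positivity) (Real.one_le_exp ?_)
    rw [nsmul_eq_mul]
    push_cast
    nlinarith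
  rw [integrableOn_const_iff] at hI2
  rcases hI2 with h1 | h1
  · exact h0 (by simpa using h1)
  · simp at h1

theorem integral_sum_halfExp {ι : Type*} (s : Finset ι) (C : ι → ℂ) (n : ι → ℤ) (k : ℤ) :
    ∫ θ : Angle, (∑ i ∈ s, C i * halfExp (n i) θ) * halfExp k θ
      = ∑ i ∈ s, if n i + k = 0 then C i * ((4 * Real.pi : ℝ) : ℂ) else 0 := by
  simp only [Finset.sum_mul, mul_assoc, halfExp_mul]
  rw [integral_finsetSum]
  · refine Finset.sum_congr rfl fun i _ => ?_
    rw [integral_const_mul, integral_halfExp]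
    split_ifs <;> simp
  · exact fun i _ => integrable_angle (continuous_const.mul (continuous_halfExp _))

/-! ### The model functions -/

theorem SmoothPunctured.continuousOn {g : Coord → ℂ} (hg : SmoothPunctured g) :
    ContinuousOn g punctured := by
  rintro ⟨r, θ⟩ hp
  obtain ⟨t, rfl⟩ := exists_angle_coe θ
  have hq : IsOpenQuotientMap (fun x : ℝ × ℝ => ((x.1, (x.2 : Angle)) : Coord)) :=
    IsOpenQuotientMap.id.prodMap QuotientAddGroup.isOpenQuotientMap_mk
  exact (hq.continuousAt_comp_iff (x := (r, t)).1 (hg (r, t) hp).continuousAt).continuousWithinAt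

theorem aestronglyMeasurable_of_continuousOn {g : Coord → ℂ} (hg : ContinuousOn g punctured) :
    AEStronglyMeasurable g coneMeasure := by
  have h := hg.aestronglyMeasurable (μ := coneMeasure) isOpen_punctured.measurableSet
  rwa [Measure.restrict_eq_self_of_ae_mem (s := punctured) ae_pos] at h

theorem dr_congr_of_isOpen {f g : Coord → ℂ} {I : Set ℝ} (hI : IsOpen I)
    (h : ∀ p : Coord, p.1 ∈ I → f p = g p) (p : Coord) (hp : p.1 ∈ I) : dr f p = dr g p := by
  refine EventuallyEq.deriv_eq ?_
  filter_upwards [hI.mem_nhds hp] with s hs using h (s, p.2) hs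

theorem dtheta_congr_of_fst {f g : Coord → ℂ} {I : Set ℝ}
    (h : ∀ p : Coord, p.1 ∈ I → f p = g p) (p : Coord) (hp : p.1 ∈ I) :
    dtheta f p = dtheta g p :=
  EventuallyEq.deriv_eq (Eventually.of_forall fun s => h (p.1, p.2 + (s : Angle)) hp)

theorem laplace_congr_of_isOpen {f g : Coord → ℂ} {I : Set ℝ} (hI : IsOpen I)
    (h : ∀ p : Coord, p.1 ∈ I → f p = g p) (p : Coord) (hp : p.1 ∈ I) :
    laplace f p = laplace g p := by
  have h1 := dr_congr_of_isOpen hI h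
  rw [laplace, laplace, h1 p hp, dr_congr_of_isOpen hI h1 p hp,
    dtheta_congr_of_fst (dtheta_congr_of_fst h) p hp]

theorem SmoothPunctured.laplace {g : Coord → ℂ} (hg : SmoothPunctured g) :
    SmoothPunctured (laplace g) := by
  have h : SmoothPunctured fun p => (-1 : ℂ) * (FlatCone.dr (FlatCone.dr g) p
      + (p.1 : ℂ)⁻¹ * FlatCone.dr g p
      + ((p.1 : ℂ) ^ 2)⁻¹ * FlatCone.dtheta (FlatCone.dtheta g) p) :=
    (smoothPunctured_const (-1)).mul (((hg.dr.dr).add (smoothPunctured_inv.mul hg.dr)).add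
      (smoothPunctured_sq_inv.mul hg.dtheta.dtheta))
  have e : FlatCone.laplace g = fun p => (-1 : ℂ) * (FlatCone.dr (FlatCone.dr g) p
      + (p.1 : ℂ)⁻¹ * FlatCone.dr g p
      + ((p.1 : ℂ) ^ 2)⁻¹ * FlatCone.dtheta (FlatCone.dtheta g) p) := by
    funext p
    rw [FlatCone.laplace, neg_one_mul]
  rw [e]
  exact h

theorem smoothPunctured_sum {ι : Type*} {s : Finset ι} {G : ι → Coord → ℂ} (c : ι → ℂ)
    (hG : ∀ i, SmoothPunctured (G i)) : SmoothPunctured fun p => ∑ i ∈ s, c i * G i p :=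
  fun x hx => ContDiffAt.sum fun i _ => contDiffAt_const.mul (hG i x hx)

theorem dx_sum {ι : Type*} {s : Finset ι} {G : ι → Coord → ℂ} (c : ι → ℂ)
    (hG : ∀ i, SmoothPunctured (G i)) {p : Coord} (hp : 0 < p.1) :
    dx (fun p => ∑ i ∈ s, c i * G i p) p = ∑ i ∈ s, c i * dx (G i) p := by
  obtain ⟨r, θ⟩ := p
  obtain ⟨t, rfl⟩ := exists_angle_coe θ
  have h1 := dr_eq_of_hasDerivAt (g := fun p => ∑ i ∈ s, c i * G i p)
    (HasDerivAt.fun_sum fun i (_ : i ∈ s) => ((hG i).hasDerivAt_dr hp (t : Angle)).const_mul (c i))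
  have h2 := dtheta_eq_of_hasDerivAt (g := fun p => ∑ i ∈ s, c i * G i p)
    (HasDerivAt.fun_sum fun i (_ : i ∈ s) => ((hG i).hasDerivAt_dtheta hp t).const_mul (c i))
  simp only [dx]
  rw [h1, h2, Finset.mul_sum, Finset.mul_sum, ← Finset.sum_sub_distrib]
  exact Finset.sum_congr rfl fun i _ => by ring

/-- The function `r^s e^{i n θ / 2}`. -/
noncomputable def powMode (s : ℝ) (n : ℤ) : Coord → ℂ := radialMode (fun r => ((r ^ s : ℝ) : ℂ)) n

/-- The function `log r`. -/
noncomputable def logTip : Coord → ℂ := radialMode (fun r => (Real.log r : ℂ)) 0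

theorem contDiffOn_rpow (s : ℝ) : ContDiffOn ℝ ∞ (fun r : ℝ => r ^ s) (Ioi 0) := fun _ hr =>
  (contDiffAt_id.rpow_const_of_ne (ne_of_gt hr)).contDiffWithinAt

theorem smoothPunctured_powMode (s : ℝ) (n : ℤ) : SmoothPunctured (powMode s n) :=
  smoothPunctured_radialMode (Complex.ofRealCLM.contDiff.comp_contDiffOn (contDiffOn_rpow s)) n

theorem smoothPunctured_logTip : SmoothPunctured logTip :=
  smoothPunctured_radialMode (Complex.ofRealCLM.contDiff.comp_contDiffOn
    (Real.contDiffOn_log.mono fun _ hr => ne_of_gt hr)) 0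

theorem hasDerivAt_rpow_ofReal (s : ℝ) {r : ℝ} (hr : 0 < r) :
    HasDerivAt (fun r : ℝ => ((r ^ s : ℝ) : ℂ)) ((s * r ^ (s - 1) : ℝ) : ℂ) r :=
  (Real.hasDerivAt_rpow_const (Or.inl hr.ne')).ofReal_comp

theorem hasDerivAt_log_ofReal {r : ℝ} (hr : 0 < r) :
    HasDerivAt (fun r : ℝ => (Real.log r : ℂ)) ((r ^ (-1 : ℝ) : ℝ) : ℂ) r := by
  rw [Real.rpow_neg_one]
  exact (Real.hasDerivAt_log hr.ne').ofReal_comp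

theorem inv_mul_rpow (s : ℝ) {r : ℝ} (hr : 0 < r) :
    (r : ℂ)⁻¹ * ((r ^ s : ℝ) : ℂ) = ((r ^ (s - 1) : ℝ) : ℂ) := by
  rw [Real.rpow_sub_one hr.ne']
  push_cast
  ring

theorem dx_powMode (s : ℝ) (n : ℤ) {p : Coord} (hp : 0 < p.1) :
    dx (powMode s n) p = ((s : ℂ) - n / 2) / 2 * powMode (s - 1) (n + 2) p
      + ((s : ℂ) + n / 2) / 2 * powMode (s - 1) (n - 2) p := by
  rw [powMode, dx_radialMode n (hasDerivAt_rpow_ofReal s hp), powMode, powMode, radialMode,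
    radialMode, mul_assoc _ (p.1 : ℂ)⁻¹, inv_mul_rpow s hp]
  push_cast
  ring

theorem dx_logTip {p : Coord} (hp : 0 < p.1) :
    dx logTip p = 1 / 2 * powMode (-1) 2 p + 1 / 2 * powMode (-1) (-2) p := by
  rw [logTip, dx_radialMode 0 (hasDerivAt_log_ofReal hp), powMode, powMode, radialMode, radialMode]
  push_cast
  simp only [zero_div, zero_mul, sub_zero, add_zero]
  ring

theorem laplace_powMode {s : ℝ} {n : ℤ} (h : (s : ℂ) ^ 2 = (n / 2) ^ 2) {p : Coord}
    (hp : 0 < p.1) : laplace (powMode s n) p = 0 := by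
  have h2 : HasDerivAt (fun r : ℝ => ((s * r ^ (s - 1) : ℝ) : ℂ))
      ((s * ((s - 1) * p.1 ^ (s - 1 - 1)) : ℝ) : ℂ) p.1 :=
    ((Real.hasDerivAt_rpow_const (p := s - 1) (Or.inl hp.ne')).const_mul s).ofReal_comp
  rw [powMode, laplace_radialMode n hp (fun r hr => hasDerivAt_rpow_ofReal s hr) h2, ← h]
  have e1 := inv_mul_rpow s hp
  have e2 := inv_mul_rpow (s - 1) hp
  push_cast
  rw [← e1] at e2
  rw [← e1, ← e2]
  ring

theorem laplace_logTip {p : Coord} (hp : 0 < p.1) : laplace logTip p = 0 := by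
  have h2 : HasDerivAt (fun r : ℝ => ((r ^ (-1 : ℝ) : ℝ) : ℂ))
      (((-1 : ℝ) * p.1 ^ ((-1 : ℝ) - 1) : ℝ) : ℂ) p.1 := hasDerivAt_rpow_ofReal (-1) hp
  rw [logTip, laplace_radialMode 0 hp (fun r hr => hasDerivAt_log_ofReal hr) h2,
    inv_mul_rpow (-1) hp]
  push_cast
  ring

/-- The radial factors of the six model functions. -/
noncomputable def modelRadial : Fin 6 → ℝ → ℝ :=
  ![fun _ => 1, Real.log, fun r => r ^ (1 / 2 : ℝ), fun r => r ^ (1 / 2 : ℝ),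
    fun r => r ^ (-1 / 2 : ℝ), fun r => r ^ (-1 / 2 : ℝ)]

/-- The angular frequencies of the six model functions. -/
def modelIndex : Fin 6 → ℤ := ![0, 0, 1, -1, 1, -1]

/-- The model functions without the cutoff. -/
noncomputable def modelTip (i : Fin 6) : Coord → ℂ :=
  radialMode (fun r => (modelRadial i r : ℂ)) (modelIndex i)

/-- The model functions. -/
noncomputable def modelFn (ρ : ℝ → ℝ) (i : Fin 6) : Coord → ℂ :=
  radialMode (fun r => ((ρ r * modelRadial i r : ℝ) : ℂ)) (modelIndex i)

theorem modelFunctions_eq (ρ : ℝ → ℝ) : modelFunctions ρ = range (modelFn ρ) := by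
  have h0 : modelFn ρ 0 = fun p => (ρ p.1 : ℂ) := by
    funext p; simp [modelFn, radialMode, modelRadial, modelIndex, halfExp_zero]
  have h1 : modelFn ρ 1 = fun p => ((ρ p.1 * Real.log p.1 : ℝ) : ℂ) := by
    funext p; simp [modelFn, radialMode, modelRadial, modelIndex, halfExp_zero]
  ext f
  simp only [modelFunctions, mem_insert_iff, mem_singleton_iff, mem_range, Fin.exists_fin_succ,
    ← h0, ← h1]
  simp only [eq_comm (a := f)]
  simp [modelFn, modelRadial, modelIndex]
  rfl

theorem modelTip_eq : modelTip = ![powMode 0 0, logTip, powMode (1 / 2) 1, powMode (1 / 2) (-1),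
    powMode (-1 / 2) 1, powMode (-1 / 2) (-1)] := by
  funext i
  fin_cases i
  · simp [modelTip, powMode, modelRadial, modelIndex]
  all_goals rfl

theorem smoothPunctured_modelTip (i : Fin 6) : SmoothPunctured (modelTip i) := by
  rw [modelTip_eq]
  fin_cases i
  · exact smoothPunctured_powMode _ _
  · exact smoothPunctured_logTip
  all_goals exact smoothPunctured_powMode _ _

theorem laplace_modelTip (i : Fin 6) {p : Coord} (hp : 0 < p.1) : laplace (modelTip i) p = 0 := by
  rw [modelTip_eq]
  fin_cases i
  · exact laplace_powMode (by norm_num) hp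
  · exact laplace_logTip hp
  all_goals exact laplace_powMode (by push_cast; norm_num) hp

theorem contDiffOn_modelRadial (i : Fin 6) : ContDiffOn ℝ ∞ (modelRadial i) (Ioi 0) := by
  fin_cases i
  · exact contDiffOn_const
  · exact Real.contDiffOn_log.mono fun _ hr => ne_of_gt hr
  all_goals exact contDiffOn_rpow _

/-- All six radial factors are `O(r^{-1/2})` at the tip, which is square integrable for `r dr`. The
constant `2` is needed for the logarithm only, from `|log r · r^{1/2}| < 1 / (1/2)`. -/
theorem abs_modelRadial_mul_sqrt_le (i : Fin 6) {r : ℝ} (h0 : 0 < r) (h1 : r ≤ 1) :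
    |modelRadial i r * √r| ≤ 2 := by
  have hs : √r ≤ 1 := Real.sqrt_le_one.2 h1
  have hp : 0 ≤ √r := Real.sqrt_nonneg r
  have a1 : |1 * √r| ≤ 2 := by rw [one_mul, abs_of_nonneg hp]; linarith
  have a2 : |Real.log r * √r| ≤ 2 := by
    have := Real.abs_log_mul_self_rpow_lt r (1 / 2) h0 h1 (by norm_num)
    rw [← Real.sqrt_eq_rpow] at this
    linarith
  have a3 : |r ^ (1 / 2 : ℝ) * √r| ≤ 2 := by
    rw [← Real.sqrt_eq_rpow, Real.mul_self_sqrt h0.le, abs_of_pos h0]; linarith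
  have a4 : |r ^ (-1 / 2 : ℝ) * √r| ≤ 2 := by
    rw [Real.sqrt_eq_rpow, ← Real.rpow_add h0]; norm_num
  fin_cases i <;> assumption

/-! ### Cutoff model functions: square integrability, weak Laplacians, and their span. -/

section Cutoff

variable {ρ : ℝ → ℝ} (hρ : IsRadialCutoff ρ)
include hρ

theorem contDiffOn_cutoff_mul (i : Fin 6) :
    ContDiffOn ℝ ∞ (fun r => ρ r * modelRadial i r) (Ioi 0) :=
  hρ.smooth.mul (contDiffOn_modelRadial i)

theorem smoothPunctured_modelFn (i : Fin 6) : SmoothPunctured (modelFn ρ i) :=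
  smoothPunctured_radialMode
    (Complex.ofRealCLM.contDiff.comp_contDiffOn (contDiffOn_cutoff_mul hρ i)) _

theorem exists_abs_cutoff_mul_le (i : Fin 6) : ∃ C R : ℝ, 0 < R ∧
    (∀ r, 0 < r → |ρ r * modelRadial i r| ≤ C * (√r)⁻¹) ∧ ∀ r, R < r → ρ r = 0 := by
  obtain ⟨ε, hε, h1⟩ := hρ.eq_one
  obtain ⟨R, hR⟩ := hρ.eq_zero
  have hc : ContinuousOn (fun r => ρ r * modelRadial i r * √r) (Icc (min ε 1) (max R 1)) := by
    refine ((contDiffOn_cutoff_mul hρ i).continuousOn.mono fun r hr => ?_).mul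
      Real.continuous_sqrt.continuousOn
    exact lt_of_lt_of_le (lt_min hε one_pos) hr.1
  obtain ⟨C, hC⟩ := isCompact_Icc.exists_bound_of_continuousOn hc
  have hR' : ∀ r, max R 1 < r → ρ r = 0 := fun r hr => hR r ((le_max_left _ _).trans hr.le)
  -- The constant `2` serves for `r ≤ min ε 1`, where `ρ = 1`, and `C` serves on the compact
  -- interval up to `max R 1`, beyond which `ρ` vanishes.
  refine ⟨max C 2, max R 1, by positivity, fun r hr => ?_, hR'⟩
  have hs : 0 < √r := Real.sqrt_pos.2 hr
  rw [← div_eq_mul_inv, le_div_iff₀ hs, ← abs_of_pos hs, ← abs_mul]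
  rcases le_or_gt r (min ε 1) with h | h
  · rw [h1 r hr (h.trans (min_le_left _ _)), one_mul]
    exact (abs_modelRadial_mul_sqrt_le i hr (h.trans (min_le_right _ _))).trans (le_max_right _ _)
  · rcases le_or_gt r (max R 1) with h3 | h3
    · exact (hC r ⟨h.le, h3⟩).trans (le_max_left _ _)
    · rw [hR' r h3, zero_mul, zero_mul, abs_zero]
      positivity

/-- The square is dominated by `C² r^{-1}` on `r ≤ R`. In the coordinate `t = log r` this becomes
`C² e^t` on a half line bounded above. -/
theorem memLp_modelFn (i : Fin 6) : MemLp (modelFn ρ i) 2 coneMeasure := by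
  obtain ⟨C, R, hR, h1, h2⟩ := exists_abs_cutoff_mul_le hρ i
  have hm := aestronglyMeasurable_of_continuousOn (smoothPunctured_modelFn hρ i).continuousOn
  rw [memLp_two_iff_integrable_sq_norm hm]
  have hI : Integrable (fun r : ℝ => if r ≤ R then C ^ 2 * r⁻¹ else 0) radialMeasure := by
    rw [integrable_radialMeasure_iff]
    have h3 : Integrable ((Iic (Real.log R)).indicator fun t => C ^ 2 * Real.exp t) :=
      (integrable_indicator_iff measurableSet_Iic).2
        ((integrableOn_exp_Iic (Real.log R)).const_mul (C ^ 2))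
    refine h3.congr (Eventually.of_forall fun t => ?_)
    by_cases ht : t ≤ Real.log R
    · have ht2 : Real.exp t ≤ R := (Real.le_log_iff_exp_le hR).1 ht
      simp only [indicator_of_mem (mem_Iic.2 ht), if_pos ht2, smul_eq_mul, two_mul, Real.exp_add]
      field_simp
    · have ht2 : ¬Real.exp t ≤ R := fun h => ht ((Real.le_log_iff_exp_le hR).2 h)
      simp only [indicator_of_notMem (fun h => ht (mem_Iic.1 h)), if_neg ht2, smul_zero]
  have hI2 : Integrable (fun p : Coord => if p.1 ≤ R then C ^ 2 * p.1⁻¹ else 0) coneMeasure :=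
    hI.comp_fst (ν := (volume : Measure Angle))
  refine hI2.mono' (hm.norm.pow 2) ?_
  filter_upwards [ae_pos] with p hp
  rw [norm_pow, norm_norm, modelFn, radialMode, norm_mul, norm_halfExp, mul_one, Complex.norm_real]
  split_ifs with h
  · calc |ρ p.1 * modelRadial i p.1| ^ 2 ≤ (C * (√p.1)⁻¹) ^ 2 :=
          pow_le_pow_left₀ (abs_nonneg _) (h1 _ hp) 2
      _ = _ := by rw [mul_pow, inv_pow, Real.sq_sqrt hp.le]
  · rw [h2 _ (not_le.1 h)]
    simp

/-- The model function is harmonic where `ρ = 1` and zero for large `r`, so its Laplacian is on `C°`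
a test function. Integration by parts against test functions sees no contribution of the tip. -/
theorem exists_isWeakLaplace_modelFn (i : Fin 6) :
    ∃ f, IsWeakLaplace ((memLp_modelFn hρ i).toLp _) f := by
  obtain ⟨ε, hε, h1⟩ := hρ.eq_one
  obtain ⟨R, hR⟩ := hρ.eq_zero
  have hG := smoothPunctured_modelFn hρ i
  obtain ⟨ψ, hψ, he⟩ := exists_test_eq hG.laplace (R := R) hε (fun p hp hp2 => by
      rw [← laplace_modelTip i hp]
      refine laplace_congr_of_isOpen (isOpen_Ioo (a := 0) (b := ε)) (fun q hq => ?_) p ⟨hp, hp2⟩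
      rw [modelFn, modelTip, radialMode, radialMode, h1 q.1 hq.1 hq.2.le, one_mul])
    (fun p hp => by
      rw [laplace_congr_of_isOpen (g := 0) (isOpen_Ioi (a := R)) (fun q hq => ?_) p hp]
      · simp [laplace, dr, dtheta]
      · rw [modelFn, radialMode, hR q.1 (le_of_lt hq), zero_mul, Complex.ofReal_zero, zero_mul]
        rfl)
  refine ⟨testToL2 ⟨ψ, hψ⟩, isWeakLaplace_of_integral fun φ hφ => ?_⟩
  have e1 : ∫ p, (testToL2 ⟨ψ, hψ⟩ : ConeL2) p * φ p ∂coneMeasure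
      = ∫ p, laplace (modelFn ρ i) p * φ p ∂coneMeasure := by
    refine integral_congr_ae ?_
    filter_upwards [(memLp_of_mem hψ).coeFn_toLp, ae_pos] with p hp hp2
    rw [he p hp2, ← hp]
    rfl
  rw [e1, ← integral_mul_laplace hG hφ]
  refine integral_congr_ae ?_
  filter_upwards [(memLp_modelFn hρ i).coeFn_toLp] with p hp
  rw [hp]

theorem mem_modelSpan_iff {u : ConeL2} :
    u ∈ modelSpan ρ ↔ ∃ c : Fin 6 → ℂ, ∑ i, c i • (memLp_modelFn hρ i).toLp _ = u := by
  have h : {w : ConeL2 | ∃ f ∈ modelFunctions ρ, w =ᵐ[coneMeasure] f}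
      = range fun i => (memLp_modelFn hρ i).toLp _ := by
    ext w
    rw [modelFunctions_eq]
    constructor
    · rintro ⟨_, ⟨i, rfl⟩, hw⟩
      exact ⟨i, Lp.ext ((memLp_modelFn hρ i).coeFn_toLp.trans hw.symm)⟩
    · rintro ⟨i, rfl⟩
      exact ⟨_, ⟨i, rfl⟩, (memLp_modelFn hρ i).coeFn_toLp⟩
  rw [modelSpan, h, Submodule.mem_span_range_iff_exists_fun]

theorem coeFn_sum_modelFn (c : Fin 6 → ℂ) :
    (∑ i, c i • (memLp_modelFn hρ i).toLp _ : ConeL2) =ᵐ[coneMeasure]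
      fun p => ∑ i, c i * modelFn ρ i p := by
  have h1 : ∀ᵐ p ∂coneMeasure, ∀ i, (c i • (memLp_modelFn hρ i).toLp _ : ConeL2) p
      = c i * modelFn ρ i p := by
    refine ae_all_iff.2 fun i => ?_
    filter_upwards [Lp.coeFn_smul (c i) ((memLp_modelFn hρ i).toLp _),
      (memLp_modelFn hρ i).coeFn_toLp] with p hp1 hp2
    rw [hp1, Pi.smul_apply, hp2, smul_eq_mul]
  have h2 := Lp.coeFn_finsetSum (p := 2) (μ := coneMeasure) Finset.univ
    (fun i => c i • (memLp_modelFn hρ i).toLp (modelFn ρ i))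
  filter_upwards [h1, h2] with p hp1 hp2
  rw [hp2, Finset.sum_apply]
  exact Finset.sum_congr rfl fun i _ => hp1 i

theorem exists_eqNearTip_modelSum (c : Fin 6 → ℂ) : ∃ ε > 0,
    EqNearTip ε (∑ i, c i • (memLp_modelFn hρ i).toLp _) fun p => ∑ i, c i * modelTip i p := by
  obtain ⟨ε, hε, h1⟩ := hρ.eq_one
  refine ⟨ε, hε, fun φ hφ h0 => integral_congr_ae ?_⟩
  filter_upwards [coeFn_sum_modelFn hρ c, ae_pos] with p hp hp2
  rcases le_or_gt p.1 ε with h | h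
  · rw [hp]
    congr 1
    refine Finset.sum_congr rfl fun i _ => ?_
    rw [modelFn, modelTip, radialMode, radialMode, h1 _ hp2 h, one_mul]
  · rw [h0 p h, mul_zero, mul_zero]

end Cutoff

/-! ### Excluding singular terms by square integrability of derivatives. -/

section Coefficients

variable {ρ : ℝ → ℝ} (hρ : IsRadialCutoff ρ) {c : Fin 6 → ℂ} {v : ConeL2}
  (hv : IsWeakDx (∑ i, c i • (memLp_modelFn hρ i).toLp _) v)
include hv

/-- If a combination of the model functions has its first derivatives in `L²`, then the functions
`log r` and `r^{-1/2} e^{± i θ / 2}` do not occur in it. -/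
theorem singular_coeff_eq_zero : c 1 = 0 ∧ c 4 = 0 ∧ c 5 = 0 := by
  obtain ⟨ε, hε, h⟩ := exists_eqNearTip_modelSum hρ c
  have hG := smoothPunctured_sum (s := Finset.univ) c smoothPunctured_modelTip
  have h2 := h.dx hG hv
  -- These are the terms of the `∂_x` derivative: the constant drops out, `log r` gives frequencies
  -- `±2`, and each half-integer power gives a single term because it is holomorphic or
  -- antiholomorphic. The six frequencies in `n` are distinct, so pairing with `e^{ikθ/2}` for `k =
  -- -n j` isolates one term.
  let C : ℝ → Fin 6 → ℂ := fun r => ![c 1 / 2 * ((r ^ (-1 : ℝ) : ℝ) : ℂ),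
    c 1 / 2 * ((r ^ (-1 : ℝ) : ℝ) : ℂ), c 2 / 2 * ((r ^ (-(1 / 2) : ℝ) : ℝ) : ℂ),
    c 3 / 2 * ((r ^ (-(1 / 2) : ℝ) : ℝ) : ℂ), -(c 4 / 2) * ((r ^ (-(3 / 2) : ℝ) : ℝ) : ℂ),
    -(c 5 / 2) * ((r ^ (-(3 / 2) : ℝ) : ℝ) : ℂ)]
  let n : Fin 6 → ℤ := ![2, -2, -1, 1, 3, -3]
  have hD : ∀ p : Coord, 0 < p.1 → dx (fun p => ∑ i, c i * modelTip i p) p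
      = ∑ j, C p.1 j * halfExp (n j) p.2 := by
    intro p hp
    rw [dx_sum c smoothPunctured_modelTip hp, modelTip_eq, Fin.sum_univ_six, Fin.sum_univ_six]
    have e1 : (1 / 2 - 1 : ℝ) = -(1 / 2) := by norm_num
    have e2 : (-1 / 2 - 1 : ℝ) = -(3 / 2) := by norm_num
    simp only [Matrix.cons_val, dx_powMode _ _ hp, dx_logTip hp, C, n, e1, e2]
    simp only [powMode, radialMode]
    push_cast
    norm_num
    ring
  have key : ∀ (r : ℝ), 0 < r → ∀ k : ℤ,
      ∫ θ : Angle, dx (fun p => ∑ i, c i * modelTip i p) (r, θ) * halfExp k θ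
        = ∑ j, if n j + k = 0 then C r j * ((4 * Real.pi : ℝ) : ℂ) else 0 := by
    intro r hr k
    rw [← integral_sum_halfExp]
    refine integral_congr_ae (Eventually.of_forall fun θ => ?_)
    simp only [hD (r, θ) hr]
  have hpi : ((4 * Real.pi : ℝ) : ℂ) ≠ 0 := by exact_mod_cast (by positivity : 4 * Real.pi ≠ 0)
  refine ⟨?_, ?_, ?_⟩
  -- The derivative of the logarithm is of size `r^{-1}`, the borderline case `α = 1` of
  -- non-integrability of the square.
  · have := h2.coeff_eq_zero hε hG.dx (-2) (a := c 1 / 2 * ((4 * Real.pi : ℝ) : ℂ)) (α := 1)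
      (by norm_num) fun r hr => by
        rw [key r hr, Fin.sum_univ_six]
        simp [C, n]
        ring
    simpa [hpi] using this
  · have := h2.coeff_eq_zero hε hG.dx (-3) (a := -(c 4 / 2) * ((4 * Real.pi : ℝ) : ℂ))
      (α := 3 / 2) (by norm_num) fun r hr => by
        rw [key r hr, Fin.sum_univ_six]
        simp [C, n]
        ring
    simpa [hpi] using this
  · have := h2.coeff_eq_zero hε hG.dx 3 (a := -(c 5 / 2) * ((4 * Real.pi : ℝ) : ℂ))
      (α := 3 / 2) (by norm_num) fun r hr => by
        rw [key r hr, Fin.sum_univ_six]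
        simp [C, n]
        ring
    simpa [hpi] using this

/-- If a combination of the model functions has its second derivatives in `L²`, then only the
constant function occurs in it. -/
theorem sqrt_coeff_eq_zero {w : ConeL2} (hw : IsWeakDx v w) : c 2 = 0 ∧ c 3 = 0 := by
  obtain ⟨h1, h4, h5⟩ := singular_coeff_eq_zero hρ hv
  obtain ⟨ε, hε, h⟩ := exists_eqNearTip_modelSum hρ c
  have hG := smoothPunctured_sum (s := Finset.univ) c smoothPunctured_modelTip
  let d : Fin 2 → ℂ := ![c 2 / 2, c 3 / 2]
  let P : Fin 2 → Coord → ℂ := ![powMode (-(1 / 2)) (-1), powMode (-(1 / 2)) 1]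
  have hP : ∀ j, SmoothPunctured (P j) := fun j => by
    fin_cases j <;> exact smoothPunctured_powMode _ _
  have hD : ∀ p : Coord, 0 < p.1 → dx (fun p => ∑ i, c i * modelTip i p) p
      = ∑ j, d j * P j p := by
    intro p hp
    rw [dx_sum c smoothPunctured_modelTip hp, modelTip_eq, Fin.sum_univ_six, Fin.sum_univ_two]
    have e1 : (1 / 2 - 1 : ℝ) = -(1 / 2) := by norm_num
    simp only [Matrix.cons_val, dx_powMode _ _ hp, dx_logTip hp, d, P, e1, h1, h4, h5]
    push_cast
    norm_num
    ring
  have h2 := (h.dx hG hv).congr hD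
  have hQ := smoothPunctured_sum (s := Finset.univ) d hP
  have h3 := h2.dx hQ hw
  -- A second `∂_x` turns `r^{-1/2} e^{∓iθ/2}` into `-1/2 · r^{-3/2} e^{∓3iθ/2}`, which is no longer
  -- square integrable at the tip.
  let C : ℝ → Fin 2 → ℂ := fun r => ![-(c 2 / 4) * ((r ^ (-(3 / 2) : ℝ) : ℝ) : ℂ),
    -(c 3 / 4) * ((r ^ (-(3 / 2) : ℝ) : ℝ) : ℂ)]
  let n : Fin 2 → ℤ := ![-3, 3]
  have hD2 : ∀ p : Coord, 0 < p.1 → dx (fun p => ∑ j, d j * P j p) p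
      = ∑ j, C p.1 j * halfExp (n j) p.2 := by
    intro p hp
    rw [dx_sum d hP hp, Fin.sum_univ_two, Fin.sum_univ_two]
    have e1 : (-(1 / 2) - 1 : ℝ) = -(3 / 2) := by norm_num
    simp only [Matrix.cons_val, d, P, C, n, dx_powMode _ _ hp, e1]
    simp only [powMode, radialMode]
    push_cast
    norm_num
    ring
  have key : ∀ (r : ℝ), 0 < r → ∀ k : ℤ,
      ∫ θ : Angle, dx (fun p => ∑ j, d j * P j p) (r, θ) * halfExp k θ
        = ∑ j, if n j + k = 0 then C r j * ((4 * Real.pi : ℝ) : ℂ) else 0 := by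
    intro r hr k
    rw [← integral_sum_halfExp]
    refine integral_congr_ae (Eventually.of_forall fun θ => ?_)
    simp only [hD2 (r, θ) hr]
  have hpi : ((4 * Real.pi : ℝ) : ℂ) ≠ 0 := by exact_mod_cast (by positivity : 4 * Real.pi ≠ 0)
  refine ⟨?_, ?_⟩
  · have := h3.coeff_eq_zero hε hQ.dx 3 (a := -(c 2 / 4) * ((4 * Real.pi : ℝ) : ℂ))
      (α := 3 / 2) (by norm_num) fun r hr => by
        rw [key r hr, Fin.sum_univ_two]
        simp [C, n]
        ring
    simpa [hpi] using this
  · have := h3.coeff_eq_zero hε hQ.dx (-3) (a := -(c 3 / 4) * ((4 * Real.pi : ℝ) : ℂ))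
      (α := 3 / 2) (by norm_num) fun r hr => by
        rw [key r hr, Fin.sum_univ_two]
        simp [C, n]
        ring
    simpa [hpi] using this

end Coefficients

theorem eqOn_punctured_of_ae_eq {f g : Coord → ℂ} (h : f =ᵐ[coneMeasure] g)
    (hf : ContinuousOn f punctured) (hg : ContinuousOn g punctured) : EqOn f g punctured :=
  Measure.eqOn_open_of_ae_eq (restrict_absolutelyContinuous.ae_eq h) isOpen_punctured hf hg

instance : (comap (Prod.fst : Coord → ℝ) (𝓝[>] (0 : ℝ))).NeBot :=
  NeBot.comap_of_surj inferInstance Prod.fst_surjective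

/-- The model functions are independent modulo the functions in `H²(C)` that vanish at the tip. -/
theorem modelSum_coeff_eq_zero {ρ : ℝ → ℝ} (hρ : IsRadialCutoff ρ) {c : Fin 6 → ℂ}
    (h2 : MemSobolev 2 (∑ i, c i • (memLp_modelFn hρ i).toLp _ : ConeL2))
    (h0 : HasValueAtTip (∑ i, c i • (memLp_modelFn hρ i).toLp _ : ConeL2) 0) : c = 0 := by
  obtain ⟨v, -, hv, -, ⟨w, -, hw, -⟩, -⟩ := h2
  obtain ⟨c1, c4, c5⟩ := singular_coeff_eq_zero hρ hv
  obtain ⟨c2, c3⟩ := sqrt_coeff_eq_zero hρ hv hw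
  obtain ⟨g, hg1, hg2, hg3⟩ := h0
  obtain ⟨ε, hε, hone⟩ := hρ.eq_one
  have hm := (smoothPunctured_sum (s := Finset.univ) c (smoothPunctured_modelFn hρ)).continuousOn
  have he := eqOn_punctured_of_ae_eq ((coeFn_sum_modelFn hρ c).symm.trans hg1) hm hg2
  -- Once the other coefficients vanish, the combination is the constant `c 0` where `ρ = 1`, so its
  -- limit at the tip is `c 0`.
  have hc : Tendsto g (comap Prod.fst (𝓝[>] (0 : ℝ))) (𝓝 (c 0)) := by
    refine tendsto_const_nhds.congr' ?_
    have : ∀ᶠ r in 𝓝[>] (0 : ℝ), r ∈ Ioo 0 ε := Ioo_mem_nhdsGT hε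
    filter_upwards [tendsto_comap.eventually this] with p hp
    rw [← he hp.1]
    beta_reduce
    rw [Fin.sum_univ_six, c1, c2, c3, c4, c5]
    simp [modelFn, radialMode, modelRadial, modelIndex, halfExp_zero, hone p.1 hp.1 hp.2.le]
  have c0 := tendsto_nhds_unique hc hg3
  funext i
  fin_cases i <;> assumption

/-! ### Weak solutions of linear ordinary differential equations -/

theorem intervalIntegrable_of_locallyIntegrable {f : ℝ → ℝ} (hf : LocallyIntegrable f) (a b : ℝ) :
    IntervalIntegrable f volume a b :=
  intervalIntegrable_iff.2
    ((hf.integrableOn_isCompact isCompact_uIcc).mono_set uIoc_subset_uIcc)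

/-- Integration by parts for absolutely continuous functions; by Lebesgue differentiation the
primitive has derivative `f` almost everywhere. There are no boundary terms, as `χ` vanishes at
`±M`. -/
theorem integral_primitive_mul_deriv {f χ : ℝ → ℝ} (hf : LocallyIntegrable f)
    (h : ContDiff ℝ ∞ χ) (hs : HasCompactSupport χ) :
    ∫ t, (∫ s in (0 : ℝ)..t, f s) * deriv χ t = -∫ t, f t * χ t := by
  obtain ⟨M, hM⟩ := hs.isCompact.isBounded.subset_ball_lt 0 0
  obtain ⟨hM0, hM⟩ := hM
  rw [Real.ball_eq_Ioo, zero_sub, zero_add] at hM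
  have hle : -M ≤ M := by linarith
  have hM1 : tsupport χ ⊆ Ioc (-M) M := hM.trans Ioo_subset_Ioc_self
  have hM2 : tsupport (deriv χ) ⊆ Ioc (-M) M := (tsupport_deriv_subset).trans hM1
  have e1 : ∫ t, (∫ s in (0 : ℝ)..t, f s) * deriv χ t
      = ∫ t in (-M)..M, (∫ s in (0 : ℝ)..t, f s) * deriv χ t :=
    (intervalIntegral.integral_eq_integral_of_support_subset
      ((Function.support_mul_subset_right _ _).trans (subset_closure.trans hM2))).symm
  have e2 : ∫ t, f t * χ t = ∫ t in (-M)..M, f t * χ t :=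
    (intervalIntegral.integral_eq_integral_of_support_subset
      ((Function.support_mul_subset_right _ _).trans (subset_closure.trans hM1))).symm
  have hac : AbsolutelyContinuousOnInterval (fun t => ∫ s in (0 : ℝ)..t, f s) (-M) M :=
    (intervalIntegrable_of_locallyIntegrable hf _ _).absolutelyContinuousOnInterval_intervalIntegral
      (by rw [uIcc_of_le hle]; exact ⟨by linarith, hM0.le⟩)
  have hχ : AbsolutelyContinuousOnInterval χ (-M) M :=
    ((h.of_le (by exact_mod_cast le_top)).contDiffOn).absolutelyContinuousOnInterval
  have z1 : χ M = 0 := image_eq_zero_of_notMem_tsupport fun hn => lt_irrefl _ (hM hn).2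
  have z2 : χ (-M) = 0 := image_eq_zero_of_notMem_tsupport fun hn => lt_irrefl _ (hM hn).1
  rw [e1, e2, hac.integral_mul_deriv_eq_deriv_mul hχ, z1, z2, mul_zero, mul_zero, sub_zero, zero_sub]
  congr 1
  refine intervalIntegral.integral_congr_ae ?_
  filter_upwards [_root_.LocallyIntegrable.ae_hasDerivAt_integral hf] with t ht _
  rw [(ht 0).deriv]

/-- The primitive from the left of the support vanishes to the right of the support exactly because
the total integral is zero. -/
theorem exists_deriv_eq_of_integral_eq_zero {φ : ℝ → ℝ} (h : ContDiff ℝ ∞ φ)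
    (hs : HasCompactSupport φ) (h0 : ∫ t, φ t = 0) :
    ∃ χ : ℝ → ℝ, ContDiff ℝ ∞ χ ∧ HasCompactSupport χ ∧ deriv χ = φ := by
  obtain ⟨M, hM0, hM⟩ := hs.isCompact.isBounded.subset_ball_lt 0 0
  rw [Real.ball_eq_Ioo, zero_sub, zero_add] at hM
  have hd : ∀ t, HasDerivAt (fun t => ∫ s in (-M)..t, φ s) (φ t) t := fun t =>
    intervalIntegral.integral_hasDerivAt_right (h.continuous.intervalIntegrable _ _)
      h.continuous.stronglyMeasurable.stronglyMeasurableAtFilter h.continuous.continuousAt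
  have hd2 : deriv (fun t => ∫ s in (-M)..t, φ s) = φ := funext fun t => (hd t).deriv
  refine ⟨fun t => ∫ s in (-M)..t, φ s, ?_, ?_, hd2⟩
  · rw [contDiff_infty_iff_deriv, hd2]
    exact ⟨fun t => (hd t).differentiableAt, h⟩
  · refine HasCompactSupport.intro (isCompact_Icc (a := -M) (b := M)) fun t ht => ?_
    rcases lt_or_ge t (-M) with h1 | h1
    · refine (intervalIntegral.integral_congr fun s hs => ?_).trans
        (intervalIntegral.integral_zero (E := ℝ) (a := -M) (b := t))
      rw [uIcc_of_ge h1.le] at hs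
      exact image_eq_zero_of_notMem_tsupport fun hn => absurd hs.2 (not_le.2 (hM hn).1)
    · have h2 : M < t := by
        by_contra hn
        exact ht ⟨h1, not_lt.1 hn⟩
      rw [intervalIntegral.integral_eq_integral_of_support_subset, h0]
      exact (subset_tsupport φ).trans (hM.trans fun s hs => ⟨hs.1, (hs.2.trans h2).le⟩)

theorem integrable_mul_test {f χ : ℝ → ℝ} (hf : LocallyIntegrable f) (h : ContDiff ℝ ∞ χ)
    (hs : HasCompactSupport χ) : Integrable fun t => f t * χ t := by
  simpa [mul_comm] using hf.integrable_smul_left_of_hasCompactSupport h.continuous hs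

/-- Every test function is a derivative up to a multiple of a fixed test function. -/
theorem exists_deriv_eq_sub : ∃ η : ℝ → ℝ, ContDiff ℝ ∞ η ∧ HasCompactSupport η ∧
    ∀ φ : ℝ → ℝ, ContDiff ℝ ∞ φ → HasCompactSupport φ →
      ∃ χ : ℝ → ℝ, ContDiff ℝ ∞ χ ∧ HasCompactSupport χ ∧
        deriv χ = fun t => φ t - (∫ s, φ s) * η t := by
  let η : ContDiffBump (0 : ℝ) := ⟨1, 2, one_pos, one_lt_two⟩
  refine ⟨η.normed volume, η.contDiff_normed, η.hasCompactSupport_normed, fun φ h hs => ?_⟩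
  have hη : Integrable (η.normed volume) :=
    η.continuous_normed.integrable_of_hasCompactSupport η.hasCompactSupport_normed
  refine exists_deriv_eq_of_integral_eq_zero (h.sub (contDiff_const.mul η.contDiff_normed))
    (hs.sub η.hasCompactSupport_normed.mul_left) ?_
  rw [integral_sub (h.continuous.integrable_of_hasCompactSupport hs) (hη.const_mul _),
    integral_const_mul, η.integral_normed, mul_one, sub_self]

/-- The lemma of du Bois-Reymond. -/
theorem ae_eq_const_of_integral_mul_deriv {f : ℝ → ℝ} (hf : LocallyIntegrable f) (b : ℝ)
    (h : ∀ χ : ℝ → ℝ, ContDiff ℝ ∞ χ → HasCompactSupport χ →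
      ∫ t, f t * deriv χ t = b * ∫ t, χ t) : ∃ a : ℝ, ∀ᵐ t, f t = a - b * t := by
  obtain ⟨η, k1, k2, k3⟩ := exists_deriv_eq_sub
  have hid : LocallyIntegrable fun t : ℝ => t := continuous_id.locallyIntegrable
  refine ⟨(∫ t, f t * η t) + b * ∫ t, t * η t, ?_⟩
  refine ae_eq_of_integral_contDiff_smul_eq hf
    (by fun_prop : Continuous fun t : ℝ => (∫ t, f t * η t) + b * (∫ t, t * η t) - b * t).locallyIntegrable
    fun φ h1 h2 => ?_
  obtain ⟨χ, c1, c2, c3⟩ := k3 φ h1 h2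
  have e1 := h χ c1 c2
  -- With primitive `t` this reads `∫ t χ' = -∫ χ`. It converts the inhomogeneous term `b ∫ χ` into
  -- an integral against `χ'`, which is known from the choice of `χ`.
  have e2 := integral_primitive_mul_deriv (f := fun _ => 1) continuous_const.locallyIntegrable c1 c2
  simp only [intervalIntegral.integral_const, smul_eq_mul, mul_one, sub_zero, one_mul] at e2
  have iφ := h1.continuous.integrable_of_hasCompactSupport (μ := volume) h2
  have key : ∀ g : ℝ → ℝ, LocallyIntegrable g →
      ∫ t, g t * deriv χ t = (∫ t, g t * φ t) - (∫ s, φ s) * ∫ t, g t * η t := by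
    intro g hg
    rw [← integral_const_mul, ← integral_sub (integrable_mul_test hg h1 h2)
      ((integrable_mul_test hg k1 k2).const_mul _), c3]
    congr 1 with t
    ring
  rw [key f hf] at e1
  rw [key _ hid] at e2
  have e3 : ∫ t, φ t • ((∫ t, f t * η t) + b * (∫ t, t * η t) - b * t)
      = ((∫ t, f t * η t) + b * ∫ t, t * η t) * (∫ t, φ t) - b * ∫ t, t * φ t := by
    generalize (∫ t, f t * η t) + b * ∫ t, t * η t = a
    rw [← integral_const_mul, ← integral_const_mul, ← integral_sub (iφ.const_mul _)
      ((integrable_mul_test hid h1 h2).const_mul _)]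
    congr 1 with t
    rw [smul_eq_mul]
    ring
  rw [e3]
  simp only [smul_eq_mul, mul_comm (φ _)]
  linear_combination e1 + b * e2

/-- Weak solutions of `f'' = g` are twice differentiable. -/
theorem exists_hasDerivAt_of_weak {f g : ℝ → ℝ} (hf : LocallyIntegrable f)
    (hg : LocallyIntegrable g)
    (h : ∀ χ : ℝ → ℝ, ContDiff ℝ ∞ χ → HasCompactSupport χ →
      ∫ t, f t * deriv (deriv χ) t = ∫ t, g t * χ t) :
    ∃ (F : ℝ → ℝ) (c : ℝ), (∀ᵐ t, f t = F t) ∧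
      ∀ t, HasDerivAt F (c + ∫ s in (0 : ℝ)..t, g s) t := by
  have hV : Continuous fun t => ∫ s in (0 : ℝ)..t, g s :=
    intervalIntegral.continuous_primitive (intervalIntegrable_of_locallyIntegrable hg) 0
  have hW : Continuous fun t => ∫ r in (0 : ℝ)..t, ∫ s in (0 : ℝ)..r, g s :=
    intervalIntegral.continuous_primitive
      (intervalIntegrable_of_locallyIntegrable hV.locallyIntegrable) 0
  have hfW : LocallyIntegrable fun t => f t - ∫ r in (0 : ℝ)..t, ∫ s in (0 : ℝ)..r, g s :=
    hf.sub hW.locallyIntegrable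
  -- Subtracting the double primitive of `g` leaves a function with vanishing weak second
  -- derivative, which must be affine.
  have h0 : ∀ χ : ℝ → ℝ, ContDiff ℝ ∞ χ → HasCompactSupport χ →
      ∫ t, (f t - ∫ r in (0 : ℝ)..t, ∫ s in (0 : ℝ)..r, g s) * deriv (deriv χ) t = 0 := by
    intro χ c1 c2
    have c3 : ContDiff ℝ ∞ (deriv χ) := (contDiff_infty_iff_deriv.1 c1).2
    have c4 : ContDiff ℝ ∞ (deriv (deriv χ)) := (contDiff_infty_iff_deriv.1 c3).2
    simp only [sub_mul]
    rw [integral_sub (integrable_mul_test hf c4 c2.deriv.deriv)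
      (integrable_mul_test hW.locallyIntegrable c4 c2.deriv.deriv), h χ c1 c2,
      integral_primitive_mul_deriv hV.locallyIntegrable c3 c2.deriv,
      integral_primitive_mul_deriv hg c1 c2, neg_neg, sub_self]
  obtain ⟨η, k1, k2, k3⟩ := exists_deriv_eq_sub
  set b := ∫ t, (f t - ∫ r in (0 : ℝ)..t, ∫ s in (0 : ℝ)..r, g s) * deriv η t with hb
  have kd : ContDiff ℝ ∞ (deriv η) := (contDiff_infty_iff_deriv.1 k1).2
  -- Testing with `χ` such that `χ' = φ - (∫ φ) η` shows that the first weak derivative is constant: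
  -- the integral against `φ'` is `b ∫ φ`, where `b` is the integral against `η'`.
  obtain ⟨a, ha⟩ := ae_eq_const_of_integral_mul_deriv hfW b fun φ h1 h2 => by
    obtain ⟨χ, c1, c2, c3⟩ := k3 φ h1 h2
    have e := h0 χ c1 c2
    have d1 : ContDiff ℝ ∞ (deriv φ) := (contDiff_infty_iff_deriv.1 h1).2
    have e2 : deriv (deriv χ) = fun t => deriv φ t - (∫ s, φ s) * deriv η t := by
      rw [c3]
      funext t
      exact ((h1.differentiable (by simp) t).hasDerivAt.sub
        ((k1.differentiable (by simp) t).hasDerivAt.const_mul _)).deriv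
    rw [e2] at e
    have e3 : ∫ t, (f t - ∫ r in (0 : ℝ)..t, ∫ s in (0 : ℝ)..r, g s)
          * (deriv φ t - (∫ s, φ s) * deriv η t)
        = (∫ t, (f t - ∫ r in (0 : ℝ)..t, ∫ s in (0 : ℝ)..r, g s) * deriv φ t)
          - (∫ s, φ s) * b := by
      rw [hb, ← integral_const_mul, ← integral_sub (integrable_mul_test hfW d1 h2.deriv)
        ((integrable_mul_test hfW kd k2.deriv).const_mul _)]
      congr 1 with t
      ring
    rw [e3] at e
    linear_combination e
  refine ⟨fun t => (∫ r in (0 : ℝ)..t, ∫ s in (0 : ℝ)..r, g s) + (a - b * t), -b, ?_, fun t => ?_⟩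
  · filter_upwards [ha] with t ht
    linear_combination ht
  · have := (intervalIntegral.integral_hasDerivAt_right (hV.intervalIntegrable 0 t)
      hV.stronglyMeasurable.stronglyMeasurableAtFilter hV.continuousAt).add
      (((hasDerivAt_id t).const_mul b).const_sub a)
    exact this.congr_deriv (by ring)

/-- Weak solutions of `f'' = q f` are classical solutions. -/
theorem exists_hasDerivAt_of_weak_ode {f q : ℝ → ℝ} (hf : LocallyIntegrable f) (hq : Continuous q)
    (h : ∀ χ : ℝ → ℝ, ContDiff ℝ ∞ χ → HasCompactSupport χ →
      ∫ t, f t * (deriv (deriv χ) t - q t * χ t) = 0) :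
    ∃ F G : ℝ → ℝ, (∀ᵐ t, f t = F t) ∧ (∀ t, HasDerivAt F (G t) t) ∧
      ∀ t, HasDerivAt G (q t * F t) t := by
  have hg : LocallyIntegrable fun t => q t * f t := by
    rw [← locallyIntegrableOn_univ] at hf ⊢
    exact hf.continuousOn_mul hq.continuousOn isOpen_univ.isLocallyClosed
  obtain ⟨F, c, h1, h2⟩ := exists_hasDerivAt_of_weak hf hg fun χ c1 c2 => by
    have c3 : ContDiff ℝ ∞ (deriv (deriv χ)) :=
      (contDiff_infty_iff_deriv.1 (contDiff_infty_iff_deriv.1 c1).2).2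
    have := h χ c1 c2
    have e : ∫ t, f t * (deriv (deriv χ) t - q t * χ t)
        = (∫ t, f t * deriv (deriv χ) t) - ∫ t, q t * f t * χ t := by
      rw [← integral_sub (integrable_mul_test hf c3 c2.deriv.deriv) (integrable_mul_test hg c1 c2)]
      congr 1 with t
      ring
    linarith
  have hF : Continuous F := continuous_iff_continuousAt.2 fun t => (h2 t).continuousAt
  have hqF : Continuous fun t => q t * F t := hq.mul hF
  refine ⟨F, _, h1, h2, fun t => ?_⟩
  have e : ∀ t, ∫ s in (0 : ℝ)..t, q s * f s = ∫ s in (0 : ℝ)..t, q s * F s := fun t => by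
    refine intervalIntegral.integral_congr_ae ?_
    filter_upwards [h1] with s hs _
    rw [hs]
  simp only [e]
  exact (intervalIntegral.integral_hasDerivAt_right (hqF.intervalIntegrable 0 t)
    hqF.stronglyMeasurable.stronglyMeasurableAtFilter hqF.continuousAt).const_add c

/-! ### Square integrable solutions of `-Δ u = u` -/

theorem nonpos_of_integrable_of_le_Ici {h : ℝ → ℝ} (hi : Integrable h) {δ t₀ : ℝ}
    (hδ : ∀ t, t₀ ≤ t → δ ≤ h t) : δ ≤ 0 := by
  by_contra! hn
  have h1 : IntegrableOn (fun _ : ℝ => δ) (Ici t₀) := by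
    refine Integrable.mono' hi.integrableOn aestronglyMeasurable_const ?_
    filter_upwards [ae_restrict_mem measurableSet_Ici] with t ht
    rw [Real.norm_of_nonneg hn.le]
    exact hδ t ht
  rw [integrableOn_const_iff] at h1
  simp [hn.ne'] at h1

theorem nonpos_of_integrable_of_le_Iic {h : ℝ → ℝ} (hi : Integrable h) {δ t₀ : ℝ}
    (hδ : ∀ t, t ≤ t₀ → δ ≤ h t) : δ ≤ 0 :=
  nonpos_of_integrable_of_le_Ici hi.comp_neg (t₀ := -t₀) fun t ht => hδ _ (by linarith)

theorem monotone_of_hasDerivAt {f f' : ℝ → ℝ} (h : ∀ t, HasDerivAt f (f' t) t)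
    (h0 : ∀ t, 0 ≤ f' t) : Monotone f :=
  monotone_of_deriv_nonneg (fun t => (h t).differentiableAt) fun t => (h t).deriv ▸ h0 t

theorem antitone_of_hasDerivAt {f f' : ℝ → ℝ} (h : ∀ t, HasDerivAt f (f' t) t)
    (h0 : ∀ t, f' t ≤ 0) : Antitone f :=
  antitone_of_deriv_nonpos (fun t => (h t).differentiableAt) fun t => (h t).deriv ▸ h0 t

/-- The solutions `(F, F')` of the modified Bessel equation `F'' = (ν² + e^{2t}) F` in logarithmic
coordinates that are square integrable for the weight `e^{2t}`. -/
structure BesselSolution (ν : ℝ) (F G : ℝ → ℝ) : Prop where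
  nonneg : 0 ≤ ν
  fst : ∀ t, HasDerivAt F (G t) t
  snd : ∀ t, HasDerivAt G ((ν ^ 2 + Real.exp (2 * t)) * F t) t
  integrable : Integrable fun t => Real.exp (2 * t) * F t ^ 2

/-! ### Sign, decay and uniqueness of square integrable Bessel solutions. -/

namespace BesselSolution

variable {ν : ℝ} {F G : ℝ → ℝ}

/-- The product `F F'` is nondecreasing, its derivative being `F'² + (ν² + e^{2t}) F²`. Were it
positive somewhere, `F²` would be nondecreasing from there on, against integrability at `+∞`. -/
theorem mul_nonpos (h : BesselSolution ν F G) (t₀ : ℝ) : F t₀ * G t₀ ≤ 0 := by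
  by_contra! hn
  have hm : Monotone fun t => F t * G t :=
    monotone_of_hasDerivAt (fun t => (h.fst t).mul (h.snd t)) fun t => by
      have : 0 ≤ (ν ^ 2 + Real.exp (2 * t)) * F t ^ 2 := by positivity
      nlinarith [sq_nonneg (G t)]
  have h2 : MonotoneOn (fun t => F t ^ 2) (Ici t₀) := by
    refine monotoneOn_of_hasDerivWithinAt_nonneg (convex_Ici t₀)
      (fun t _ => ((h.fst t).pow 2).continuousAt.continuousWithinAt)
      (fun t _ => ((h.fst t).pow 2).hasDerivWithinAt) fun t ht => ?_
    rw [interior_Ici] at ht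
    have := hm (le_of_lt ht)
    simp only at this
    simp
    nlinarith
  have h3 := nonpos_of_integrable_of_le_Ici h.integrable (δ := Real.exp (2 * t₀) * F t₀ ^ 2)
    (t₀ := t₀) fun t ht => mul_le_mul (Real.exp_le_exp.2 (by linarith)) (h2 self_mem_Ici ht ht)
      (by positivity) (by positivity)
  have h4 : F t₀ ≠ 0 := fun h0 => by simp [h0] at hn
  have : 0 < Real.exp (2 * t₀) * F t₀ ^ 2 := by positivity
  linarith

/-- The difference `F'² - ν² F²` has derivative `2 e^{2t} F F' ≤ 0`. Were it negative somewhere, `ν²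
F²` would stay bounded below by a positive constant, against integrability at `+∞`. -/
theorem sq_le_sq (h : BesselSolution ν F G) (t₀ : ℝ) : ν ^ 2 * F t₀ ^ 2 ≤ G t₀ ^ 2 := by
  have ha : Antitone fun t => G t ^ 2 - ν ^ 2 * F t ^ 2 :=
    antitone_of_hasDerivAt (fun t => ((h.snd t).pow 2).sub (((h.fst t).pow 2).const_mul (ν ^ 2)))
      fun t => by
        have := mul_nonneg (Real.exp_pos (2 * t)).le (neg_nonneg.2 (h.mul_nonpos t))
        simp
        nlinarith
  have h3 := nonpos_of_integrable_of_le_Ici (h.integrable.const_mul (ν ^ 2))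
    (δ := Real.exp (2 * t₀) * (ν ^ 2 * F t₀ ^ 2 - G t₀ ^ 2)) (t₀ := t₀) fun t ht => by
      have h1 := ha ht
      simp only at h1
      have h2 : Real.exp (2 * t₀) ≤ Real.exp (2 * t) := Real.exp_le_exp.2 (by linarith)
      have h5 : ν ^ 2 * F t₀ ^ 2 - G t₀ ^ 2 ≤ ν ^ 2 * F t ^ 2 := by nlinarith [sq_nonneg (G t)]
      calc _ ≤ Real.exp (2 * t₀) * (ν ^ 2 * F t ^ 2) := by gcongr
        _ ≤ Real.exp (2 * t) * (ν ^ 2 * F t ^ 2) := by gcongr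
        _ = _ := by ring
  nlinarith [Real.exp_pos (2 * t₀)]

theorem mul_le (h : BesselSolution ν F G) (t : ℝ) : F t * G t ≤ -(ν * F t ^ 2) := by
  have h1 := h.mul_nonpos t
  have h2 : (ν * F t ^ 2) ^ 2 ≤ (-(F t * G t)) ^ 2 := by
    nlinarith [mul_le_mul_of_nonneg_right (h.sq_le_sq t) (sq_nonneg (F t))]
  have := abs_le_of_sq_le_sq' h2 (by linarith)
  linarith [this.2]

/-- By `F F' ≤ -ν F²` the logarithmic derivative of `F²` is at most `-2ν`. Read backwards, `|F|`
grows at least like `e^{-νt} = r^{-ν}` towards the tip. -/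
theorem antitone (h : BesselSolution ν F G) : Antitone fun t => F t ^ 2 * Real.exp (2 * ν * t) :=
  antitone_of_hasDerivAt (fun t => ((h.fst t).pow 2).mul
    (((hasDerivAt_id t).const_mul (2 * ν)).exp)) fun t => by
      have := mul_le_mul_of_nonneg_right (h.mul_le t) (Real.exp_pos (2 * ν * t)).le
      simp
      nlinarith

/-- As `t → -∞` the weighted square `e^{2t} F²` is at least a multiple of `e^{(2 - 2ν)t}`, which for
`ν ≥ 1` stays bounded away from zero. -/
theorem eq_zero_of_one_le (h : BesselSolution ν F G) (hν : 1 ≤ ν) (t₀ : ℝ) : F t₀ = 0 := by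
  have h3 := nonpos_of_integrable_of_le_Iic h.integrable
    (δ := F t₀ ^ 2 * Real.exp (2 * ν * t₀) * Real.exp ((2 - 2 * ν) * t₀)) (t₀ := t₀) fun t ht => by
      have h1 := h.antitone ht
      simp only at h1
      have h2 : Real.exp ((2 - 2 * ν) * t₀) ≤ Real.exp ((2 - 2 * ν) * t) :=
        Real.exp_le_exp.2 (mul_le_mul_of_nonpos_left ht (by linarith))
      calc _ ≤ F t ^ 2 * Real.exp (2 * ν * t) * Real.exp ((2 - 2 * ν) * t) := by gcongr
        _ = _ := by rw [mul_assoc, ← Real.exp_add, mul_comm]; ring_nf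
  by_contra hn
  have : 0 < F t₀ ^ 2 * Real.exp (2 * ν * t₀) * Real.exp ((2 - 2 * ν) * t₀) := by positivity
  linarith

/-- Monotonicity of `F² e^{2νt}` propagates a zero forwards. Uniqueness for the Cauchy problem then
propagates it backwards. -/
theorem eq_zero_of_eq_zero (h : BesselSolution ν F G) {t₀ : ℝ} (h0 : F t₀ = 0) (t : ℝ) :
    F t = 0 := by
  have hf : ∀ t, t₀ ≤ t → F t = 0 := fun t ht => by
    have h1 := h.antitone ht
    simp only [h0] at h1
    have h2 := Real.exp_pos (2 * ν * t)
    have : F t ^ 2 ≤ 0 := by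
      by_contra! hn
      have := mul_pos hn h2
      simp at h1
      linarith
    exact pow_eq_zero_iff (two_ne_zero) |>.1 (le_antisymm this (sq_nonneg _))
  rcases le_total t₀ t with ht | ht
  · exact hf t ht
  -- The Cauchy data are taken at `t₀ + 1`, around which `F` vanishes on both sides, so that its
  -- derivative is zero.
  have hG : G (t₀ + 1) = 0 := by
    refine (h.fst (t₀ + 1)).unique ((hasDerivAt_const (t₀ + 1) (0 : ℝ)).congr_of_eventuallyEq ?_)
    filter_upwards [Ioi_mem_nhds (lt_add_one t₀)] with s hs
    exact hf s (le_of_lt hs)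
  -- Grönwall: with `q = ν² + e^{2t}`, the derivative of `F² + F'²` is at most `(1 + q)(F² + F'²)`
  -- in absolute value, and `1 + q ≤ K` for `t ≤ t₀ + 1`.
  set K := 1 + (ν ^ 2 + Real.exp (2 * (t₀ + 1))) with hK
  have hm : MonotoneOn (fun t => (F t ^ 2 + G t ^ 2) * Real.exp (K * t)) (Iic (t₀ + 1)) := by
    have hd : ∀ t, HasDerivAt (fun t => (F t ^ 2 + G t ^ 2) * Real.exp (K * t)) _ t := fun t =>
      (((h.fst t).pow 2).add ((h.snd t).pow 2)).mul (((hasDerivAt_id t).const_mul K).exp)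
    refine monotoneOn_of_hasDerivWithinAt_nonneg (convex_Iic _)
      (fun t _ => (hd t).continuousAt.continuousWithinAt)
      (fun t _ => (hd t).hasDerivWithinAt) fun t ht => ?_
    rw [interior_Iic] at ht
    have h1 : Real.exp (2 * t) ≤ Real.exp (2 * (t₀ + 1)) :=
      Real.exp_le_exp.2 (by linarith [mem_Iio.1 ht])
    have h2 : 0 ≤ (1 + (ν ^ 2 + Real.exp (2 * t))) * (F t + G t) ^ 2 := by positivity
    have h3 : 0 ≤ (Real.exp (2 * (t₀ + 1)) - Real.exp (2 * t)) * (F t ^ 2 + G t ^ 2) :=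
      mul_nonneg (by linarith) (by positivity)
    have h4 : 0 ≤ (2 * (F t * G t) + 2 * (G t * ((ν ^ 2 + Real.exp (2 * t)) * F t))
        + K * (F t ^ 2 + G t ^ 2)) := by
      rw [hK]
      nlinarith
    have := mul_nonneg h4 (Real.exp_pos (K * t)).le
    simp
    nlinarith
  have h1 := hm (a := t) (b := t₀ + 1) (by simp; linarith) self_mem_Iic (by linarith)
  simp only [hf (t₀ + 1) (by linarith), hG] at h1
  have h2 := Real.exp_pos (K * t)
  by_contra hn
  have : 0 < (F t ^ 2 + G t ^ 2) * Real.exp (K * t) := by positivity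
  simp at h1
  linarith

theorem neg (h : BesselSolution ν F G) : BesselSolution ν (fun t => -F t) fun t => -G t :=
  ⟨h.nonneg, fun t => (h.fst t).neg, fun t => (h.snd t).neg.congr_deriv (by ring), by
    simpa using h.integrable⟩

/-- A solution without zeros has constant sign, so its integral against a nonnegative nonzero bump
cannot vanish. Thus one number determines whether the solution is zero, without identifying it as
`K_ν`. -/
theorem eq_zero_of_integral_eq_zero (h : BesselSolution ν F G) {χ : ℝ → ℝ} (hc : Continuous χ)
    (hs : HasCompactSupport χ) (h0 : ∀ t, 0 ≤ χ t) {s : ℝ} (h1 : χ s ≠ 0)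
    (hi : ∫ t, F t * χ t = 0) (t₀ : ℝ) : F t₀ = 0 := by
  have key : ∀ {F G : ℝ → ℝ}, BesselSolution ν F G → ∫ t, F t * χ t = 0 → ¬ 0 < F s := by
    intro F G h hi hp
    have hF : Continuous F := continuous_iff_continuousAt.2 fun t => (h.fst t).continuousAt
    have hn : ∀ t, F t ≠ 0 := fun t ht => hp.ne' (h.eq_zero_of_eq_zero ht s)
    have hpos : ∀ t, 0 < F t := by
      intro t
      by_contra! hle
      obtain ⟨r, -, hr⟩ := isPreconnected_univ.intermediate_value (mem_univ t) (mem_univ s)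
        hF.continuousOn ⟨hle, hp.le⟩
      exact hn r hr
    exact ((hF.mul hc).integral_pos_of_hasCompactSupport_nonneg_nonzero hs.mul_left
      (fun t => mul_nonneg (hpos t).le (h0 t)) (mul_ne_zero hp.ne' h1)).ne' hi
  have hz : F s = 0 := by
    rcases lt_trichotomy (F s) 0 with hlt | heq | hgt
    · exact absurd (neg_pos.2 hlt) (key h.neg (by simp [integral_neg, hi]))
    · exact heq
    · exact absurd hgt (key h hi)
  exact h.eq_zero_of_eq_zero hz t₀

end BesselSolution

/-- Testing `Δu = -u` with `χ(log r) e^{inθ/2}` gives `∫ c (χ'' - ((n/2)² + e^{2t}) χ) = 0` for the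
`n`-th coefficient `c`. A real functional `L`, in practice the real or imaginary part, makes order
arguments available. -/
theorem exists_besselSolution {u : ConeL2} (hu : IsWeakLaplace u (-u)) (n : ℤ) (L : ℂ →L[ℝ] ℝ) :
    ∃ F G : ℝ → ℝ, (∀ᵐ t, L (angularCoeff u n t) = F t) ∧ BesselSolution |(n : ℝ) / 2| F G := by
  have hf : LocallyIntegrable fun t => L (angularCoeff u n t) := fun t => by
    obtain ⟨s, hs, h⟩ := locallyIntegrable_angularCoeff u n t
    exact ⟨s, hs, L.integrable_comp h⟩
  obtain ⟨F, G, h1, h2, h3⟩ := exists_hasDerivAt_of_weak_ode (q := fun t => (n / 2 : ℝ) ^ 2 +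
    Real.exp (2 * t)) hf (by fun_prop) fun χ c1 c2 => by
      have c3 : ContDiff ℝ ∞ (deriv (deriv χ)) :=
        (contDiff_infty_iff_deriv.1 (contDiff_infty_iff_deriv.1 c1).2).2
      have c4 : ContDiff ℝ ∞ fun t => Real.exp (-(2 * t)) * (deriv (deriv χ) t - (n / 2) ^ 2 * χ t) := by
        fun_prop
      have c5 : HasCompactSupport fun t =>
          Real.exp (-(2 * t)) * (deriv (deriv χ) t - (n / 2) ^ 2 * χ t) :=
        (c2.deriv.deriv.sub c2.mul_left).mul_left
      have e1 := hu.integral_eq (logMode_mem c1 c2 n)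
      have e2 : ∫ p, u p * laplace (logMode χ n) p ∂coneMeasure = -∫ p, u p * logMode (fun t =>
          Real.exp (-(2 * t)) * (deriv (deriv χ) t - (n / 2) ^ 2 * χ t)) n p ∂coneMeasure := by
        rw [← integral_neg]
        refine integral_congr_ae ?_
        filter_upwards [ae_pos] with p hp
        rw [laplace_logMode c1 n hp, mul_neg]
      have e3 : ∫ p, (-u : ConeL2) p * logMode χ n p ∂coneMeasure
          = -∫ p, u p * logMode χ n p ∂coneMeasure := by
        rw [← integral_neg]
        refine integral_congr_ae ?_
        filter_upwards [Lp.coeFn_neg u] with p hp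
        rw [hp, Pi.neg_apply, neg_mul]
      obtain ⟨i1, j1⟩ := integral_mul_logMode c1 c2 n u
      obtain ⟨i2, j2⟩ := integral_mul_logMode c4 c5 n u
      rw [e2, e3, j1, j2, neg_inj, ← sub_eq_zero, ← integral_sub i1 i2] at e1
      have e4 := L.integral_comp_comm (i1.sub i2)
      rw [show ∫ t, ((fun t => (Real.exp (2 * t) * χ t) • angularCoeff u n t) - fun t =>
        (Real.exp (2 * t) * (Real.exp (-(2 * t)) * (deriv (deriv χ) t - (n / 2) ^ 2 * χ t))) •
          angularCoeff u n t) t = 0 from e1, map_zero] at e4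
      rw [← neg_eq_zero, ← integral_neg, ← e4]
      congr 1 with t
      have e5 : Real.exp (2 * t) * Real.exp (-(2 * t)) = 1 := by rw [← Real.exp_add]; simp
      simp only [Pi.sub_apply, map_sub, map_smul, smul_eq_mul, ← mul_assoc, e5]
      ring
  refine ⟨F, G, h1, abs_nonneg _, h2, fun t => by simpa only [sq_abs] using h3 t, ?_⟩
  have hF : Continuous F := continuous_iff_continuousAt.2 fun t => (h2 t).continuousAt
  refine ((integrable_exp_mul_norm_sq_angularCoeff u n).const_mul (‖L‖ ^ 2)).mono'
    (by fun_prop : Continuous fun t => Real.exp (2 * t) * F t ^ 2).aestronglyMeasurable ?_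
  filter_upwards [h1] with t ht
  rw [Real.norm_of_nonneg (by positivity), ← ht]
  have h5 : L (angularCoeff u n t) ^ 2 ≤ (‖L‖ * ‖angularCoeff u n t‖) ^ 2 := by
    rw [← sq_abs, ← Real.norm_eq_abs]
    exact pow_le_pow_left₀ (norm_nonneg _) (L.le_opNorm _) 2
  calc _ ≤ Real.exp (2 * t) * (‖L‖ * ‖angularCoeff u n t‖) ^ 2 := by gcongr
    _ = _ := by ring

theorem ae_eq_zero_of_re_im {f : ℝ → ℂ} (h : ∀ L : ℂ →L[ℝ] ℝ, ∀ᵐ t, L (f t) = 0) :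
    f =ᵐ[volume] 0 := by
  filter_upwards [h Complex.reCLM, h Complex.imCLM] with t h1 h2
  exact Complex.ext h1 h2

theorem angularCoeff_eq_zero_of_two_le {u : ConeL2} (hu : IsWeakLaplace u (-u)) {n : ℤ}
    (hn : 2 ≤ |n|) : angularCoeff u n =ᵐ[volume] 0 :=
  ae_eq_zero_of_re_im fun L => by
    obtain ⟨F, G, h1, h2⟩ := exists_besselSolution hu n L
    have h3 : 1 ≤ |(n : ℝ) / 2| := by
      have : (2 : ℝ) ≤ |(n : ℝ)| := by exact_mod_cast hn
      rw [abs_div, abs_two]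
      linarith
    filter_upwards [h1] with t ht
    rw [ht, h2.eq_zero_of_one_le h3]

/-- A bump function on the real line. -/
noncomputable def bump : ContDiffBump (0 : ℝ) := ⟨1, 2, one_pos, one_lt_two⟩

theorem contDiff_bump : ContDiff ℝ ∞ fun t => Real.exp (-(2 * t)) * bump t := by
  have : ContDiff ℝ ∞ bump := bump.contDiff
  fun_prop

theorem hasCompactSupport_bump : HasCompactSupport fun t => Real.exp (-(2 * t)) * bump t :=
  bump.hasCompactSupport.mul_left

theorem angularCoeff_eq_zero_of_integral {u : ConeL2} (hu : IsWeakLaplace u (-u)) {n : ℤ}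
    (h : ∫ p, u p * logMode (fun t => Real.exp (-(2 * t)) * bump t) n p ∂coneMeasure = 0) :
    angularCoeff u n =ᵐ[volume] 0 :=
  ae_eq_zero_of_re_im fun L => by
    obtain ⟨F, G, h1, h2⟩ := exists_besselSolution hu n L
    obtain ⟨i1, j1⟩ := integral_mul_logMode contDiff_bump hasCompactSupport_bump n u
    have e := L.integral_comp_comm i1
    rw [← j1, h, map_zero] at e
    have e2 : ∫ t, F t * bump t = 0 := by
      refine (integral_congr_ae ?_).trans e
      filter_upwards [h1] with t ht
      have e5 : Real.exp (2 * t) * Real.exp (-(2 * t)) = 1 := by rw [← Real.exp_add]; simp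
      rw [← ht, map_smul, smul_eq_mul, ← mul_assoc, e5]
      ring
    filter_upwards [h1] with t ht
    rw [ht, h2.eq_zero_of_integral_eq_zero bump.continuous bump.hasCompactSupport
      (fun t => bump.nonneg) (s := 0) (by
        rw [bump.one_of_mem_closedBall (by simp [bump])]; exact one_ne_zero) e2]

theorem eq_zero_of_isWeakLaplace_neg {u : ConeL2} (hu : IsWeakLaplace u (-u))
    (h : ∀ n : ℤ, |n| ≤ 1 →
      ∫ p, u p * logMode (fun t => Real.exp (-(2 * t)) * bump t) n p ∂coneMeasure = 0) :
    u = 0 :=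
  eq_zero_of_angularCoeff fun n => by
    rcases le_or_gt 2 |n| with hn | hn
    · exact angularCoeff_eq_zero_of_two_le hu hn
    · exact angularCoeff_eq_zero_of_integral hu (h n (by omega))

/-! ### The codimension of the domain of the closure in the domain of the adjoint -/

/-- In the quotient by `D`, the map induced by `B` has rank at most `dim W` and kernel inside the
image of `N`, so the quotient has dimension at most `m`. By `hM` the map `M` embeds `K^m` into it,
hence is onto modulo `D`. -/
theorem top_le_sup_range {K V W : Type*} [Field K] [AddCommGroup V] [Module K V] [AddCommGroup W]
    [Module K W] [FiniteDimensional K W] {D N : Submodule K V} [FiniteDimensional K N]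
    {B : V →ₗ[K] W} (hD : D ≤ LinearMap.ker B) (hB : LinearMap.ker B ≤ D ⊔ N) {m : ℕ}
    (hm : Module.finrank K W + Module.finrank K N ≤ m) {M : (Fin m → K) →ₗ[K] V}
    (hM : ∀ c, M c ∈ D → c = 0) : ⊤ ≤ D ⊔ LinearMap.range M := by
  have hk : LinearMap.ker (D.liftQ B hD) ≤ N.map D.mkQ := by
    rw [Submodule.ker_liftQ]
    refine (Submodule.map_mono hB).trans ?_
    rw [Submodule.map_sup, Submodule.mkQ_map_self, bot_sup_eq]
  have : FiniteDimensional K (LinearMap.ker (D.liftQ B hD)) :=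
    Submodule.finiteDimensional_of_le hk
  have : FiniteDimensional K ((V ⧸ D) ⧸ LinearMap.ker (D.liftQ B hD)) :=
    (D.liftQ B hD).quotKerEquivRange.symm.finiteDimensional
  have : FiniteDimensional K (V ⧸ D) :=
    Module.Finite.of_submodule_quotient (LinearMap.ker (D.liftQ B hD))
  have h1 := (D.liftQ B hD).finrank_range_add_finrank_ker
  have h2 := (LinearMap.range (D.liftQ B hD)).finrank_le
  have h3 := Submodule.finrank_mono hk
  have h4 := Submodule.finrank_map_le D.mkQ N
  have hi : Function.Injective (D.mkQ ∘ₗ M) := by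
    rw [← LinearMap.ker_eq_bot, LinearMap.ker_eq_bot']
    exact fun c hc => hM c ((Submodule.Quotient.mk_eq_zero D).1 hc)
  have h5 := LinearMap.finrank_le_finrank_of_injective hi
  rw [Module.finrank_fin_fun] at h5
  have hs : Function.Surjective (D.mkQ ∘ₗ M) :=
    (LinearMap.injective_iff_surjective_of_finrank_eq_finrank (by
      rw [Module.finrank_fin_fun]; omega)).1 hi
  intro x _
  obtain ⟨c, hc⟩ := hs (D.mkQ x)
  refine Submodule.mem_sup.2 ⟨x - M c, ?_, M c, LinearMap.mem_range_self M c, sub_add_cancel _ _⟩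
  exact (Submodule.Quotient.eq D).1 hc.symm

/-- Nonnegativity passes to the limit: `‖v‖² ≤ Re ⟨v, v + g⟩ ≤ ‖v‖ ‖v + g‖`. -/
theorem IsGraphLimit.norm_le {v g : ConeL2} (h : IsGraphLimit v g) : ‖v‖ ≤ ‖v + g‖ := by
  have h1 : 0 ≤ (inner ℂ v g).re := by
    obtain ⟨φ, h1, h2⟩ := h
    have h3 := (Complex.continuous_re.tendsto _).comp (h1.inner (𝕜 := ℂ) h2)
    refine ge_of_tendsto h3 (Eventually.of_forall fun n => ?_)
    rw [Function.comp_apply, inner_laplaceTest_self, Complex.ofReal_re]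
    positivity
  have h2 : ‖v‖ ^ 2 ≤ ‖v‖ * ‖v + g‖ := by
    have h3 : (inner ℂ v (v + g)).re ≤ ‖v‖ * ‖v + g‖ :=
      (Complex.re_le_norm _).trans (norm_inner_le_norm v (v + g))
    rw [inner_add_right, inner_self_eq_norm_sq_to_K, Complex.add_re] at h3
    have h4 : (((‖v‖ : ℂ)) ^ 2).re = ‖v‖ ^ 2 := by rw [← Complex.ofReal_pow, Complex.ofReal_re]
    have h5 : ((RCLike.ofReal ‖v‖ : ℂ) ^ 2).re = ‖v‖ ^ 2 := h4
    linarith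
  by_contra! hn
  nlinarith [norm_nonneg v, norm_nonneg (v + g)]

/-- The range of `Δ + 1` on the domain of the closure. -/
noncomputable def shiftRange : Submodule ℂ ConeL2 :=
  coneLaplacian.closure.graph.map (LinearMap.fst ℂ ConeL2 ConeL2 + LinearMap.snd ℂ ConeL2 ConeL2)

theorem mem_shiftRange_iff {x : ConeL2} :
    x ∈ shiftRange ↔ ∃ v g, IsGraphLimit v g ∧ v + g = x := by
  constructor
  · rintro ⟨⟨v, g⟩, h, rfl⟩
    exact ⟨v, g, mem_closure_graph_iff.1 h, rfl⟩
  · rintro ⟨v, g, h, rfl⟩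
    exact ⟨(v, g), mem_closure_graph_iff.2 h, rfl⟩

/-- On the closed graph the map `(v, g) ↦ v + g` is bounded below, with constant `2` because `‖g‖ ≤
‖v + g‖ + ‖v‖ ≤ 2 ‖v + g‖`. Such a map on a complete space has closed range. -/
theorem isClosed_shiftRange : IsClosed (shiftRange : Set ConeL2) := by
  have hc : IsClosed (coneLaplacian.closure.graph : Set (ConeL2 × ConeL2)) :=
    coneLaplacian_isClosable.closure_isClosed
  have : CompleteSpace coneLaplacian.closure.graph := hc.isComplete.completeSpace_coe
  let f : coneLaplacian.closure.graph →L[ℂ] ConeL2 :=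
    (ContinuousLinearMap.fst ℂ ConeL2 ConeL2 + ContinuousLinearMap.snd ℂ ConeL2 ConeL2).comp
      coneLaplacian.closure.graph.subtypeL
  have h1 : (shiftRange : Set ConeL2) = range f := by
    ext x
    simp [shiftRange, f]
  rw [h1]
  refine AntilipschitzWith.isClosed_range (K := 2) ?_ f.uniformContinuous
  refine AddMonoidHomClass.antilipschitz_of_bound f fun x => ?_
  obtain ⟨⟨v, g⟩, hx⟩ := x
  have h2 := (mem_closure_graph_iff.1 hx).norm_le
  have h3 : ‖g‖ ≤ ‖v + g‖ + ‖v‖ := by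
    have := norm_sub_le (v + g) v
    rwa [add_sub_cancel_left] at this
  change ‖((v, g) : ConeL2 × ConeL2)‖ ≤ 2 * ‖v + g‖
  rw [Prod.norm_def]
  refine max_le ?_ ?_ <;> simp only <;> linarith [norm_nonneg v]

/-- The solutions of `Δ u = -u` in the domain of the adjoint. -/
def deficiencySpace : Submodule ℂ ConeL2 where
  carrier := {u | IsWeakLaplace u (-u)}
  zero_mem' := fun φ => by simp
  add_mem' := fun hu hv => by
    have := IsWeakLaplace.add hu hv
    rwa [← neg_add] at this
  smul_mem' := fun c u hu => by
    have := IsWeakLaplace.smul c hu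
    rwa [smul_neg] at this

theorem shiftRange_orthogonal_le : shiftRangeᗮ ≤ deficiencySpace := by
  intro u hu φ
  have h := (Submodule.mem_orthogonal _ _).1 hu _
    (mem_shiftRange_iff.2 ⟨_, _, isGraphLimit_test φ, rfl⟩)
  rw [inner_add_left] at h
  rw [inner_neg_right]
  linear_combination -h

/-- Frequencies `|n| ≥ 2` do not occur in a solution, and each of `n = -1, 0, 1` is detected by one
pairing with a bump. -/
theorem exists_injective_deficiencySpace :
    ∃ f : deficiencySpace →ₗ[ℂ] (Fin 3 → ℂ), Function.Injective f := by
  -- The conjugate makes the inner product with `w n`, conjugate linear in the first slot, equal to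
  -- the bilinear pairing with the mode.
  let w : ℤ → ConeL2 := fun n =>
    testToL2 (conjTest ⟨_, logMode_mem contDiff_bump hasCompactSupport_bump n⟩)
  refine ⟨LinearMap.pi fun i =>
    (innerSL ℂ (w (i - 1))).toLinearMap ∘ₗ deficiencySpace.subtype, ?_⟩
  rw [← LinearMap.ker_eq_bot, LinearMap.ker_eq_bot']
  rintro ⟨u, hu⟩ h
  have h1 : ∀ i : Fin 3, inner ℂ (w (i - 1)) u = 0 := fun i => congrFun h i
  have h2 : ∀ n : ℤ, |n| ≤ 1 → inner ℂ (w n) u = 0 := by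
    intro n hn
    rw [abs_le] at hn
    have e : n = -1 ∨ n = 0 ∨ n = 1 := by omega
    rcases e with rfl | rfl | rfl
    · simpa using h1 0
    · simpa using h1 1
    · simpa using h1 2
  refine Subtype.ext (eq_zero_of_isWeakLaplace_neg hu fun n hn => ?_)
  have h3 := h2 n hn
  simp only [w, inner_testToL2_left] at h3
  simpa [conjTest] using h3

instance : FiniteDimensional ℂ deficiencySpace :=
  let ⟨f, hf⟩ := exists_injective_deficiencySpace
  FiniteDimensional.of_injective f hf

theorem finrank_deficiencySpace_le : Module.finrank ℂ deficiencySpace ≤ 3 := by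
  obtain ⟨f, hf⟩ := exists_injective_deficiencySpace
  simpa using LinearMap.finrank_le_finrank_of_injective hf

theorem mem_closure_domain_of_isGraphLimit {v g : ConeL2} (h : IsGraphLimit v g) :
    v ∈ coneLaplacian.closure.domain := mem_closure_domain_iff.2 ⟨g, h⟩

theorem closure_domain_le : coneLaplacian.closure.domain ≤ coneLaplacian.adjoint.domain := by
  intro u hu
  obtain ⟨f, hf⟩ := mem_closure_domain_iff.1 hu
  exact mem_adjoint_domain_iff'.2 ⟨f, hf.isWeakLaplace⟩

theorem memSobolev_hasValueAtTip_of_mem {u : ConeL2} (hu : u ∈ coneLaplacian.closure.domain) :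
    MemSobolev 2 u ∧ HasValueAtTip u 0 := by
  obtain ⟨f, hf⟩ := mem_closure_domain_iff.1 hu
  exact ⟨hf.memSobolev, hf.hasValueAtTip⟩

theorem modelSpan_le {ρ : ℝ → ℝ} (hρ : IsRadialCutoff ρ) :
    modelSpan ρ ≤ coneLaplacian.adjoint.domain := by
  intro u hu
  obtain ⟨c, rfl⟩ := (mem_modelSpan_iff hρ).1 hu
  exact Submodule.sum_mem _ fun i _ => Submodule.smul_mem _ _
    (mem_adjoint_domain_iff'.2 (exists_isWeakLaplace_modelFn hρ i))

/-- Two spaces of dimension at most `3`, the complement of the range of `Δ + 1` and the solutions of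
`Δu = -u`, bound the codimension by `6`. The six model functions, independent modulo the closure,
fill it. -/
theorem adjoint_domain_eq {ρ : ℝ → ℝ} (hρ : IsRadialCutoff ρ) :
    coneLaplacian.adjoint.domain = coneLaplacian.closure.domain ⊔ modelSpan ρ := by
  refine le_antisymm ?_ (sup_le closure_domain_le (modelSpan_le hρ))
  have : CompleteSpace shiftRange := isClosed_shiftRange.isComplete.completeSpace_coe
  have : FiniteDimensional ℂ shiftRangeᗮ :=
    Submodule.finiteDimensional_of_le shiftRange_orthogonal_le
  let A := coneLaplacian.adjoint.domain
  -- The obstruction to writing `(Δ* + 1)u` as `(Δ + 1)v` with `v` in the domain of the closure. As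
  -- the range is closed, the obstruction vanishes exactly when such a `v` exists.
  let B : A →ₗ[ℂ] shiftRangeᗮ := shiftRangeᗮ.orthogonalProjectionOnto.toLinearMap ∘ₗ
    (coneLaplacian.adjoint.toFun + A.subtype)
  have hB : ∀ u : A, B u = 0 ↔ coneLaplacian.adjoint u + u ∈ shiftRange := by
    intro u
    change shiftRangeᗮ.orthogonalProjectionOnto (coneLaplacian.adjoint u + u) = 0 ↔ _
    rw [Submodule.orthogonalProjectionOnto_eq_zero_iff, Submodule.orthogonal_orthogonal]
  let M : (Fin 6 → ℂ) →ₗ[ℂ] A := LinearMap.codRestrict A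
    (Fintype.linearCombination ℂ fun i => (memLp_modelFn hρ i).toLp _) fun c =>
      modelSpan_le hρ ((mem_modelSpan_iff hρ).2 ⟨c, rfl⟩)
  have hMc : ∀ c, (M c : ConeL2) = ∑ i, c i • (memLp_modelFn hρ i).toLp _ := fun c => rfl
  let e : deficiencySpace.comap A.subtype →ₗ[ℂ] deficiencySpace :=
    A.subtype.restrict fun x hx => hx
  have he : Function.Injective e := fun x y h => by
    have : ((x : A) : ConeL2) = y := congrArg (fun z : deficiencySpace => (z : ConeL2)) h
    exact Subtype.ext (Subtype.ext this)
  have : FiniteDimensional ℂ (deficiencySpace.comap A.subtype) := FiniteDimensional.of_injective e he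
  have key := top_le_sup_range (D := coneLaplacian.closure.domain.comap A.subtype)
    (N := deficiencySpace.comap A.subtype) (B := B) (M := M) ?_ ?_ ?_ ?_
  · intro u hu
    obtain ⟨v, hv, _, ⟨c, rfl⟩, h⟩ := Submodule.mem_sup.1 (key (Submodule.mem_top (x := ⟨u, hu⟩)))
    exact Submodule.mem_sup.2 ⟨v, hv, M c, (mem_modelSpan_iff hρ).2 ⟨c, rfl⟩, congrArg Subtype.val h⟩
  · intro u hu
    obtain ⟨f, hf⟩ := mem_closure_domain_iff.1 hu
    rw [LinearMap.mem_ker, hB, (isWeakLaplace_adjoint u).unique hf.isWeakLaplace]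
    exact mem_shiftRange_iff.2 ⟨_, _, hf, add_comm _ _⟩
  · intro u hu
    rw [LinearMap.mem_ker, hB] at hu
    obtain ⟨v, g, hv, h⟩ := mem_shiftRange_iff.1 hu
    have hvD := mem_closure_domain_of_isGraphLimit hv
    refine Submodule.mem_sup.2 ⟨⟨v, closure_domain_le hvD⟩, hvD,
      u - ⟨v, closure_domain_le hvD⟩, ?_, add_sub_cancel _ _⟩
    -- As `u` and `v` have the same image under `Δ + 1`, their difference solves `Δw = -w`.
    have h2 := (isWeakLaplace_adjoint u).add (hv.isWeakLaplace.smul (-1))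
    have h3 : coneLaplacian.adjoint u + (-1 : ℂ) • g = -((u : ConeL2) + (-1 : ℂ) • v) := by
      rw [neg_one_smul, neg_one_smul, ← sub_eq_zero]
      have : coneLaplacian.adjoint u = v + g - u := by rw [h]; abel
      rw [this]
      abel
    rw [h3, neg_one_smul, ← sub_eq_add_neg] at h2
    exact h2
  · have h1 := Submodule.finrank_mono shiftRange_orthogonal_le
    have h2 := LinearMap.finrank_le_finrank_of_injective he
    have h3 := finrank_deficiencySpace_le
    omega
  · intro c hc
    have h1 : (∑ i, c i • (memLp_modelFn hρ i).toLp _ : ConeL2) ∈ coneLaplacian.closure.domain := hc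
    obtain ⟨h2, h3⟩ := memSobolev_hasValueAtTip_of_mem h1
    exact modelSum_coeff_eq_zero hρ h2 h3

/-! ### The three descriptions -/

theorem integral_sub_mul {u v : ConeL2} {φ : Coord → ℂ} (hφ : φ ∈ testFunctions) :
    ∫ p, (u - v : ConeL2) p * φ p ∂coneMeasure
      = (∫ p, u p * φ p ∂coneMeasure) - ∫ p, v p * φ p ∂coneMeasure := by
  have i : ∀ g : ConeL2, Integrable (fun p => g p * φ p) coneMeasure :=
    fun g => (Lp.memLp g).integrable_mul (memLp_of_mem hφ)
  rw [← integral_sub (i u) (i v)]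
  refine integral_congr_ae ?_
  filter_upwards [Lp.coeFn_sub u v] with p hp
  rw [hp, Pi.sub_apply, sub_mul]

theorem IsWeakDx.sub {u v u' v' : ConeL2} (hu : IsWeakDx u u') (hv : IsWeakDx v v') :
    IsWeakDx (u - v) (u' - v') := fun φ hφ => by
  rw [integral_sub_mul hφ, integral_sub_mul (dx_mem hφ), hu φ hφ, hv φ hφ]
  ring

theorem IsWeakDy.sub {u v u' v' : ConeL2} (hu : IsWeakDy u u') (hv : IsWeakDy v v') :
    IsWeakDy (u - v) (u' - v') := fun φ hφ => by
  rw [integral_sub_mul hφ, integral_sub_mul (dy_mem hφ), hu φ hφ, hv φ hφ]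
  ring

theorem MemSobolev.sub {k : ℕ} {u v : ConeL2} (hu : MemSobolev k u) (hv : MemSobolev k v) :
    MemSobolev k (u - v) := by
  induction k generalizing u v with
  | zero => trivial
  | succ k ih =>
    obtain ⟨a, b, h1, h2, h3, h4⟩ := hu
    obtain ⟨a', b', k1, k2, k3, k4⟩ := hv
    exact ⟨a - a', b - b', h1.sub k1, h2.sub k2, ih h3 k3, ih h4 k4⟩

theorem HasValueAtTip.sub {u v : Coord → ℂ} {a b : ℂ} (hu : HasValueAtTip u a)
    (hv : HasValueAtTip v b) : HasValueAtTip (u - v) (a - b) := by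
  obtain ⟨g, h1, h2, h3⟩ := hu
  obtain ⟨g', k1, k2, k3⟩ := hv
  exact ⟨g - g', h1.sub k1, h2.sub k2, h3.sub k3⟩

theorem HasValueAtTip.congr_ae {u v : Coord → ℂ} {a : ℂ} (hu : HasValueAtTip u a)
    (h : v =ᵐ[coneMeasure] u) : HasValueAtTip v a := by
  obtain ⟨g, h1, h2, h3⟩ := hu
  exact ⟨g, h.trans h1, h2, h3⟩

theorem isRadialCutoff_bump : IsRadialCutoff bump where
  smooth := (bump.contDiff : ContDiff ℝ ∞ bump).contDiffOn
  eq_one := ⟨1, one_pos, fun r h1 h2 => bump.one_of_mem_closedBall (by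
    simpa [bump, abs_of_pos h1] using h2)⟩
  eq_zero := ⟨2, fun r h => bump.zero_of_le_dist (by
    simpa [bump] using h.trans (le_abs_self r))⟩

theorem disjoint_modelSpan {ρ : ℝ → ℝ} (hρ : IsRadialCutoff ρ) :
    Disjoint coneLaplacian.closure.domain (modelSpan ρ) := by
  refine Submodule.disjoint_def.2 fun u h1 h2 => ?_
  obtain ⟨c, rfl⟩ := (mem_modelSpan_iff hρ).1 h2
  obtain ⟨h3, h4⟩ := memSobolev_hasValueAtTip_of_mem h1
  simp [modelSum_coeff_eq_zero hρ h3 h4]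

/-- The second derivatives give a weak Laplacian in `L²`, so `u` lies in the domain of the adjoint.
Its model part is a difference of two functions in `H²` vanishing at the tip, hence zero by
independence. Any one cutoff serves. -/
theorem mem_closure_domain_of_memSobolev {u : ConeL2} (h1 : MemSobolev 2 u)
    (h2 : HasValueAtTip u 0) : u ∈ coneLaplacian.closure.domain := by
  have h3 : u ∈ coneLaplacian.adjoint.domain := mem_adjoint_domain_iff'.2 h1.exists_isWeakLaplace
  rw [adjoint_domain_eq isRadialCutoff_bump] at h3
  obtain ⟨v, hv, m, hm, rfl⟩ := Submodule.mem_sup.1 h3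
  obtain ⟨c, rfl⟩ := (mem_modelSpan_iff isRadialCutoff_bump).1 hm
  obtain ⟨h4, h5⟩ := memSobolev_hasValueAtTip_of_mem hv
  have h6 := h1.sub h4
  have h7 := (h2.sub h5).congr_ae (Lp.coeFn_sub _ _)
  rw [add_sub_cancel_left] at h6 h7
  rw [sub_zero] at h7
  rw [modelSum_coeff_eq_zero isRadialCutoff_bump h6 h7]
  simpa using hv

theorem closure_adjoint_domain_eq :
    coneLaplacian.closure.adjoint.domain = coneLaplacian.adjoint.domain := by
  ext u
  rw [mem_closure_adjoint_domain_iff, mem_adjoint_domain_iff']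

/-- The form is the Dirichlet energy, so form-Cauchy sequences have `∂_x` derivatives that are
Cauchy in `L²`. This alone rules out the `log r` and `r^{-1/2}` terms. -/
theorem exists_isWeakDx_of_mem_formDomain {u : ConeL2} (hu : u ∈ formDomain coneLaplacian) :
    ∃ v, IsWeakDx u v := by
  obtain ⟨x, h1, h2⟩ := hu
  choose φ hφ using fun n => LinearMap.mem_range.1 (x n).2
  have e : ∀ n, x n = ⟨testToL2 (φ n), LinearMap.mem_range_self _ _⟩ := fun n =>
    Subtype.ext (hφ n).symm
  have h3 : ∀ q : ℕ × ℕ, inner ℂ ((x q.1 - x q.2 : coneLaplacian.domain) : ConeL2)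
      (coneLaplacian (x q.1 - x q.2))
        = ((‖testToL2 (dxTest (φ q.1 - φ q.2))‖ ^ 2
          + ‖testToL2 (dyTest (φ q.1 - φ q.2))‖ ^ 2 : ℝ) : ℂ) := by
    intro q
    have e2 : x q.1 - x q.2 = ⟨testToL2 (φ q.1 - φ q.2), LinearMap.mem_range_self _ _⟩ := by
      rw [e, e]
      exact Subtype.ext (map_sub testToL2 _ _).symm
    rw [e2, coneLaplacian_apply, inner_laplaceTest_self]
  have h4 : CauchySeq fun n => testToL2 (dxTest (φ n)) := by
    rw [cauchySeq_iff_tendsto_dist_atTop_0]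
    have h5 : Tendsto (fun q : ℕ × ℕ => ‖testToL2 (dxTest (φ q.1 - φ q.2))‖ ^ 2
        + ‖testToL2 (dyTest (φ q.1 - φ q.2))‖ ^ 2) atTop (𝓝 0) := by
      have := (Complex.continuous_re.tendsto 0).comp (h2.congr h3)
      simpa only [Function.comp_def, Complex.ofReal_re, Complex.zero_re] using this
    have h6 := (Real.continuous_sqrt.tendsto 0).comp h5
    rw [Real.sqrt_zero] at h6
    refine squeeze_zero (fun q => dist_nonneg) (fun q => ?_) h6
    rw [dist_eq_norm, ← map_sub, ← map_sub]
    exact Real.le_sqrt_of_sq_le (le_add_of_nonneg_right (sq_nonneg _))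
  obtain ⟨v, hv⟩ := cauchySeq_tendsto_of_complete h4
  exact ⟨v, isWeakDx_of_tendsto (by simpa only [hφ] using h1) hv⟩

theorem exists_expansion_of_mem_friedrichsDomain {ρ : ℝ → ℝ} (hρ : IsRadialCutoff ρ) {u : ConeL2}
    (hu : u ∈ friedrichsDomain coneLaplacian) :
    ∃ a₀ a₁ a₂ : ℂ, ∃ v ∈ coneLaplacian.closure.domain,
      u =ᵐ[coneMeasure] (fun p => (a₀ + a₁ * (√p.1 : ℂ) * halfExp (-1) p.2
        + a₂ * (√p.1 : ℂ) * halfExp 1 p.2) * (ρ p.1 : ℂ) + v p) := by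
  have h := hu.1
  rw [adjoint_domain_eq hρ] at h
  obtain ⟨v, hv, m, hm, rfl⟩ := Submodule.mem_sup.1 h
  obtain ⟨c, rfl⟩ := (mem_modelSpan_iff hρ).1 hm
  obtain ⟨w, hw⟩ := exists_isWeakDx_of_mem_formDomain hu.2
  obtain ⟨⟨v', -, hv', -⟩, -⟩ := memSobolev_hasValueAtTip_of_mem hv
  have h1 := hw.sub hv'
  -- The closure part also has `∂_x` in `L²`; subtracting it leaves the model part alone.
  rw [add_sub_cancel_left] at h1
  obtain ⟨c1, c4, c5⟩ := singular_coeff_eq_zero hρ h1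
  refine ⟨c 0, c 3, c 2, v, hv, ?_⟩
  filter_upwards [Lp.coeFn_add v _, coeFn_sum_modelFn hρ c] with p h2 h3
  rw [h2, Pi.add_apply, h3, Fin.sum_univ_six, c1, c4, c5, Real.sqrt_eq_rpow]
  simp only [modelFn, radialMode, modelRadial, modelIndex, Matrix.cons_val, halfExp_zero]
  push_cast
  ring

theorem hasValueAtTip_sub_of_expansion {ρ : ℝ → ℝ} (hρ : IsRadialCutoff ρ) {u v F : Coord → ℂ}
    (hv : HasValueAtTip v 0) (hF : Continuous F)
    (h : u =ᵐ[coneMeasure] fun p => F p * (ρ p.1 : ℂ) + v p) :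
    HasValueAtTip (fun p => u p - F p) 0 := by
  obtain ⟨g, h1, h2, h3⟩ := hv
  obtain ⟨ε, hε, hone⟩ := hρ.eq_one
  refine ⟨fun p => F p * ((ρ p.1 : ℂ) - 1) + g p, ?_, ?_, ?_⟩
  · filter_upwards [h, h1] with p hp hp1
    rw [hp, hp1]
    ring
  · have hc : ContinuousOn (fun p : Coord => (ρ p.1 : ℂ)) punctured :=
      Complex.continuous_ofReal.comp_continuousOn
        (hρ.smooth.continuousOn.comp continuous_fst.continuousOn fun p hp => hp)
    exact (hF.continuousOn.mul (hc.sub continuousOn_const)).add h2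
  · refine h3.congr' ?_
    have : ∀ᶠ r in 𝓝[>] (0 : ℝ), r ∈ Ioo 0 ε := Ioo_mem_nhdsGT hε
    filter_upwards [tendsto_comap.eventually this] with p hp
    rw [hone p.1 hp.1 hp.2.le]
    simp

end FlatCone

theorem mainTheorem11 :
    -- the closure of the Laplace operator on test functions
    (∀ u : FlatCone.ConeL2, u ∈ FlatCone.coneLaplacian.closure.domain ↔
      FlatCone.MemSobolev 2 u ∧ FlatCone.HasValueAtTip u 0) ∧
    -- the domain of its adjoint
    (∀ ρ : ℝ → ℝ, FlatCone.IsRadialCutoff ρ →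
      (∀ f ∈ FlatCone.modelFunctions ρ, MemLp f 2 FlatCone.coneMeasure) ∧
      Disjoint FlatCone.coneLaplacian.closure.domain (FlatCone.modelSpan ρ) ∧
      FlatCone.coneLaplacian.closure.adjoint.domain =
        FlatCone.coneLaplacian.closure.domain ⊔ FlatCone.modelSpan ρ) ∧
    -- the expansion of the elements of the Friedrichs domain
    (∀ ρ : ℝ → ℝ, FlatCone.IsRadialCutoff ρ →
      ∀ u ∈ FlatCone.friedrichsDomain FlatCone.coneLaplacian,
        ∃ a₀ a₁ a₂ : ℂ, ∃ v ∈ FlatCone.coneLaplacian.closure.domain,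
          u =ᵐ[FlatCone.coneMeasure] (fun p =>
            (a₀ + a₁ * (√p.1 : ℂ) * FlatCone.halfExp (-1) p.2
              + a₂ * (√p.1 : ℂ) * FlatCone.halfExp 1 p.2) * (ρ p.1 : ℂ) + v p) ∧
          FlatCone.HasValueAtTip (fun p =>
            u p - a₀ - a₁ * (√p.1 : ℂ) * FlatCone.halfExp (-1) p.2
              - a₂ * (√p.1 : ℂ) * FlatCone.halfExp 1 p.2) 0) := by
  refine ⟨fun u => ⟨FlatCone.memSobolev_hasValueAtTip_of_mem, fun h =>
    FlatCone.mem_closure_domain_of_memSobolev h.1 h.2⟩, fun ρ hρ => ⟨?_,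
    FlatCone.disjoint_modelSpan hρ,
    FlatCone.closure_adjoint_domain_eq.trans (FlatCone.adjoint_domain_eq hρ)⟩, fun ρ hρ u hu => ?_⟩
  · rw [FlatCone.modelFunctions_eq]
    rintro _ ⟨i, rfl⟩
    exact FlatCone.memLp_modelFn hρ i
  · obtain ⟨a₀, a₁, a₂, v, hv, h⟩ := FlatCone.exists_expansion_of_mem_friedrichsDomain hρ hu
    refine ⟨a₀, a₁, a₂, v, hv, h, ?_⟩
    have h1 := FlatCone.continuous_halfExp (-1)
    have h2 := FlatCone.continuous_halfExp 1
    have h3 := FlatCone.hasValueAtTip_sub_of_expansion hρ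
      (FlatCone.memSobolev_hasValueAtTip_of_mem hv).2 (by fun_prop) h
    refine h3.congr_ae (Eventually.of_forall fun p => ?_)
    ring
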